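/- A POMDP is a tuple $\Lambda=(Q,A,\delta,\Omega,O)$ with $Q,A$ finite non-empty sets of states and actions, $\delta:Q\times A\to\mathcal D(Q)$ (probability distributions on $Q$), $\Omega$ a non-empty set of observations and $O:Q\to\Omega$. For $b\in\mathcal D(Q)$, $a\in A$, $o\in\Omega$ let $p(b,a,o):=\sum_{q\in O^{-1}(o)}\sum_{q'\in Q}b(q')\,\delta(q',a)(q)$, and, if $p(b,a,o)>0$, let $\lambda[b,a,o](q):=\frac{1}{p(b,a,o)}\sum_{q'\in Q}b(q')\,\delta(q',a)(q)$ if $O(q)=o$ and $:=0$ otherwise. $\Lambda$ is Dirac-preserving if for all $q\in Q$ (seen as a Dirac belief), $a\in A$ and $o$ with $p(q,a,o)>0$, the support of $\lambda[q,a,o]$ has exactly one element. The parity objective $W_f\subseteq Q^\omega$ of a labelling $f:Q\to\mathbb N$ is the set of infinite paths whose highest label seen infinitely often is even; it is observation-compatible if $f(q_1)=f(q_2)$ whenever $O(q_1)=O(q_2)$. The value is $\mathsf{val}(\Lambda,b,W):=\sup_\kappa\sum_{q}b(q)\,\mathbb P^\kappa_q[\Lambda,W]$, the supremum being over strategies $\kappa:\Omega\cdot(A\cdot\Omega)^*\to\mathcal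 D(A)$, which see only the observations (including that of the initial state). An MEMDP is a tuple $\Gamma=(Q',A,E,(\delta_e)_{e\in E})$ with $Q',A,E$ finite non-empty and each $\Gamma[e]=(Q',A,\delta_e)$ an MDP; for $b'\in\mathcal D(E)$ its prior value at $q'\in Q'$ is $\mathsf{val}^{\mathsf{pr}}_{q'}(\Gamma,b',W'):=\sup_\sigma\sum_{e}b'(e)\,\mathbb P^\sigma_{q'}[\Gamma[e],W']$, over strategies $\sigma:Q'\cdot(A\cdot Q')^*\to\mathcal D(A)$. **Theorem.** 1. There is an algorithm running in exponential time (a Turing machine making at most $2^{p(n)}$ steps on inputs of length $n$, for some polynomial $p$) which, given a Dirac-preserving POMDP $\Lambda=(Q,A,\delta,\Omega,O)$ with rational probabilities, a labelling $f$ of $Q$ inducing an observation-compatible parity objective $W_f$, and a rational initial belief $b\in\mathcal D(Q)$, all listed explicitly with numbers in binary, outputs an explicitly listed MEMDP $\Gamma=(Q',A,E,(\delta_e)_{e\in E})$ with the same actions, a labelling $f'$ of $Q'$, an environment belief $b'\in\mathcal D(E)$ and a state $q'\in Q'$ such that $$\mathsf{val}(\Lambda,b,W_f)=\mathsf{val}^{\mathsf{pr}}_{q'}(\Gamma,b',W_{f'}).$$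 2. For arbitrary real probabilities the same reduction exists with exponential size: there is a polynomial $p$ such that for every Dirac-preserving POMDP $\Lambda=(Q,A,\delta,\Omega,O)$, every observation-compatible parity objective $W_f$ and every $b\in\mathcal D(Q)$ there are an MEMDP $\Gamma=(Q',A,E,(\delta_e)_{e\in E})$ with $|Q'|,|E|\le 2^{p(|Q|)}$, a labelling $f'$ of $Q'$, a belief $b'\in\mathcal D(E)$ and a state $q'\in Q'$ with $\mathsf{val}(\Lambda,b,W_f)=\mathsf{val}^{\mathsf{pr}}_{q'}(\Gamma,b',W_{f'})$. -/

import Mathlib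

open MeasureTheory ProbabilityTheory
open scoped ENNReal NNReal

noncomputable section

/-! ### Runs, strategies, parity objectives -/

/-- Finite runs `q₀ · (a₁, q₁) ⋯ (aₙ, qₙ)`, i.e. elements of `Q · (A · Q)^*`. -/
abbrev FinRun (Q A : Type*) := Q × List (A × Q)

/-- The last state of a finite run. -/
def FinRun.head {Q A : Type*} (ρ : FinRun Q A) : Q :=
  (ρ.2.getLast?.map Prod.snd).getD ρ.1

/-- Replace every state of a finite run by its image under `g`. -/
def FinRun.mapStates {Q Ω A : Type*} (g : Q → Ω) (ρ : FinRun Q A) : FinRun Ω A :=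
  (g ρ.1, ρ.2.map fun x => (x.1, g x.2))

/-- Strategies map finite runs to probability distributions over actions. -/
abbrev Strategy (Q A : Type*) := FinRun Q A → PMF A

/-- The parity objective induced by a labelling: the infinite paths whose highest label seen
infinitely often is even. -/
def parityObjective {Q : Type*} (f : Q → ℕ) : Set (ℕ → Q) :=
  {ρ | ∃ n, IsGreatest {n | ∀ i, ∃ j ≥ i, f (ρ j) = n} n ∧ Even n}

/-! ### Markov decision processes -/

/-- A Markov decision process with states `Q` and actions `A`. -/
structure MDP (Q A : Type*) where
  δ : Q → A → PMF Q

namespace MDP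

variable {Q A : Type*}

/-- The distribution of the next action-state pair `(a, q)` after the finite run `ρ`:
its mass at `(a, q)` is `σ(ρ)(a) · δ(head ρ, a)(q)`. -/
def next (G : MDP Q A) (σ : Strategy Q A) (ρ : FinRun Q A) : PMF (A × Q) :=
  (σ ρ).bind fun a => (G.δ ρ.head a).map fun q => (a, q)

/-- The distribution of the next action-state pair, as a kernel on the first `n + 1` pairs
`(a₁, q₁), …, (aₙ₊₁, qₙ₊₁)` of a run from `q`. -/
def nextKernel [Countable Q] [Countable A] (G : MDP Q A) (σ : Strategy Q A) (q : Q) (n : ℕ) :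
    @Kernel (Finset.Iic n → A × Q) (A × Q) (@MeasurableSpace.pi _ _ fun _ => ⊤) ⊤ :=
  letI : MeasurableSpace (A × Q) := ⊤
  Kernel.ofFunOfCountable fun h =>
    (G.next σ (q, List.ofFn fun i : Fin (n + 1) =>
      h ⟨i, Finset.mem_Iic.2 (Nat.lt_succ_iff.1 i.2)⟩)).toMeasure

instance [Countable Q] [Countable A] (G : MDP Q A) (σ : Strategy Q A) (q : Q) (n : ℕ) :
    @IsMarkovKernel _ _ (@MeasurableSpace.pi _ _ fun _ => ⊤) ⊤ (G.nextKernel σ q n) :=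
  letI : MeasurableSpace (A × Q) := ⊤
  ⟨fun _ => PMF.toMeasure.isProbabilityMeasure _⟩

/-- The law of the infinite run `q · (a₁, q₁)(a₂, q₂) ⋯` played from the state `q` with the
strategy `σ`. It is carried by the sequences `n ↦ (aₙ₊₁, qₙ₊₁)`, with the product of the
discrete `σ`-algebras, and is obtained from the one-step distributions `next` by the
Ionescu-Tulcea theorem. -/
def runMeasure [Countable Q] [Countable A] (G : MDP Q A) (σ : Strategy Q A) (q : Q) :
    @Measure (ℕ → A × Q) (@MeasurableSpace.pi ℕ (fun _ => A × Q) fun _ => ⊤) :=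
  letI : MeasurableSpace (A × Q) := ⊤
  Kernel.trajMeasure (X := fun _ => A × Q) (G.next σ (q, [])).toMeasure (G.nextKernel σ q)

/-- The infinite path `q · q₁ · q₂ ⋯` of states of the infinite run
`q · (a₁, q₁)(a₂, q₂) ⋯`. -/
def path (q : Q) (x : ℕ → A × Q) : ℕ → Q
  | 0 => q
  | n + 1 => (x n).2

/-- The probability that the infinite path from `q` under `σ` lies in `W`. -/
def prob [Countable Q] [Countable A] (G : MDP Q A) (σ : Strategy Q A) (q : Q)
    (W : Set (ℕ → Q)) : ℝ≥0∞ :=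
  G.runMeasure σ q {x | path q x ∈ W}

end MDP

/-! ### Multi-environment Markov decision processes -/

/-- An MEMDP with states `Q`, actions `A` and environments `E`. -/
structure MEMDP (Q A E : Type*) where
  δ : E → Q → A → PMF Q

/-- The MDP `Γ[e]` of the environment `e`. -/
def MEMDP.env {Q A E : Type*} (Γ : MEMDP Q A E) (e : E) : MDP Q A := ⟨Γ.δ e⟩

/-- The prior value of `Γ` at the state `q` for the environment belief `b`. -/
def MEMDP.priorValue {Q A E : Type*} [Countable Q] [Countable A]
    (Γ : MEMDP Q A E) (b : PMF E) (q : Q) (W : Set (ℕ → Q)) : ℝ≥0∞ :=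
  ⨆ σ : Strategy Q A, ∑' e, b e * (Γ.env e).prob σ q W

/-! ### Partially observable Markov decision processes -/

/-- A POMDP with states `Q`, actions `A` and observations `Ω`. -/
structure POMDP (Q A Ω : Type*) extends MDP Q A where
  obs : Q → Ω

namespace POMDP

variable {Q A Ω : Type*}

/-- The value of the initial belief `b`: the player sees only the observations, so the
strategies read the images of the finite runs under the observation map. -/
def value [Countable Q] [Countable A] (Λ : POMDP Q A Ω) (b : PMF Q)
    (W : Set (ℕ → Q)) : ℝ≥0∞ :=
  ⨆ κ : Strategy Ω A, ∑' q, b q * Λ.toMDP.prob (fun ρ => κ (ρ.mapStates Λ.obs)) q W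

/-- The likelihood `p(b, a, o)` of the observation `o` after playing `a` with belief `b`. -/
def likelihood (Λ : POMDP Q A Ω) (b : PMF Q) (a : A) (o : Ω) : ℝ≥0∞ :=
  ∑' q : {q // Λ.obs q = o}, ∑' q', b q' * Λ.δ q' a q

/-- The observations compatible with `(b, a)`. -/
def Comp (Λ : POMDP Q A Ω) (b : PMF Q) (a : A) : Set Ω :=
  {o | 0 < Λ.likelihood b a o}

open Classical in
/-- The updated belief `λ[b, a, o]`, meaningful for `o ∈ Comp(b, a)`. -/
def updatedBelief (Λ : POMDP Q A Ω) (b : PMF Q) (a : A) (o : Ω) (q : Q) : ℝ≥0∞ :=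
  if Λ.obs q = o then (∑' q', b q' * Λ.δ q' a q) / Λ.likelihood b a o else 0

/-- Dirac beliefs stay Dirac: from a known state, after any action and any compatible
observation, the support of the updated belief has exactly one element. -/
def DiracPreserving (Λ : POMDP Q A Ω) : Prop :=
  ∀ (q : Q) (a : A), ∀ o ∈ Λ.Comp (PMF.pure q) a,
    (Function.support (Λ.updatedBelief (PMF.pure q) a o)).encard = 1

/-- A labelling is observation-compatible if it depends only on the observation. -/
def ObsCompatible (Λ : POMDP Q A Ω) (f : Q → ℕ) : Prop :=
  ∀ q₁ q₂, Λ.obs q₁ = Λ.obs q₂ → f q₁ = f q₂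

end POMDP

/-! ### Finite descriptions with rational probabilities -/

/-- Rational probability distributions on `{0, …, k - 1}`. -/
abbrev RatDist (k : ℕ) := {w : Fin k → ℚ≥0 // ∑ i, w i = 1}

/-- A rational distribution, as a distribution. -/
def RatDist.toPMF {k : ℕ} (w : RatDist k) : PMF (Fin k) :=
  PMF.ofFintype (fun i => ((w.1 i : ℝ≥0) : ℝ≥0∞)) <| by
    have h : ∑ i, ((w.1 i : ℚ≥0) : ℝ≥0) = 1 := by
      rw [← NNRat.cast_sum, w.2, NNRat.cast_one]
    exact_mod_cast h

/-- A finite POMDP with rational probabilities, a labelling of its states and a rational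
initial belief. The states, actions and observations are named by natural numbers. -/
structure POMDPInstance where
  numStates : ℕ
  numActions : ℕ
  actions_pos : 0 < numActions
  obs : Fin numStates → ℕ
  label : Fin numStates → ℕ
  belief : RatDist numStates
  δ : Fin numStates → Fin numActions → RatDist numStates

/-- The POMDP described by an instance. -/
def POMDPInstance.toPOMDP (I : POMDPInstance) :
    POMDP (Fin I.numStates) (Fin I.numActions) ℕ where
  δ q a := (I.δ q a).toPMF
  obs := I.obs

/-- The instances whose POMDP is Dirac-preserving and whose labelling, hence whose parity
objective, is observation-compatible. -/
abbrev DiracInstance :=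
  {I : POMDPInstance // I.toPOMDP.DiracPreserving ∧ I.toPOMDP.ObsCompatible I.label}

/-- A finite MEMDP with rational probabilities, a labelling of its states, a rational
environment belief and a distinguished state. -/
structure MEMDPInstance where
  numStates : ℕ
  numActions : ℕ
  numEnvs : ℕ
  init : Fin numStates
  label : Fin numStates → ℕ
  belief : RatDist numEnvs
  δ : Fin numEnvs → Fin numStates → Fin numActions → RatDist numStates

/-- The MEMDP described by an instance. -/
def MEMDPInstance.toMEMDP (J : MEMDPInstance) :
    MEMDP (Fin J.numStates) (Fin J.numActions) (Fin J.numEnvs) where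
  δ e q a := (J.δ e q a).toPMF

/-! ### Encodings over the alphabet `{0, 1, #}`

The letters are `some false`, `some true` and the separator `none`. Sizes and state names are
written in unary, all other numbers in binary (least significant bit first); distributions and
transition functions are written out as tables of reduced fractions. -/

/-- `w₁ # w₂ # ⋯ wₙ #`. -/
def encodeWords (L : List (List Bool)) : List (Option Bool) :=
  (L.map fun w => w.map some ++ [none]).flatten

/-- `n` in unary. -/
def unaryWord (n : ℕ) : List Bool := List.replicate n true

/-- A rational distribution, as its list of numerators and denominators in binary. -/
def RatDist.words {k : ℕ} (w : RatDist k) : List (List Bool) :=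
  (List.ofFn fun i => [Nat.bits (w.1 i).num, Nat.bits (w.1 i).den]).flatten

def POMDPInstance.words (I : POMDPInstance) : List (List Bool) :=
  [unaryWord I.numStates, unaryWord I.numActions] ++
    ((List.ofFn fun q => Nat.bits (I.obs q)) ++
    ((List.ofFn fun q => Nat.bits (I.label q)) ++
    (I.belief.words ++
    (List.ofFn fun q => (List.ofFn fun a => (I.δ q a).words).flatten).flatten)))

def MEMDPInstance.words (J : MEMDPInstance) : List (List Bool) :=
  [unaryWord J.numStates, unaryWord J.numActions, unaryWord J.numEnvs, unaryWord J.init] ++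
    ((List.ofFn fun q => Nat.bits (J.label q)) ++
    (J.belief.words ++
    (List.ofFn fun e => (List.ofFn fun q =>
      (List.ofFn fun a => (J.δ e q a).words).flatten).flatten).flatten))

/-- The encoding of the inputs. -/
def encodePOMDP (I : POMDPInstance) : List (Option Bool) := encodeWords I.words

/-- The encoding of the outputs. -/
def encodeMEMDP (J : MEMDPInstance) : List (Option Bool) := encodeWords J.words

/-! #### The encodings are injective -/

theorem encodeWords_injective : Function.Injective encodeWords := by
  have cancel : ∀ (w w' : List Bool) (r r' : List (Option Bool)),
      w.map some ++ none :: r = w'.map some ++ none :: r' → w = w' ∧ r = r' := by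
    intro w
    induction w with
    | nil => intro w' r r' h; cases w' <;> simp_all
    | cons x w ih =>
      intro w' r r' h
      cases w' with
      | nil => simp at h
      | cons y w' =>
        simp only [List.map_cons, List.cons_append, List.cons.injEq, Option.some.injEq] at h
        obtain ⟨h1, h2⟩ := ih _ _ _ h.2
        exact ⟨by rw [h.1, h1], h2⟩
  intro L
  induction L with
  | nil => intro L' h; cases L' <;> simp_all [encodeWords]
  | cons w L ih =>
    intro L' h
    cases L' with
    | nil => simp [encodeWords] at h
    | cons w' L' =>
      simp only [encodeWords, List.map_cons, List.flatten_cons, List.append_assoc,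
        List.singleton_append] at h
      obtain ⟨h1, h2⟩ := cancel _ _ _ _ h
      rw [h1, ih h2]

theorem unaryWord_injective : Function.Injective unaryWord :=
  fun _ _ h => List.replicate_left_injective true h

theorem bits_injective : Function.Injective Nat.bits := by
  intro a b h
  have key : ∀ n : ℕ, (Nat.bits n).foldr (fun c m => Nat.bit c m) 0 = n := by
    intro n
    induction n using Nat.binaryRec' with
    | zero => simp
    | bit c n hn ih => rw [Nat.bits_append_bit _ _ hn, List.foldr_cons, ih]
  rw [← key a, h, key b]

theorem ofFn_flatten_injective {α : Type*} {k c : ℕ} {f g : Fin k → List α}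
    (hf : ∀ i, (f i).length = c) (hg : ∀ i, (g i).length = c)
    (h : (List.ofFn f).flatten = (List.ofFn g).flatten) : f = g := by
  refine List.ofFn_injective (List.eq_iff_flatten_eq.2 ⟨h, ?_⟩)
  simp only [List.map_ofFn]
  congr 1
  funext i
  simp [hf, hg]

theorem ofFn_flatten_length {α : Type*} {k c : ℕ} {f : Fin k → List α}
    (hf : ∀ i, (f i).length = c) : (List.ofFn f).flatten.length = k * c := by
  simp [List.length_flatten, List.map_ofFn, Function.comp_def, hf]

theorem RatDist.words_length {k : ℕ} (w : RatDist k) : w.words.length = k * 2 :=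
  ofFn_flatten_length fun _ => rfl

theorem RatDist.words_injective {k : ℕ} : Function.Injective (RatDist.words (k := k)) := by
  intro w w' h
  have h1 := ofFn_flatten_injective (c := 2) (fun _ => rfl) (fun _ => rfl) h
  apply Subtype.ext
  funext i
  have h2 := congrFun h1 i
  simp only [List.cons.injEq, and_true] at h2
  exact NNRat.ext_num_den (bits_injective h2.1) (bits_injective h2.2)

theorem encodePOMDP_injective : Function.Injective encodePOMDP := by
  intro I I' henc
  have h := encodeWords_injective henc
  clear henc
  obtain ⟨n, m, hm, O, f, b, d⟩ := I
  obtain ⟨n', m', hm', O', f', b', d'⟩ := I'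
  simp only [POMDPInstance.words, List.cons_append, List.nil_append, List.cons.injEq] at h
  obtain ⟨h1, h2, h⟩ := h
  obtain rfl := unaryWord_injective h1
  obtain rfl := unaryWord_injective h2
  obtain ⟨hO, h⟩ := List.append_inj h (by simp)
  obtain ⟨hl, h⟩ := List.append_inj h (by simp)
  obtain ⟨hb, h⟩ := List.append_inj h (by simp only [RatDist.words_length])
  have hO : O = O' := funext fun q => bits_injective (congrFun (List.ofFn_injective hO) q)
  have hl : f = f' := funext fun q => bits_injective (congrFun (List.ofFn_injective hl) q)
  have hb : b = b' := RatDist.words_injective hb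
  have hd : d = d' := by
    funext q a
    have h1 := ofFn_flatten_injective
      (fun _ => ofFn_flatten_length fun _ => RatDist.words_length _)
      (fun _ => ofFn_flatten_length fun _ => RatDist.words_length _) h
    have h2 := ofFn_flatten_injective (fun _ => RatDist.words_length _)
      (fun _ => RatDist.words_length _) (congrFun h1 q)
    exact RatDist.words_injective (congrFun h2 a)
  subst hO hl hb hd
  rfl

theorem encodeMEMDP_injective : Function.Injective encodeMEMDP := by
  intro I I' henc
  have h := encodeWords_injective henc
  clear henc
  obtain ⟨n, m, k, i, f, b, d⟩ := I
  obtain ⟨n', m', k', i', f', b', d'⟩ := I'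
  simp only [MEMDPInstance.words, List.cons_append, List.nil_append, List.cons.injEq] at h
  obtain ⟨h1, h2, h3, h4, h⟩ := h
  obtain rfl := unaryWord_injective h1
  obtain rfl := unaryWord_injective h2
  obtain rfl := unaryWord_injective h3
  obtain rfl := Fin.ext (unaryWord_injective h4)
  obtain ⟨hl, h⟩ := List.append_inj h (by simp)
  obtain ⟨hb, h⟩ := List.append_inj h (by simp only [RatDist.words_length])
  have hl : f = f' := funext fun q => bits_injective (congrFun (List.ofFn_injective hl) q)
  have hb : b = b' := RatDist.words_injective hb
  have hd : d = d' := by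
    funext e q a
    have h0 := ofFn_flatten_injective
      (fun _ => ofFn_flatten_length fun _ => ofFn_flatten_length fun _ => RatDist.words_length _)
      (fun _ => ofFn_flatten_length fun _ => ofFn_flatten_length fun _ => RatDist.words_length _) h
    have h1 := ofFn_flatten_injective
      (fun _ => ofFn_flatten_length fun _ => RatDist.words_length _)
      (fun _ => ofFn_flatten_length fun _ => RatDist.words_length _) (congrFun h0 e)
    have h2 := ofFn_flatten_injective (fun _ => RatDist.words_length _)
      (fun _ => RatDist.words_length _) (congrFun h1 q)
    exact RatDist.words_injective (congrFun h2 a)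
  subst hl hb hd
  rfl

/-! ### Exponential time -/

/-- `f` is computed, on encoded inputs and outputs, by a Turing machine with finitely many
stacks within `2 ^ p(n)` steps on inputs of length `n`, for some polynomial `p`. -/
def ComputableInExpTime {α β S T : Type} (ea : α → List S) (eb : β → List T)
    (f : α → β) : Prop :=
  ∃ M : Turing.TM2ComputableInTime ea eb f, ∃ p : Polynomial ℕ, ∀ n, M.time n ≤ 2 ^ p.eval n

end

/-! The environments of the MEMDP are the initial states of the POMDP, and the initial belief
becomes the environment belief. A state of the MEMDP is a tuple `g : Q → Option Q`: for every
initial state `i`, `g i` is the state the POMDP would be in now had it started in `i`, or `none` if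
the observed history excludes `i`. Such a tuple makes sense because of Dirac preservation: from a
known state, an action and an observation leave only one possible successor
(`DiracPreserving.eq_of_obs_eq`), so an initial state together with the history of actions and
observations determines the current state. In environment `e` the MEMDP samples a successor of `g e`
and updates the whole tuple with the resulting observation.

On runs that are possible, the tuples and the observations carry the same information. The tuples
are computed from the observations, and the last observation can be read off any non-`none` entry of
the tuple. Hence strategies can be carried over in both directions, with equal laws for the
sequences of labels (`Tracking.runMeasure_labels`, `Tracking.mapStates_track`). The label of a tuple
is well defined because labels depend only on observations. A prior value starts in one fixed state,
while the POMDP reveals an initial observation; the MEMDP therefore spends one extra step moving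
from the all-`none` tuple to the tuple given by that observation. This step does not affect parity
(`mem_parityObjective_iff`). A strategy may randomize the action of that step and remember it, but
this is a mixture of POMDP strategies and gains nothing over the supremum (`Tracking.value_eq`). The
comparison of laws rests on decomposing the Ionescu-Tulcea measure after its first step
(`MDP.runMeasure_apply`), which is checked on cylinders.

With `n` states there are `(n + 1) ^ n` tuples, which gives the size bound. For the running time,
the whole input is folded into one number, held in unary together with a base and a cap. All three
numbers are at most `2 ^ (n (n + 1) + 1)` for inputs of length `n`. It then suffices that the output
is produced by register programs whose time is polynomial in the values of the registers
(`Emits.computableInExpTime`). The classes `UnaryComp`, `UnaryPred` and `Emits` are closed under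
composition, bounded recursion, bounded quantification and loops, so the tables of the MEMDP can be
written by arithmetic on tuples coded as numbers in base `n + 1` (`emits_subsetOutput`). The
register programs compile to a stack machine (`StackProg.iterate_machine`). -/

noncomputable section

/-! ### Structured programs on stacks -/

/-- Structured programs on stacks named by natural numbers. `loop k P` pops the stack `k` until it
is empty, and runs `P c` after popping the letter `c`. -/
inductive StackProg : Type
  | skip : StackProg
  | push (k : ℕ) (c : Option Bool) : StackProg
  | seq (P Q : StackProg) : StackProg
  | loop (k : ℕ) (P : Option Bool → StackProg) : StackProg

/-- The contents of the stacks. -/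
abbrev Stacks := ℕ → List (Option Bool)

namespace StackProg

/-- `Exec P s t s'`: the program `P` leads from `s` to `s'` in `t` steps. -/
inductive Exec : StackProg → Stacks → ℕ → Stacks → Prop
  | skip (s) : Exec skip s 1 s
  | push (k c s) : Exec (push k c) s 1 (Function.update s k (c :: s k))
  | seq {P Q s t s' t' s''} : Exec P s t s' → Exec Q s' t' s'' → Exec (seq P Q) s (t + t' + 1) s''
  | loop_nil {k P s} : s k = [] → Exec (loop k P) s 1 s
  | loop_cons {k P s c l t s' t' s''} : s k = c :: l → Exec (P c) (Function.update s k l) t s' →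
      Exec (loop k P) s' t' s'' → Exec (loop k P) s (t + t' + 1) s''

/-- A bound on the stacks that a program uses. -/
def bound : StackProg → ℕ
  | skip => 0
  | push k _ => k
  | seq P Q => max P.bound Q.bound
  | loop k P => max k (max (P none).bound (max (P (some true)).bound (P (some false)).bound))

theorem bound_le_loop (k : ℕ) (P : Option Bool → StackProg) (c : Option Bool) :
    (P c).bound ≤ (loop k P).bound := by
  rcases c with _ | _ | _ <;> simp [bound]

/-- The control points met while running `P` before the continuation `r`. -/
def labels : StackProg → List StackProg → Set (List StackProg)
  | skip, r => {skip :: r}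
  | push k c, r => {push k c :: r}
  | seq P Q, r => {seq P Q :: r} ∪ (labels P (Q :: r) ∪ labels Q r)
  | loop k P, r => {loop k P :: r} ∪ ⋃ c, labels (P c) (loop k P :: r)

/-- Every continuation is fixed by the syntax of the program and a loop has one body per letter of a
finite alphabet. This is what makes the label type of `machine` finite. -/
theorem labels_finite (P : StackProg) : ∀ r, (labels P r).Finite := by
  induction P with
  | skip | push => intro r; exact Set.finite_singleton _
  | seq P Q hP hQ => intro r; exact (Set.finite_singleton _).union ((hP _).union (hQ _))
  | loop k P hP =>
    intro r; exact (Set.finite_singleton _).union (Set.finite_iUnion fun c => hP c _)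

theorem cons_mem_labels (P : StackProg) (r : List StackProg) : P :: r ∈ labels P r := by
  cases P <;> simp [labels]

/-- The labels of the machine that runs `P`. -/
abbrev Label (P : StackProg) := {l // l ∈ insert [] (labels P [])}

open Classical in
/-- A control point as a label. -/
def toLabel (P : StackProg) (l : List StackProg) : Label P :=
  if h : l ∈ insert [] (labels P []) then ⟨l, h⟩ else ⟨[], Set.mem_insert _ _⟩

/-- The name of the stack `k` among the first `R + 1` stacks. -/
def idx (R k : ℕ) : Fin (R + 1) := ⟨min k R, Nat.lt_succ_of_le (min_le_right k R)⟩

/-- The statement that the machine running `P` executes at a control point. -/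
def stmt (P : StackProg) (R : ℕ) :
    List StackProg → Turing.TM2.Stmt (fun _ : Fin (R + 1) => Option Bool) (Label P)
      (Option (Option Bool))
  | [] => .load (fun _ => none) .halt
  | skip :: r => .goto fun _ => toLabel P r
  | push k c :: r => .push (idx R k) (fun _ => c) (.goto fun _ => toLabel P r)
  | seq Q Q' :: r => .goto fun _ => toLabel P (Q :: Q' :: r)
  | loop k Q :: r => .pop (idx R k) (fun _ o => o) (.goto fun v =>
      v.elim (toLabel P r) fun c => toLabel P (Q c :: loop k Q :: r))

/-- The Turing machine that runs `P`, with input on the stack `0` and output on the stack `1`. -/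
def machine (P : StackProg) (R : ℕ) : Turing.FinTM2 :=
  haveI : Fintype (Label P) := ((labels_finite P []).insert []).fintype
  { K := Fin (R + 1)
    k₀ := idx R 0
    k₁ := idx R 1
    Γ := fun _ => Option Bool
    Λ := Label P
    main := toLabel P [P]
    σ := Option (Option Bool)
    initialState := none
    m := fun l => stmt P R l.1 }

/-- The configurations of the machine. -/
def cfg (P : StackProg) (R : ℕ) (l : List StackProg) (v : Option (Option Bool)) (s : Stacks) :
    (machine P R).Cfg :=
  (⟨some (toLabel P l), v, fun i => s i⟩ :
    Turing.TM2.Cfg (fun _ : Fin (R + 1) => Option Bool) (Label P) (Option (Option Bool)))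

/-- The halting configurations of the machine. -/
def haltCfg (P : StackProg) (R : ℕ) (s : Stacks) : (machine P R).Cfg :=
  (⟨none, none, fun i => s i⟩ :
    Turing.TM2.Cfg (fun _ : Fin (R + 1) => Option Bool) (Label P) (Option (Option Bool)))

/-! ### Simulation of structured programs by the machine -/

theorem step_cfg (P : StackProg) (R : ℕ) {l : List StackProg} (h : l ∈ insert [] (labels P []))
    (v : Option (Option Bool)) (s : Stacks) :
    (machine P R).step (cfg P R l v s) =
      some (Turing.TM2.stepAux (stmt P R l) v fun i : Fin (R + 1) => s i) := by
  have : (toLabel P l).1 = l := by rw [toLabel, dif_pos h]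
  show some (Turing.TM2.stepAux (stmt P R (toLabel P l).1) v fun i : Fin (R + 1) => s i) = _
  rw [this]

theorem update_idx {R k : ℕ} (hk : k ≤ R) (s : Stacks) (x : List (Option Bool)) :
    (Function.update (fun i : Fin (R + 1) => s i) (idx R k) x) =
      fun i : Fin (R + 1) => Function.update s k x i := by
  funext i
  have : i = idx R k ↔ (i : ℕ) = k := by
    simp [idx, Fin.ext_iff, hk]
  simp only [Function.update_apply, this]

theorem val_idx {R k : ℕ} (hk : k ≤ R) : (idx R k : ℕ) = k := by
  simp [idx, hk]

theorem flip_bind_some {α β : Type} (f : α → Option β) (a : α) :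
    flip bind f (some a) = f a := rfl

/-- The label of the machine is the list of programs still to be run, acting as a call stack. The
costs in `Exec` are chosen so that each rule accounts for exactly one machine step besides those of
its premises; the step counts therefore agree exactly. The internal variable only holds the outcome
of the last pop, so its value is irrelevant at both ends. -/
theorem iterate_machine {P₀ : StackProg} {R : ℕ} {P : StackProg} {s s' : Stacks} {t : ℕ}
    (h : Exec P s t s') : ∀ {r : List StackProg}, P.bound ≤ R →
    labels P r ⊆ insert [] (labels P₀ []) → r ∈ insert [] (labels P₀ []) →
    ∀ v, ∃ v', (flip bind (machine P₀ R).step)^[t] (some (cfg P₀ R (P :: r) v s)) =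
      some (cfg P₀ R r v' s') := by
  induction h with
  | skip s =>
    intro r hR hl hr v
    refine ⟨v, ?_⟩
    rw [Function.iterate_one]
    rw [flip_bind_some, step_cfg _ _ (hl (cons_mem_labels _ _))]
    rfl
  | push k c s =>
    intro r hR hl hr v
    refine ⟨v, ?_⟩
    rw [Function.iterate_one]
    have hk : k ≤ R := hR
    rw [flip_bind_some, step_cfg _ _ (hl (cons_mem_labels _ _))]
    simp only [stmt, Turing.TM2.stepAux, update_idx hk, val_idx hk]
    rfl
  | @seq P Q s t s' t' s'' _ _ ih ih' =>
    intro r hR hl hr v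
    have hl' : labels P (Q :: r) ∪ labels Q r ⊆ insert [] (labels P₀ []) :=
      Set.subset_union_right.trans hl
    obtain ⟨v₁, h₁⟩ := ih ((le_max_left _ _).trans hR) (Set.subset_union_left.trans hl')
      (hl' (Or.inr (cons_mem_labels _ _))) v
    obtain ⟨v₂, h₂⟩ := ih' ((le_max_right _ _).trans hR) (Set.subset_union_right.trans hl') hr v₁
    refine ⟨v₂, ?_⟩
    rw [Function.iterate_succ_apply, add_comm, Function.iterate_add_apply]
    have : flip bind (machine P₀ R).step (some (cfg P₀ R (seq P Q :: r) v s)) =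
        some (cfg P₀ R (P :: Q :: r) v s) := by
      rw [flip_bind_some, step_cfg _ _ (hl (cons_mem_labels _ _))]
      rfl
    rw [this, h₁, h₂]
  | @loop_nil k P s hs =>
    intro r hR hl hr v
    refine ⟨none, ?_⟩
    rw [Function.iterate_one]
    rw [flip_bind_some, step_cfg _ _ (hl (cons_mem_labels _ _))]
    have hk : k ≤ R := (le_max_left _ _).trans hR
    simp only [stmt, Turing.TM2.stepAux, update_idx hk, val_idx hk]
    have h : Function.update s k (s k).tail = s := by
      have h : (s k).tail = s k := by rw [hs]; rfl
      rw [h, Function.update_eq_self]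
    rw [h, hs]
    rfl
  | @loop_cons k P s c l t s' t' s'' hs _ _ ih ih' =>
    intro r hR hl hr v
    have hk : k ≤ R := (le_max_left _ _).trans hR
    have hl' : labels (P c) (loop k P :: r) ⊆ insert [] (labels P₀ []) :=
      ((Set.subset_iUnion (fun c => labels (P c) (loop k P :: r)) c).trans
        Set.subset_union_right).trans hl
    obtain ⟨v₁, h₁⟩ := ih ((bound_le_loop k P c).trans hR) hl' (hl (cons_mem_labels _ _)) (some c)
    obtain ⟨v₂, h₂⟩ := ih' hR hl hr v₁
    refine ⟨v₂, ?_⟩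
    rw [Function.iterate_succ_apply, add_comm, Function.iterate_add_apply]
    have : flip bind (machine P₀ R).step (some (cfg P₀ R (loop k P :: r) v s)) =
        some (cfg P₀ R (P c :: loop k P :: r) (some c) (Function.update s k l)) := by
      rw [flip_bind_some, step_cfg _ _ (hl (cons_mem_labels _ _))]
      simp only [stmt, Turing.TM2.stepAux, update_idx hk, val_idx hk, hs]
      rfl
    rw [this, h₁, h₂]

/-- Stacks with the contents `inp` and `out` of the stacks `0` and `1`, all others being empty. -/
def ioStacks (inp out : List (Option Bool)) : Stacks
  | 0 => inp
  | 1 => out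
  | _ => []

theorem outputsInTime {P : StackProg} {inp out : List (Option Bool)} {t T : ℕ}
    (h : Exec P (ioStacks inp []) t (ioStacks [] out)) (ht : t + 1 ≤ T) :
    Nonempty (Turing.TM2OutputsInTime (machine P (P.bound + 1)) inp (some out) T) := by
  -- The extra stack keeps the stacks `0` and `1` distinct even if the program uses only stack `0`.
  have hR : P.bound ≤ P.bound + 1 := Nat.le_succ _
  obtain ⟨v', h'⟩ := iterate_machine (P₀ := P) (R := P.bound + 1) h (r := []) hR
    (Set.subset_insert _ _) (Set.mem_insert _ _) none
  have h0 : Turing.initList (machine P (P.bound + 1)) inp =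
      cfg P (P.bound + 1) [P] none (ioStacks inp []) := by
    unfold Turing.initList cfg machine
    congr 1
    funext k
    obtain ⟨_ | _ | k, hk⟩ := k
    · simp [ioStacks, idx]
    · simp [ioStacks, idx]
    · simp [ioStacks, idx]
  have h1 : Turing.haltList (machine P (P.bound + 1)) out =
      haltCfg P (P.bound + 1) (ioStacks [] out) := by
    unfold Turing.haltList haltCfg machine
    congr 1
    funext k
    obtain ⟨_ | _ | k, hk⟩ := k
    · simp [ioStacks, idx]
    · simp [ioStacks, idx]
    · simp [ioStacks, idx]
  -- The additional step is the one at the empty continuation: it resets the internal variable, as a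
  -- halting configuration requires, and halts.
  refine ⟨⟨⟨t + 1, ?_⟩, ht⟩⟩
  have h2 : Option.map (Turing.haltList (machine P (P.bound + 1))) (some out) =
    some (haltCfg P (P.bound + 1) (ioStacks [] out)) := congrArg some h1
  rw [h0, h2, add_comm t 1, Function.iterate_add_apply]
  refine (congrArg _ h').trans ?_
  rw [Function.iterate_one]
  rw [flip_bind_some, step_cfg _ _ (Set.mem_insert _ _)]
  rfl

end StackProg

end

noncomputable section

/-! ### Polynomially bounded functions -/

/-- The size of a tuple of numbers. -/
def tupleNorm {m : ℕ} (v : Fin m → ℕ) : ℕ := 2 + ∑ i, v i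

theorem two_le_tupleNorm {m : ℕ} (v : Fin m → ℕ) : 2 ≤ tupleNorm v := Nat.le_add_right _ _

theorem le_tupleNorm {m : ℕ} (v : Fin m → ℕ) (i : Fin m) : v i ≤ tupleNorm v :=
  (Finset.single_le_sum (f := v) (fun _ _ => Nat.zero_le _) (Finset.mem_univ i)).trans
    (Nat.le_add_left _ _)

/-- A function is polynomially bounded in the values of its arguments. -/
def PolyBdd {m : ℕ} (g : (Fin m → ℕ) → ℕ) : Prop := ∃ c, ∀ v, g v ≤ tupleNorm v ^ c

namespace PolyBdd

variable {m : ℕ} {f g : (Fin m → ℕ) → ℕ}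

theorem mono (hg : PolyBdd g) (h : ∀ v, f v ≤ g v) : PolyBdd f :=
  hg.imp fun _ hc v => (h v).trans (hc v)

theorem const (n : ℕ) : PolyBdd fun _ : Fin m → ℕ => n :=
  -- The summand `2` of `tupleNorm` makes every constant absorbable by an exponent: `n ≤ 2 ^ n`.
  ⟨n, fun v => (Nat.lt_two_pow_self.le).trans (Nat.pow_le_pow_left (two_le_tupleNorm v) n)⟩

theorem var (i : Fin m) : PolyBdd fun v => v i :=
  ⟨1, fun v => by simpa using le_tupleNorm v i⟩

theorem mul (hf : PolyBdd f) (hg : PolyBdd g) : PolyBdd fun v => f v * g v := by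
  obtain ⟨c, hc⟩ := hf
  obtain ⟨d, hd⟩ := hg
  exact ⟨c + d, fun v => by rw [pow_add]; exact Nat.mul_le_mul (hc v) (hd v)⟩

theorem add (hf : PolyBdd f) (hg : PolyBdd g) : PolyBdd fun v => f v + g v := by
  obtain ⟨c, hc⟩ := hf
  obtain ⟨d, hd⟩ := hg
  refine ⟨max c d + 1, fun v => ?_⟩
  have h1 : 1 ≤ tupleNorm v := one_le_two.trans (two_le_tupleNorm v)
  calc f v + g v ≤ tupleNorm v ^ max c d + tupleNorm v ^ max c d :=
        add_le_add ((hc v).trans (Nat.pow_le_pow_right h1 (le_max_left _ _)))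
          ((hd v).trans (Nat.pow_le_pow_right h1 (le_max_right _ _)))
    _ = tupleNorm v ^ max c d * 2 := by ring
    _ ≤ tupleNorm v ^ (max c d + 1) := by
        rw [pow_succ]; exact Nat.mul_le_mul_left _ (two_le_tupleNorm v)

theorem sum {n : ℕ} {g : Fin n → (Fin m → ℕ) → ℕ} (hg : ∀ j, PolyBdd (g j)) :
    PolyBdd fun v => ∑ j, g j v := by
  induction n with
  | zero => simpa using const 0
  | succ n ih =>
    simp only [Fin.sum_univ_succ]
    exact (hg 0).add (ih fun j => hg j.succ)

theorem norm {n : ℕ} {g : Fin n → (Fin m → ℕ) → ℕ} (hg : ∀ j, PolyBdd (g j)) :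
    PolyBdd fun v => tupleNorm fun j => g j v :=
  (const 2).add (sum hg)

theorem pow (hf : PolyBdd f) (c : ℕ) : PolyBdd fun v => f v ^ c := by
  obtain ⟨d, hd⟩ := hf
  exact ⟨d * c, fun v => by rw [pow_mul]; exact Nat.pow_le_pow_left (hd v) c⟩

theorem comp {n : ℕ} {h : (Fin n → ℕ) → ℕ} {g : Fin n → (Fin m → ℕ) → ℕ} (hh : PolyBdd h)
    (hg : ∀ j, PolyBdd (g j)) : PolyBdd fun v => h fun j => g j v := by
  obtain ⟨c, hc⟩ := hh
  exact ((norm hg).pow c).mono fun v => hc _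

end PolyBdd

/-! ### Programs on unary registers -/

namespace StackProg

/-- `P` leads from `s` to `s'` in at most `T` steps. -/
def Runs (P : StackProg) (s : Stacks) (T : ℕ) (s' : Stacks) : Prop := ∃ t ≤ T, Exec P s t s'

theorem Runs.mono {P : StackProg} {s s' : Stacks} {T T' : ℕ} (h : Runs P s T s') (hT : T ≤ T') :
    Runs P s T' s' :=
  let ⟨t, ht, h⟩ := h
  ⟨t, ht.trans hT, h⟩

theorem Runs.seq {P Q : StackProg} {s s' s'' : Stacks} {T T' : ℕ} (h : Runs P s T s')
    (h' : Runs Q s' T' s'') : Runs (seq P Q) s (T + T' + 1) s'' := by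
  obtain ⟨t, ht, h⟩ := h
  obtain ⟨t', ht', h'⟩ := h'
  exact ⟨t + t' + 1, by omega, h.seq h'⟩

/-- The stacks holding the input, the output, and the register `r` in unary on the stack
`r + 2`. -/
def regs (inp out : List (Option Bool)) (v : ℕ → ℕ) : Stacks
  | 0 => inp
  | 1 => out
  | r + 2 => List.replicate (v r) none

variable {inp out : List (Option Bool)} {v : ℕ → ℕ}

theorem update_regs (r n : ℕ) : Function.update (regs inp out v) (r + 2) (List.replicate n none) =
    regs inp out (Function.update v r n) := by
  funext x
  rcases x with _ | _ | x
  · simp [regs]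
  · simp [regs]
  · by_cases h : x = r
    · simp [regs, h]
    · simp [regs, h]

theorem update_regs_out (l : List (Option Bool)) :
    Function.update (regs inp out v) 1 l = regs inp l v := by
  funext x
  rcases x with _ | _ | x <;> simp [regs]

theorem Runs.cast {P : StackProg} {inp' out' : List (Option Bool)} {v' w w' : ℕ → ℕ} {T T' : ℕ}
    (h : Runs P (regs inp out v) T (regs inp' out' v')) (h1 : w = v) (h2 : T ≤ T')
    (h3 : v' = w') : Runs P (regs inp out w) T' (regs inp' out' w') := by
  subst h1 h3
  exact h.mono h2

theorem runs_skip (s : Stacks) : Runs skip s 1 s := ⟨1, le_rfl, .skip s⟩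

theorem runs_inc (r : ℕ) : Runs (push (r + 2) none) (regs inp out v) 1
    (regs inp out (Function.update v r (v r + 1))) := by
  refine ⟨1, le_rfl, ?_⟩
  have := Exec.push (r + 2) none (regs inp out v)
  rwa [show none :: regs inp out v (r + 2) = List.replicate (v r + 1) none from rfl,
    update_regs] at this

theorem runs_emit (c : Option Bool) : Runs (push 1 c) (regs inp out v) 1
    (regs inp (c :: out) v) := by
  refine ⟨1, le_rfl, ?_⟩
  have := Exec.push 1 c (regs inp out v)
  rwa [update_regs_out] at this

/-- Run `P` as often as the register `r` says, counting it down. -/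
def rloop (r : ℕ) (P : StackProg) : StackProg := loop (r + 2) fun _ => P

/-- The loop rule with invariant: `o i` and `w i` describe output and registers when `i` rounds
remain. The pop precedes the body, so the body going from `i + 1` to `i` already finds `i` in the
counter and may use it as a loop index. -/
theorem runs_rloop {r n C : ℕ} {P : StackProg} {o : ℕ → List (Option Bool)} {w : ℕ → ℕ → ℕ}
    (hw : ∀ i ≤ n, w i r = i)
    (hP : ∀ i < n, Runs P (regs inp (o (i + 1)) (Function.update (w (i + 1)) r i)) C
      (regs inp (o i) (w i))) :
    Runs (rloop r P) (regs inp (o n) (w n)) (n * (C + 1) + 1) (regs inp (o 0) (w 0)) := by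
  induction n with
  | zero =>
    refine ⟨1, by omega, .loop_nil ?_⟩
    simp [regs, hw 0 le_rfl]
  | succ n ih =>
    obtain ⟨t', ht', h'⟩ := ih (fun i hi => hw i (hi.trans n.le_succ))
      (fun i hi => hP i (hi.trans n.lt_succ_self))
    obtain ⟨t, ht, h⟩ := hP n n.lt_succ_self
    refine ⟨t + t' + 1, by nlinarith, .loop_cons (c := none) (l := List.replicate n none) ?_ ?_ h'⟩
    · simp [regs, hw (n + 1) le_rfl, List.replicate_succ]
    · rwa [update_regs]

/-- Add the register `r` to the register `s` and clear `r`. -/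
def move (r s : ℕ) : StackProg := rloop r (push (s + 2) none)

theorem runs_move {r s : ℕ} (h : r ≠ s) : Runs (move r s) (regs inp out v) (2 * v r + 1)
    (regs inp out (Function.update (Function.update v r 0) s (v s + v r))) := by
  have := runs_rloop (inp := inp) (r := r) (n := v r) (C := 1) (P := push (s + 2) none)
    (o := fun _ => out)
    (w := fun i => Function.update (Function.update v r i) s (v s + (v r - i)))
    (fun i _ => by simp [h]) (fun i hi => by
      convert runs_inc s using 2
      funext x
      simp only [Function.update_apply]
      split_ifs <;> omega)
  refine this.cast ?_ (by omega) (by simp)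
  simp [Function.update_eq_self]

/-- Clear the register `r`. -/
def clear (r : ℕ) : StackProg := rloop r skip

theorem runs_clear (r : ℕ) : Runs (clear r) (regs inp out v) (2 * v r + 1)
    (regs inp out (Function.update v r 0)) := by
  have := runs_rloop (inp := inp) (r := r) (n := v r) (C := 1) (P := skip)
    (o := fun _ => out) (w := fun i => Function.update v r i)
    (fun i _ => by simp) (fun i hi => by simpa using runs_skip _)
  exact this.cast (by simp) (by omega) rfl

/-- Add the register `r` to the register `s`, using the empty register `t`. -/
def copy (r s t : ℕ) : StackProg :=
  seq (rloop r (seq (push (s + 2) none) (push (t + 2) none))) (move t r)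

theorem runs_copy {r s t : ℕ} (hrs : r ≠ s) (hrt : r ≠ t) (hst : s ≠ t) (ht : v t = 0) :
    Runs (copy r s t) (regs inp out v) (6 * v r + 3)
      (regs inp out (Function.update v s (v s + v r))) := by
  have h1 := runs_rloop (inp := inp) (r := r) (n := v r) (C := 3)
    (P := seq (push (s + 2) none) (push (t + 2) none)) (o := fun _ => out)
    (w := fun i => Function.update (Function.update (Function.update v r i) s (v s + (v r - i)))
      t (v r - i))
    (fun i _ => by simp [hrs, hrt]) (fun i hi => by
      convert (runs_inc s).seq (runs_inc t) using 2
      funext x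
      simp only [Function.update_apply]
      split_ifs <;> omega)
  have h2 := h1.seq (runs_move hrt.symm)
  refine h2.cast ?_ ?_ ?_
  · funext x
    simp only [Function.update_apply]
    split_ifs <;> subst_vars <;> omega
  · simp; omega
  · funext x
    simp only [Function.update_apply]
    split_ifs <;> subst_vars <;> first | rfl | omega

end StackProg

open StackProg

/-- `f` is computed by programs on unary registers, in time polynomial in the values of its
arguments: from arguments held in registers below `k`, the result is written to the register `k`,
and all registers from `k` on serve as scratch memory. -/
def UnaryComp {m : ℕ} (f : (Fin m → ℕ) → ℕ) : Prop :=
  PolyBdd f ∧ ∃ cost, PolyBdd cost ∧ ∀ (k : ℕ) (a : Fin m → ℕ), (∀ i, a i < k) →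
    ∃ P : StackProg, ∀ inp out (v : ℕ → ℕ), (∀ r, k ≤ r → v r = 0) →
      Runs P (regs inp out v) (cost (v ∘ a)) (regs inp out (Function.update v k (f (v ∘ a))))

/-- The words `F v` are written to the output by programs on unary registers, in time polynomial
in the values of the arguments. -/
def Emits {m : ℕ} (F : (Fin m → ℕ) → List (Option Bool)) : Prop :=
  ∃ cost, PolyBdd cost ∧ ∀ (k : ℕ) (a : Fin m → ℕ), (∀ i, a i < k) →
    ∃ P : StackProg, ∀ inp out (v : ℕ → ℕ), (∀ r, k ≤ r → v r = 0) →
      Runs P (regs inp out v) (cost (v ∘ a)) (regs inp (F (v ∘ a) ++ out) v)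

namespace UnaryComp

variable {m : ℕ}

theorem var (i : Fin m) : UnaryComp fun v => v i := by
  refine ⟨.var i, fun v => 6 * v i + 3, ((PolyBdd.const 6).mul (.var i)).add (.const 3),
    fun k a ha => ⟨copy (a i) k (k + 1), fun inp out v hv => ?_⟩⟩
  have hi := ha i
  refine (runs_copy (r := a i) (s := k) (t := k + 1)
    (by omega) (by omega) (by omega) (hv _ (by omega))).cast rfl le_rfl ?_
  rw [hv k le_rfl, zero_add]
  rfl

theorem zero : UnaryComp fun _ : Fin m → ℕ => 0 := by
  refine ⟨.const 0, fun v => 1, .const 1, fun k a ha => ⟨skip, fun inp out v hv => ?_⟩⟩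
  refine (runs_skip _).cast rfl le_rfl ?_
  rw [← hv k le_rfl, Function.update_eq_self]

theorem succ_aux : UnaryComp fun v : Fin 1 → ℕ => v 0 + 1 := by
  obtain ⟨hb, cost, hc, h⟩ := var (0 : Fin 1)
  refine ⟨hb.add (.const 1), fun v => cost v + 1 + 1, (hc.add (.const 1)).add (.const 1),
    fun k a ha => ?_⟩
  obtain ⟨P, hP⟩ := h k a ha
  refine ⟨seq P (push (k + 2) none), fun inp out v hv => ?_⟩
  convert (hP inp out v hv).seq (runs_inc k) using 2
  simp

/-- Evaluate `g j` into the registers `k + j`. -/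
theorem eval_all {n : ℕ} {g : Fin n → (Fin m → ℕ) → ℕ} (hg : ∀ j, UnaryComp (g j)) :
    ∃ cost, PolyBdd cost ∧ ∀ (k : ℕ) (a : Fin m → ℕ), (∀ i, a i < k) →
    ∃ P : StackProg, ∀ inp out (v : ℕ → ℕ), (∀ r, k ≤ r → v r = 0) →
      Runs P (regs inp out v) (cost (v ∘ a)) (regs inp out fun r =>
        if h : k ≤ r ∧ r < k + n then g ⟨r - k, by omega⟩ (v ∘ a) else v r) := by
  induction n with
  | zero =>
    refine ⟨fun _ => 1, .const 1, fun k a ha => ⟨skip, fun inp out v hv => ?_⟩⟩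
    convert runs_skip _ using 2
    funext r
    rw [dif_neg (by omega)]
  | succ n ih =>
    obtain ⟨cost, hc, h⟩ := ih (g := fun j => g j.castSucc) (fun j => hg _)
    obtain ⟨hb, cost', hc', h'⟩ := hg (Fin.last n)
    refine ⟨fun v => cost v + cost' v + 1, (hc.add hc').add (.const 1), fun k a ha => ?_⟩
    obtain ⟨P, hP⟩ := h k a ha
    -- With base `k + n`, the results computed so far lie below the scratch area and survive.
    obtain ⟨P', hP'⟩ := h' (k + n) a fun i => (ha i).trans_le (Nat.le_add_right _ _)
    refine ⟨seq P P', fun inp out v hv => ?_⟩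
    have h1 := hP inp out v hv
    set w : ℕ → ℕ := fun r =>
        if h : k ≤ r ∧ r < k + n then g (Fin.castSucc ⟨r - k, by omega⟩) (v ∘ a) else v r with hw
    have hwa : w ∘ a = v ∘ a := by
      funext i
      have := ha i
      simp only [Function.comp, hw]
      rw [dif_neg (by omega)]
    have h2 := hP' inp out w fun r hr => by
      simp only [hw]
      rw [dif_neg (by omega)]
      exact hv r (by omega)
    rw [hwa] at h2
    convert h1.seq h2 using 2
    funext r
    by_cases hr : r = k + n
    · subst hr
      rw [dif_pos (by omega), Function.update_self]
      congr 1
      simp [Fin.ext_iff]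
    · rw [Function.update_of_ne hr]
      simp only [hw]
      by_cases hr' : k ≤ r ∧ r < k + n
      · rw [dif_pos (by omega), dif_pos hr']
        rfl
      · rw [dif_neg (by omega), dif_neg hr']

/-- Clear the registers `k, …, k + n - 1`. -/
theorem clear_all (n : ℕ) (k : ℕ) : ∃ P : StackProg, ∀ inp out (v : ℕ → ℕ),
    Runs P (regs inp out v) (1 + ∑ j : Fin n, (2 * v (k + j) + 2))
      (regs inp out fun r => if k ≤ r ∧ r < k + n then 0 else v r) := by
  induction n with
  | zero =>
    refine ⟨skip, fun inp out v => ?_⟩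
    refine (runs_skip _).cast rfl (by simp) ?_
    funext r
    rw [if_neg (by omega)]
  | succ n ih =>
    obtain ⟨P, hP⟩ := ih
    refine ⟨seq P (clear (k + n)), fun inp out v => ?_⟩
    have h := (hP inp out v).seq (runs_clear (k + n))
    rw [if_neg (by omega)] at h
    convert h using 1
    · rw [Fin.sum_univ_castSucc]
      simp only [Fin.val_castSucc, Fin.val_last]
      omega
    · congr 1
      funext r
      simp only [Function.update_apply]
      split_ifs <;> first | rfl | omega

/-- Register layout: the inner values go to `k + 1, …, k + n`, the outer value to `k + 1 + n`. The
inner values are then cleared and the result is moved down to `k`, so that the scratch area is empty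
again. -/
theorem comp {n : ℕ} {f : (Fin n → ℕ) → ℕ} {g : Fin n → (Fin m → ℕ) → ℕ} (hf : UnaryComp f)
    (hg : ∀ j, UnaryComp (g j)) : UnaryComp fun v => f fun j => g j v := by
  obtain ⟨hfb, cf, hcf, hf⟩ := hf
  obtain ⟨cg, hcg, hg'⟩ := eval_all hg
  have hgb := fun j => (hg j).1
  refine ⟨hfb.comp hgb, fun v => ((cg v + cf (fun j => g j v) + 1) +
    (1 + ∑ j : Fin n, (2 * g j v + 2)) + 1) + (2 * f (fun j => g j v) + 1) + 1, ?_,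
    fun k a ha => ?_⟩
  · exact ((((hcg.add (hcf.comp hgb)).add (.const 1)).add ((PolyBdd.const 1).add (.sum fun j =>
      ((PolyBdd.const 2).mul (hgb j)).add (.const 2)))).add (.const 1)).add
      (((PolyBdd.const 2).mul (hfb.comp hgb)).add (.const 1)) |>.add (.const 1)
  obtain ⟨P, hP⟩ := hg' (k + 1) a fun i => (ha i).trans (Nat.lt_succ_self _)
  obtain ⟨P', hP'⟩ := hf (k + 1 + n) (fun j => k + 1 + (j : ℕ)) fun j => by omega
  obtain ⟨P'', hP''⟩ := clear_all n (k + 1)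
  refine ⟨seq (seq (seq P P') P'') (move (k + 1 + n) k), fun inp out v hv => ?_⟩
  have h1 := hP inp out v fun r hr => hv r (by omega)
  set w : ℕ → ℕ := fun r =>
    if h : k + 1 ≤ r ∧ r < k + 1 + n then g ⟨r - (k + 1), by omega⟩ (v ∘ a) else v r with hw
  have h2 := hP' inp out w fun r hr => by
    simp only [hw]
    rw [dif_neg (by omega)]
    exact hv r (by omega)
  have hwa : (w ∘ fun j : Fin n => k + 1 + (j : ℕ)) = fun j => g j (v ∘ a) := by
    funext j
    simp only [Function.comp, hw]
    rw [dif_pos (by omega)]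
    congr 1
    simp
  rw [hwa] at h2
  have h3 := (h1.seq h2).seq (hP'' inp out _)
  have h4 := h3.seq (runs_move (show k + 1 + n ≠ k by omega))
  refine h4.cast rfl (le_of_eq ?_) ?_
  · have e1 : ∀ j : Fin n, Function.update w (k + 1 + n) (f fun j => g j (v ∘ a)) (k + 1 + j) =
        g j (v ∘ a) := fun j => by
      rw [Function.update_of_ne (by omega)]
      exact congrFun hwa j
    rw [if_neg (by omega), Function.update_self]
    simp only [e1]
  · funext r
    simp only [Function.update_apply, hw]
    have := hv k le_rfl
    have := hv (k + 1 + n) (by omega)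
    have := hv r
    split_ifs <;> omega

/-- Closure under recursion with polynomially bounded values. -/
theorem natRec {cnt init : (Fin m → ℕ) → ℕ} {step : (Fin m → ℕ) → ℕ → ℕ → ℕ}
    (hcnt : UnaryComp cnt) (hinit : UnaryComp init)
    (hstep : UnaryComp fun w : Fin (m + 2) → ℕ => step (fun i => w i.succ.succ) (w 0) (w 1))
    {bd : (Fin m → ℕ) → ℕ} (hbd : PolyBdd bd)
    (hb : ∀ v, ∀ j ≤ cnt v, Nat.rec (init v) (step v) j ≤ bd v) :
    UnaryComp fun v => Nat.rec (init v) (step v) (cnt v) := by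
  obtain ⟨hcb, cc, hcc, hcnt⟩ := hcnt
  obtain ⟨-, ci, hci, hinit⟩ := hinit
  obtain ⟨-, cs, ⟨e, he⟩, hstep⟩ := hstep
  -- In every round the arguments of the step function are the original ones, an index at most `cnt
  -- v` and an accumulator at most `bd v`; one polynomial in this sum bounds the cost of each
  -- evaluation. Without the bound `bd` the iterated values could outgrow every polynomial.
  have hN : PolyBdd fun v : Fin m → ℕ => tupleNorm v + cnt v + bd v :=
    ((PolyBdd.norm fun j => .var j).add hcb).add hbd
  refine ⟨hbd.mono fun v => hb v _ le_rfl, fun v => (ci v + cc v + 1) +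
    (cnt v * (((tupleNorm v + cnt v + bd v) ^ e + (2 * bd v + 1) + 1 + (2 * bd v + 1) + 1) + 1 + 1
      + 1) + 1) + 1 + (2 * cnt v + 1) + 1, ?_, fun k a ha => ?_⟩
  · have h2 : PolyBdd fun v : Fin m → ℕ => 2 * bd v + 1 :=
      ((PolyBdd.const 2).mul hbd).add (.const 1)
    exact (((((hci.add hcc).add (.const 1)).add ((hcb.mul
      ((((((((hN.pow e).add h2).add (.const 1)).add
      h2).add (.const 1)).add (.const 1)).add (.const 1)).add (.const 1))).add (.const 1))).add
      (.const 1)).add (((PolyBdd.const 2).mul hcb).add (.const 1))).add (.const 1)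
  obtain ⟨Pi, hPi⟩ := hinit k a ha
  obtain ⟨Pc, hPc⟩ := hcnt (k + 2) a fun i => (ha i).trans (by omega)
  obtain ⟨Ps, hPs⟩ := hstep (k + 3) (Fin.cons (k + 1) (Fin.cons k a)) (by
    intro i
    refine Fin.cases ?_ (fun i => Fin.cases ?_ (fun i => ?_) i) i
    · simp
    · simp
    · have := ha i
      simp only [Fin.cons_succ]
      omega)
  -- Register layout: `k` holds the accumulator, `k + 1` the number of completed rounds (the
  -- recursion index), `k + 2` the number of remaining rounds, and `k + 3` receives the new value
  -- before it replaces the old one.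
  refine ⟨seq (seq (seq Pi Pc) (rloop (k + 2) (seq (seq (seq Ps (clear k)) (move (k + 3) k))
    (push (k + 1 + 2) none)))) (clear (k + 1)), fun inp out v hv => ?_⟩
  set u := v ∘ a with hu
  have h1 := hPi inp out v hv
  have h2 := hPc inp out (Function.update v k (init u)) fun r hr => by
    rw [Function.update_of_ne (by omega)]; exact hv r (by omega)
  have hua : ∀ (x y z : ℕ), Function.update (Function.update (Function.update v k x) (k + 1) y)
      (k + 2) z ∘ a = u := by
    intro x y z
    funext i
    have := ha i
    simp only [Function.comp, hu]
    rw [Function.update_of_ne (by omega), Function.update_of_ne (by omega),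
      Function.update_of_ne (by omega)]
  have hua' : Function.update v k (init u) ∘ a = u := by
    funext i
    have := ha i
    simp only [Function.comp, hu]
    rw [Function.update_of_ne (by omega)]
  rw [hua'] at h2
  have h3 := runs_rloop (inp := inp) (r := k + 2) (n := cnt u)
    (C := ((tupleNorm u + cnt u + bd u) ^ e + (2 * bd u + 1) + 1 + (2 * bd u + 1) + 1) + 1 + 1)
    (P := seq (seq (seq Ps (clear k)) (move (k + 3) k)) (push (k + 1 + 2) none))
    (o := fun _ => out)
    (w := fun i => Function.update (Function.update (Function.update v k
      (Nat.rec (init u) (step u) (cnt u - i))) (k + 1) (cnt u - i)) (k + 2) i)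
    (fun i _ => by simp) (fun i hi => by
      set j := cnt u - (i + 1) with hj
      have hj1 : cnt u - i = j + 1 := by omega
      set x : ℕ := Nat.rec (init u) (step u) j with hx
      have hx1 : x ≤ bd u := hb u j (by omega)
      have hx2 : step u j x ≤ bd u := hb u (j + 1) (by omega)
      rw [Function.update_idem, hj1]
      set w := Function.update (Function.update (Function.update v k x) (k + 1) j) (k + 2) i with hw
      have hw0 : w k = x := by simp [hw]
      have hw1 : w (k + 1) = j := by simp [hw]
      have hv3 := hv (k + 3) (by omega)
      have hw3 : w (k + 3) = 0 := by simp [hw, hv3]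
      have e1 := hPs inp out w fun r hr => by
        simp only [hw]
        rw [Function.update_of_ne (by omega), Function.update_of_ne (by omega),
          Function.update_of_ne (by omega)]
        exact hv r (by omega)
      have hwc : w ∘ (Fin.cons (k + 1) (Fin.cons k a) : Fin (m + 2) → ℕ) =
          Fin.cons j (Fin.cons x u) := by
        funext i
        refine Fin.cases ?_ (fun i => Fin.cases ?_ (fun i => ?_) i) i
        · simpa using hw1
        · simpa using hw0
        · simpa using congrFun (hua x j _) i
      rw [hwc] at e1
      have e1' : Runs Ps (regs inp out w) ((tupleNorm u + cnt u + bd u) ^ e)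
          (regs inp out (Function.update w (k + 3) (step u j x))) := by
        refine Runs.mono e1 ((he _).trans (Nat.pow_le_pow_left ?_ e))
        simp only [tupleNorm, Fin.sum_univ_succ, Fin.cons_zero, Fin.cons_succ]
        omega
      have e2 := e1'.seq (runs_clear k)
      have e3 := e2.seq (runs_move (show k + 3 ≠ k by omega))
      have e4 := e3.seq (runs_inc (k + 1))
      refine Runs.mono ?_ (T := (((tupleNorm u + cnt u + bd u) ^ e +
        (2 * x + 1) + 1 + (2 * step u j x + 1) + 1) + 1 + 1)) (by omega)
      refine e4.cast rfl (le_of_eq ?_) ?_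
      · have q1 : Function.update w (k + 3) (step u j x) k = x := by
          rw [Function.update_of_ne (by omega), hw0]
        have q2 : Function.update (Function.update w (k + 3) (step u j x)) k 0 (k + 3)
          = step u j x := by
          rw [Function.update_of_ne (by omega), Function.update_self]
        rw [q1, q2]
      · funext r
        have hs : Nat.rec (init u) (step u) (j + 1) = step u j x := rfl
        rw [hs]
        simp only [hw, Function.update_apply]
        split_ifs <;> subst_vars <;> first | rfl | omega)
  have h3' := h3.cast (w := Function.update (Function.update v k (init u)) (k + 2) (cnt u)) (by
      funext r
      have := hv (k + 1) (by omega)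
      simp only [Function.update_apply, Nat.sub_self]
      split_ifs <;> subst_vars <;> first | rfl | omega) le_rfl rfl
  refine (((h1.seq h2).seq h3').seq (runs_clear (k + 1))).cast rfl (le_of_eq ?_) ?_
  · simp [hu]
  · funext r
    have := hv (k + 1) (by omega)
    have := hv (k + 2) (by omega)
    simp only [Function.update_apply, Nat.sub_zero]
    split_ifs <;> first | rfl | omega | simp_all

end UnaryComp

namespace Emits

variable {m : ℕ}

theorem letter (c : Option Bool) : Emits fun _ : Fin m → ℕ => [c] :=
  ⟨fun _ => 1, .const 1, fun _ _ _ => ⟨push 1 c, fun _ _ _ _ => runs_emit c⟩⟩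

/-- The output is a stack, so words are put in front of what is already there and the second word
has to be written first. -/
theorem append {F G : (Fin m → ℕ) → List (Option Bool)} (hF : Emits F) (hG : Emits G) :
    Emits fun v => F v ++ G v := by
  obtain ⟨cF, hcF, hF⟩ := hF
  obtain ⟨cG, hcG, hG⟩ := hG
  refine ⟨fun v => cG v + cF v + 1, (hcG.add hcF).add (.const 1), fun k a ha => ?_⟩
  obtain ⟨P, hP⟩ := hF k a ha
  obtain ⟨P', hP'⟩ := hG k a ha
  refine ⟨seq P' P, fun inp out v hv => ?_⟩
  rw [List.append_assoc]
  exact (hP' inp out v hv).seq (hP inp _ v hv)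

/-- The loop counter runs downwards while the output grows at its front; the two reversals cancel,
and the words appear in increasing order of the index. The counter ends at zero, so no cleanup is
needed. -/
theorem flatMap_range {cnt : (Fin m → ℕ) → ℕ} {F : (Fin m → ℕ) → ℕ → List (Option Bool)}
    (hcnt : UnaryComp cnt) (hF : Emits fun w : Fin (m + 1) → ℕ => F (fun i => w i.succ) (w 0)) :
    Emits fun v => (List.range (cnt v)).flatMap (F v) := by
  obtain ⟨hcb, cc, hcc, hcnt⟩ := hcnt
  obtain ⟨cF, ⟨e, he⟩, hF⟩ := hF
  refine ⟨fun v => cc v + (cnt v * ((tupleNorm v + cnt v) ^ e + 1) + 1) + 1,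
    (hcc.add ((hcb.mul ((((PolyBdd.norm fun j => .var j).add hcb).pow e).add (.const 1))).add
    (.const 1))).add (.const 1), fun k a ha => ?_⟩
  obtain ⟨Pc, hPc⟩ := hcnt k a ha
  obtain ⟨P, hP⟩ := hF (k + 1) (Fin.cons k a) (by
    intro i
    refine Fin.cases ?_ (fun i => ?_) i
    · simp
    · have := ha i
      simp only [Fin.cons_succ]
      omega)
  refine ⟨seq Pc (rloop k P), fun inp out v hv => ?_⟩
  set u := v ∘ a with hu
  have h1 := hPc inp out v hv
  have h2 := runs_rloop (inp := inp) (r := k) (n := cnt u) (P := P)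
    (C := (tupleNorm u + cnt u) ^ e)
    (o := fun i => ((List.range (cnt u)).drop i).flatMap (F u) ++ out)
    (w := fun i => Function.update v k i) (fun i _ => by simp) (fun i hi => by
      have e1 := hP inp (((List.range (cnt u)).drop (i + 1)).flatMap (F u) ++ out)
        (Function.update v k i) fun r hr => by
          rw [Function.update_of_ne (by omega)]; exact hv r (by omega)
      have hwc : Function.update v k i ∘ (Fin.cons k a : Fin (m + 1) → ℕ) = Fin.cons i u := by
        funext j
        refine Fin.cases ?_ (fun j => ?_) j
        · simp
        · have := ha j
          simp only [Function.comp, Fin.cons_succ, hu]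
          rw [Function.update_of_ne (by omega)]
      rw [hwc] at e1
      have hd : (List.range (cnt u)).drop i = i :: (List.range (cnt u)).drop (i + 1) := by
        rw [List.drop_eq_getElem_cons (by simpa using hi), List.getElem_range]
      rw [Function.update_idem, hd, List.flatMap_cons, List.append_assoc]
      refine Runs.mono e1 ((he _).trans (Nat.pow_le_pow_left ?_ e))
      simp only [tupleNorm, Fin.sum_univ_succ, Fin.cons_zero, Fin.cons_succ]
      omega)
  refine h1.seq ?_
  have hv0 : Function.update v k 0 = v := by rw [← hv k le_rfl, Function.update_eq_self]
  rw [List.drop_of_length_le (by simp), List.drop_zero, hv0] at h2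
  exact h2

end Emits

end

noncomputable section

/-! ### Arithmetic on unary registers -/

namespace UnaryComp

variable {m : ℕ} {f g h : (Fin m → ℕ) → ℕ}

theorem comp1 {F : ℕ → ℕ} (hF : UnaryComp fun v : Fin 1 → ℕ => F (v 0)) (hf : UnaryComp f) :
    UnaryComp fun v => F (f v) :=
  hF.comp (g := ![f]) (by simpa using hf)

theorem comp2 {F : ℕ → ℕ → ℕ} (hF : UnaryComp fun v : Fin 2 → ℕ => F (v 0) (v 1))
    (hf : UnaryComp f) (hg : UnaryComp g) : UnaryComp fun v => F (f v) (g v) :=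
  hF.comp (g := ![f, g]) (by simpa [Fin.forall_fin_succ] using ⟨hf, hg⟩)

theorem comp3 {F : ℕ → ℕ → ℕ → ℕ} (hF : UnaryComp fun v : Fin 3 → ℕ => F (v 0) (v 1) (v 2))
    (hf : UnaryComp f) (hg : UnaryComp g) (hh : UnaryComp h) :
    UnaryComp fun v => F (f v) (g v) (h v) :=
  hF.comp (g := ![f, g, h]) (by simpa [Fin.forall_fin_succ] using ⟨hf, hg, hh⟩)

theorem congr (hf : UnaryComp f) (h : ∀ v, f v = g v) : UnaryComp g := by
  rwa [funext h] at hf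

theorem succ (hf : UnaryComp f) : UnaryComp fun v => f v + 1 :=
  comp1 (F := fun x => x + 1) succ_aux hf

theorem const (n : ℕ) : UnaryComp fun _ : Fin m → ℕ => n := by
  induction n with
  | zero => exact zero
  | succ n ih => exact ih.succ

theorem add (hf : UnaryComp f) (hg : UnaryComp g) : UnaryComp fun v => f v + g v := by
  have e : ∀ x y : ℕ, Nat.rec x (fun _ acc => acc + 1) y = x + y := fun x y => by
    induction y with
    | zero => rfl
    | succ y ih => simp only [ih]; omega
  refine comp2 (F := fun x y => x + y) (UnaryComp.congr (natRec (cnt := fun v => v 1)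
    (init := fun v => v 0) (step := fun _ _ acc => acc + 1) (var 1) (var 0) (var 1).succ
    (bd := fun v => v 0 + v 1) ((PolyBdd.var 0).add (.var 1)) ?_) fun v => e _ _) hf hg
  intro v j hj
  rw [e]
  omega

theorem mul (hf : UnaryComp f) (hg : UnaryComp g) : UnaryComp fun v => f v * g v := by
  have e : ∀ x y : ℕ, Nat.rec 0 (fun _ acc => acc + x) y = x * y := fun x y => by
    induction y with
    | zero => rfl
    | succ y ih => simp only [ih]; ring
  refine comp2 (F := fun x y => x * y) (UnaryComp.congr (natRec (cnt := fun v => v 1)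
    (init := fun _ => 0) (step := fun v _ acc => acc + v 0) (var 1) (const 0)
    ((var 1).add (var _)) (bd := fun v => v 0 * v 1) ((PolyBdd.var 0).mul (.var 1)) ?_)
    fun v => e _ _) hf hg
  intro v j hj
  rw [e]
  exact Nat.mul_le_mul_left _ hj

theorem pred (hf : UnaryComp f) : UnaryComp fun v => f v - 1 := by
  have e : ∀ y : ℕ, Nat.rec 0 (fun j _ => j) y = y - 1 := fun y => by
    cases y <;> rfl
  refine comp1 (F := fun x => x - 1) (UnaryComp.congr (natRec (cnt := fun v => v 0)
    (init := fun _ => 0) (step := fun _ j _ => j) (var 0) (const 0)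
    (var 0) (bd := fun v => v 0) (PolyBdd.var 0) ?_) fun v => e _) hf
  intro v j hj
  rw [e]
  omega

theorem sub (hf : UnaryComp f) (hg : UnaryComp g) : UnaryComp fun v => f v - g v := by
  have e : ∀ x y : ℕ, Nat.rec x (fun _ acc => acc - 1) y = x - y := fun x y => by
    induction y with
    | zero => rfl
    | succ y ih => simp only [ih]; omega
  refine comp2 (F := fun x y => x - y) (UnaryComp.congr (natRec (cnt := fun v => v 1)
    (init := fun v => v 0) (step := fun _ _ acc => acc - 1) (var 1) (var 0) (var 1).pred
    (bd := fun v => v 0) (PolyBdd.var 0) ?_) fun v => e _ _) hf hg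
  intro v j hj
  rw [e]
  omega

end UnaryComp

/-- The predicate `p` is decided by programs on unary registers. -/
def UnaryPred {m : ℕ} (p : (Fin m → ℕ) → Prop) : Prop :=
  ∃ f, UnaryComp f ∧ ∀ v, f v = 1 ∧ p v ∨ f v = 0 ∧ ¬ p v

namespace UnaryPred

variable {m : ℕ} {f g : (Fin m → ℕ) → ℕ} {p q : (Fin m → ℕ) → Prop}

theorem le (hf : UnaryComp f) (hg : UnaryComp g) : UnaryPred fun v => f v ≤ g v :=
  ⟨fun v => 1 - (f v - g v), (UnaryComp.const 1).sub (hf.sub hg), fun v => by dsimp only; omega⟩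

theorem lt (hf : UnaryComp f) (hg : UnaryComp g) : UnaryPred fun v => f v < g v :=
  le hf.succ hg

theorem not (hp : UnaryPred p) : UnaryPred fun v => ¬ p v := by
  obtain ⟨f, hf, h⟩ := hp
  refine ⟨fun v => 1 - f v, (UnaryComp.const 1).sub hf, fun v => ?_⟩
  rcases h v with ⟨h1, h2⟩ | ⟨h1, h2⟩ <;> simp [h1, h2]

theorem and (hp : UnaryPred p) (hq : UnaryPred q) : UnaryPred fun v => p v ∧ q v := by
  obtain ⟨f, hf, h⟩ := hp
  obtain ⟨g, hg, h'⟩ := hq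
  refine ⟨fun v => f v * g v, hf.mul hg, fun v => ?_⟩
  rcases h v with ⟨h1, h2⟩ | ⟨h1, h2⟩ <;> rcases h' v with ⟨h3, h4⟩ | ⟨h3, h4⟩ <;>
    simp [h1, h2, h3, h4]

theorem congr (hp : UnaryPred p) (h : ∀ v, p v ↔ q v) : UnaryPred q := by
  rwa [funext fun v => propext (h v)] at hp

theorem or (hp : UnaryPred p) (hq : UnaryPred q) : UnaryPred fun v => p v ∨ q v :=
  (hp.not.and hq.not).not.congr fun v => by tauto

theorem imp (hp : UnaryPred p) (hq : UnaryPred q) : UnaryPred fun v => p v → q v :=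
  (hp.not.or hq).congr fun v => by tauto

theorem eq (hf : UnaryComp f) (hg : UnaryComp g) : UnaryPred fun v => f v = g v :=
  ((le hf hg).and (le hg hf)).congr fun _ => le_antisymm_iff.symm

theorem ite [DecidablePred p] (hp : UnaryPred p) (hf : UnaryComp f) (hg : UnaryComp g) :
    UnaryComp fun v => if p v then f v else g v := by
  obtain ⟨c, hc, h⟩ := hp
  refine ((hc.mul hf).add (((UnaryComp.const 1).sub hc).mul hg)).congr fun v => ?_
  rcases h v with ⟨h1, h2⟩ | ⟨h1, h2⟩ <;> simp [h1, h2]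

theorem ball {cnt : (Fin m → ℕ) → ℕ} {p : (Fin m → ℕ) → ℕ → Prop} (hcnt : UnaryComp cnt)
    (hp : UnaryPred fun w : Fin (m + 1) → ℕ => p (fun i => w i.succ) (w 0)) :
    UnaryPred fun v => ∀ i < cnt v, p v i := by
  classical
  have e : ∀ v j, Nat.rec (motive := fun _ => ℕ) 1 (fun i acc => if p v i then acc else 0) j =
      if ∀ i < j, p v i then 1 else 0 := fun v j => by
    induction j with
    | zero => simp
    | succ j ih =>
      simp only [ih, Nat.forall_lt_succ_right]
      split_ifs <;> first | rfl | (exfalso; tauto)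
  refine ⟨_, UnaryComp.natRec (cnt := cnt) (init := fun _ => 1)
    (step := fun v i acc => if p v i then acc else 0) hcnt (.const 1) ?_ (bd := fun _ => 1)
    (.const 1) ?_, fun v => ?_⟩
  · refine UnaryPred.ite (p := fun w : Fin (m + 2) → ℕ => p (fun i => w i.succ.succ) (w 0)) ?_
      (.var 1) (.const 0)
    obtain ⟨f, hf, h⟩ := hp
    -- The recursion step receives index, accumulator and arguments; the predicate must skip the
    -- accumulator in position `1`.
    refine ⟨fun w => f (Fin.cons (w 0) fun i => w i.succ.succ), ?_, fun w => ?_⟩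
    · refine (hf.comp (g := Fin.cons (fun w : Fin (m + 2) → ℕ => w 0) fun i w => w i.succ.succ)
        fun j => ?_).congr fun w => ?_
      · refine Fin.cases ?_ (fun j => ?_) j
        · exact .var 0
        · exact .var _
      · congr 1
        funext j
        refine Fin.cases ?_ (fun j => ?_) j <;> simp
    · simpa using h (Fin.cons (w 0) fun i => w i.succ.succ)
  · intro v j _
    rw [e]
    split_ifs <;> omega
  · rw [e]
    split_ifs with h
    · exact Or.inl ⟨rfl, h⟩
    · exact Or.inr ⟨rfl, h⟩

end UnaryPred

namespace UnaryComp

variable {m : ℕ} {f g h : (Fin m → ℕ) → ℕ}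

theorem min (hf : UnaryComp f) (hg : UnaryComp g) : UnaryComp fun v => min (f v) (g v) :=
  (UnaryPred.ite (UnaryPred.le hf hg) hf hg).congr fun _ => by rw [Nat.min_def]

/-- The quotient is found by counting up as long as its successor still fits; `x` rounds are enough
because `x / y ≤ x`. The guard `0 < y` produces the convention `x / 0 = 0`. -/
theorem div (hf : UnaryComp f) (hg : UnaryComp g) : UnaryComp fun v => f v / g v := by
  have e : ∀ x y j : ℕ, Nat.rec (motive := fun _ => ℕ) 0
      (fun _ acc => if 0 < y ∧ (acc + 1) * y ≤ x then acc + 1 else acc) j =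
        Min.min j (x / y) := fun x y j => by
    induction j with
    | zero => simp
    | succ j ih =>
      simp only [ih]
      rcases Nat.eq_zero_or_pos y with rfl | hy
      · simp
      · simp only [← Nat.le_div_iff_mul_le hy]
        split_ifs <;> omega
  refine comp2 (F := fun x y => x / y) (UnaryComp.congr (natRec (cnt := fun v => v 0)
    (init := fun _ => 0)
    (step := fun v _ acc => if 0 < v 1 ∧ (acc + 1) * v 1 ≤ v 0 then acc + 1 else acc)
    (var 0) (const 0) (UnaryPred.ite ((UnaryPred.lt (const 0) (var _)).and
      (UnaryPred.le ((var 1).succ.mul (var _)) (var _))) (var 1).succ (var 1))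
    (bd := fun v => v 0) (PolyBdd.var 0) ?_) fun v => ?_) hf hg
  · intro v j hj
    rw [e]
    omega
  · rw [e]
    exact min_eq_right (Nat.div_le_self _ _)

theorem mod (hf : UnaryComp f) (hg : UnaryComp g) : UnaryComp fun v => f v % g v :=
  (hf.sub (hg.mul (hf.div hg))).congr fun v => by
    have := Nat.div_add_mod (f v) (g v)
    omega

/-- Division by a power. -/
theorem divPow (hf : UnaryComp f) (hg : UnaryComp g) (hh : UnaryComp h) :
    UnaryComp fun v => f v / g v ^ h v := by
  -- Dividing repeatedly keeps all intermediate values at most `x`, whereas the power itself is not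
  -- polynomially bounded in `y` and `j`.
  have e : ∀ x y j : ℕ, Nat.rec (motive := fun _ => ℕ) x (fun _ acc => acc / y) j =
      x / y ^ j := fun x y j => by
    induction j with
    | zero => simp
    | succ j ih => simp only [ih]; rw [Nat.div_div_eq_div_mul, pow_succ]
  refine comp3 (F := fun x y z => x / y ^ z) (UnaryComp.congr (natRec (cnt := fun v => v 2)
    (init := fun v => v 0) (step := fun v _ acc => acc / v 1) (var 2) (var 0)
    ((var 1).div (var _)) (bd := fun v => v 0) (PolyBdd.var 0) ?_) fun v => e _ _ _) hf hg hh
  intro v j _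
  rw [e]
  exact Nat.div_le_self _ _

/-- The binary length. -/
theorem size (hf : UnaryComp f) : UnaryComp fun v => (f v).size := by
  have e : ∀ x j : ℕ, Nat.rec (motive := fun _ => ℕ) 0
      (fun _ acc => if 0 < x / 2 ^ acc then acc + 1 else acc) j = Min.min j x.size :=
    fun x j => by
      induction j with
      | zero => simp
      | succ j ih =>
        simp only [ih]
        have h : 0 < x / 2 ^ Min.min j x.size ↔ Min.min j x.size < x.size := by
          rw [Nat.lt_size, Nat.div_pos_iff]
          simp
        simp only [h]
        split_ifs <;> omega
  have hs : ∀ x : ℕ, x.size ≤ x := fun x => Nat.size_le.2 Nat.lt_two_pow_self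
  refine comp1 (F := Nat.size) (UnaryComp.congr (natRec (cnt := fun v => v 0)
    (init := fun _ => 0) (step := fun v _ acc => if 0 < v 0 / 2 ^ acc then acc + 1 else acc)
    (var 0) (const 0) (UnaryPred.ite (UnaryPred.lt (const 0) ((var _).divPow (const 2) (var 1)))
      (var 1).succ (var 1)) (bd := fun v => v 0) (PolyBdd.var 0) ?_) fun v => ?_) hf
  · intro v j hj
    rw [e]
    omega
  · rw [e]
    exact min_eq_right (hs _)

/-- The power `g v ^ h v`, as long as it does not exceed `f v`. -/
theorem cappedPow (hf : UnaryComp f) (hg : UnaryComp g) (hh : UnaryComp h) :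
    UnaryComp fun v => Nat.rec (motive := fun _ => ℕ) 1
      (fun _ acc => Min.min (acc * g v) (f v)) (h v) := by
  -- The bound is `v 0 + 1` and not `v 0` because the recursion starts at `1` even when the cap is
  -- zero.
  refine comp3 (F := fun x y z => Nat.rec (motive := fun _ => ℕ) 1
    (fun _ acc => Min.min (acc * y) x) z) (natRec (cnt := fun v => v 2)
    (init := fun _ => 1) (step := fun v _ acc => Min.min (acc * v 1) (v 0)) (var 2) (const 1)
    (((var 1).mul (var _)).min (var _)) (bd := fun v => v 0 + 1)
    ((PolyBdd.var 0).add (.const 1)) ?_) hf hg hh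
  intro v j _
  cases j with
  | zero => simp
  | succ j => exact (min_le_right _ _).trans (Nat.le_succ _)

/-- The powers increase, so a cap above the last one is never active. -/
theorem rec_min_mul {b e c : ℕ} (hb : 0 < b) (h : b ^ e ≤ c) :
    Nat.rec (motive := fun _ => ℕ) 1 (fun _ acc => Min.min (acc * b) c) e = b ^ e := by
  induction e with
  | zero => simp
  | succ e ih =>
    simp only [ih ((Nat.pow_le_pow_right hb (Nat.le_succ e)).trans h)]
    rw [← pow_succ, min_eq_left h]

end UnaryComp

namespace Emits

variable {m : ℕ}

theorem congr {F G : (Fin m → ℕ) → List (Option Bool)} (hF : Emits F) (h : ∀ v, F v = G v) :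
    Emits G := by
  rwa [funext h] at hF

theorem _root_.Nat.bits_eq_map_testBit (n : ℕ) : n.bits = (List.range n.size).map n.testBit := by
  refine List.ext_getElem (by simp [Nat.size_eq_bits_len]) fun i h1 h2 => ?_
  rw [List.getElem_map, List.getElem_range, Nat.testBit_eq_inth, List.getI_eq_getElem _ h1]

/-- A number in binary, with a separator. -/
theorem bits {f : (Fin m → ℕ) → ℕ} (hf : UnaryComp f) :
    Emits fun v => (f v).bits.map some ++ [none] := by
  have hb : UnaryComp fun w : Fin (m + 1) → ℕ => f (fun i => w i.succ) / 2 ^ w 0 % 2 :=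
    (((hf.comp (g := fun i w => w i.succ) fun i => .var _).divPow (.const 2) (.var 0)).mod
      (.const 2))
  refine Emits.append ?_ (letter none)
  refine (flatMap_range (F := fun v i => [some ((f v).testBit i)]) hf.size ?_).congr fun v => ?_
  -- Choosing a letter without branching: one loop has the bit as its number of rounds, the other
  -- the complementary bit, so exactly one letter is written.
  · refine ((flatMap_range (F := fun _ _ => [some true]) hb (letter _)).append
      (flatMap_range (F := fun _ _ => [some false]) ((UnaryComp.const 1).sub hb)
        (letter _))).congr fun w => ?_
    rw [Nat.testBit_eq_decide_div_mod_eq]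
    rcases Nat.mod_two_eq_zero_or_one (f (fun i => w i.succ) / 2 ^ w 0) with h | h <;>
      simp [h]
  · rw [Nat.bits_eq_map_testBit, List.map_map]
    simp [Function.comp_def, ← List.map_eq_flatMap]

/-- A number in unary, with a separator. -/
theorem unary {f : (Fin m → ℕ) → ℕ} (hf : UnaryComp f) :
    Emits fun v => (unaryWord (f v)).map some ++ [none] := by
  refine Emits.append ?_ (letter none)
  refine (flatMap_range (F := fun _ _ => [some true]) hf (letter _)).congr fun v => ?_
  simp [unaryWord, ← List.map_eq_flatMap]

end Emits

end

noncomputable section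

/-! ### Reading the input into registers -/

/-- Fold one letter of the input into a number whose digits in base `b` are the values of the
words. -/
def readLetter (b : ℕ) : Option Bool → ℕ → ℕ
  | none, t => t * b
  | some c, t => t + t % b + c.toNat

/-- The base `2 ^ (n + 1)`, the number `2 ^ (n (n + 1))`, and the number whose digits are the
values of the words of the input, where `n` is the length of the input. -/
def readInput (l : List (Option Bool)) : Fin 3 → ℕ :=
  ![2 ^ (l.length + 1), (2 ^ (l.length + 1)) ^ l.length,
    l.foldr (readLetter (2 ^ (l.length + 1))) 0]

/-- Reading a letter at most multiplies `t + 1` by `b`: a separator gives `t * b`, a bit gives at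
most `2 * t + 1`. -/
theorem foldr_readLetter_lt {b : ℕ} (hb : 2 ≤ b) (l : List (Option Bool)) :
    l.foldr (readLetter b) 0 < b ^ l.length := by
  induction l with
  | nil => simp
  | cons c l ih =>
    rw [List.foldr_cons, List.length_cons, pow_succ]
    generalize l.foldr (readLetter b) 0 = t at ih ⊢
    generalize b ^ l.length = x at ih ⊢
    have h1 : (t + 1) * b ≤ x * b := Nat.mul_le_mul_right _ ih
    rcases c with _ | c
    · simp only [readLetter]
      nlinarith
    · have h2 : t % b ≤ t := Nat.mod_le _ _
      have h3 : c.toNat ≤ 1 := by cases c <;> simp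
      simp only [readLetter]
      nlinarith

/-- After a separator the last digit is zero. Folding from the right meets the most significant bit
first, and each bit doubles the last digit and adds itself; since `2 ^ w.length ≤ b`, no carry
reaches the higher digits. The digit is identified with a number only for words that are binary
expansions. -/
theorem foldr_readLetter_word {b : ℕ} (w : List Bool) (hw : 2 ^ w.length ≤ b)
    (t : ℕ) : ∃ x < 2 ^ w.length, (∀ n : ℕ, n.bits = w → x = n) ∧
      (w.map some).foldr (readLetter b) (t * b) = t * b + x := by
  induction w with
  | nil =>
    refine ⟨0, by simp, fun n hn => ?_, by simp⟩
    have : n.bits.length = 0 := by rw [hn]; rfl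
    rw [Nat.size_eq_bits_len, Nat.size_eq_zero] at this
    exact this.symm
  | cons c w ih =>
    rw [List.length_cons, pow_succ] at hw
    obtain ⟨x, hx, h, e⟩ := ih (by omega)
    have hc : c.toNat ≤ 1 := by cases c <;> simp
    refine ⟨2 * x + c.toNat, by rw [List.length_cons, pow_succ]; omega, fun n hn => ?_, ?_⟩
    · have hn0 : n ≠ 0 := by rintro rfl; simp at hn
      rw [← Nat.bit_bodd_div2 n] at hn
      rw [Nat.bits_append_bit] at hn
      · rw [List.cons.injEq] at hn
        rw [h _ hn.2, ← hn.1]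
        conv_rhs => rw [← Nat.bit_bodd_div2 n, Nat.bit_val]
      · intro h0
        have := Nat.bit_bodd_div2 n
        rw [h0] at this
        rcases hb : n.bodd
        · rw [hb] at this; simp at this; exact absurd this.symm hn0
        · rfl
    · rw [List.map_cons, List.foldr_cons, e]
      simp only [readLetter]
      rw [Nat.mul_add_mod', Nat.mod_eq_of_lt (by omega)]
      omega

/-- The digits of the number read are the values of the words. -/
theorem readInput_digit {b : ℕ} (hb : 0 < b) (L : List ℕ)
    (hL : ∀ n ∈ L, 2 ^ n.bits.length ≤ b) (k : ℕ) :
    (encodeWords (L.map Nat.bits)).foldr (readLetter b) 0 / b ^ k % b = L[k]?.getD 0 := by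
  induction L generalizing k with
  | nil => simp [encodeWords]
  | cons n L ih =>
    have e : encodeWords ((n :: L).map Nat.bits) =
        n.bits.map some ++ none :: encodeWords (L.map Nat.bits) := by
      simp [encodeWords]
    rw [e, List.foldr_append, List.foldr_cons]
    obtain ⟨x, hx, h, e⟩ := foldr_readLetter_word (b := b) n.bits (hL n (by simp))
      ((encodeWords (L.map Nat.bits)).foldr (readLetter b) 0)
    have hxb : x < b := hx.trans_le (hL n (by simp))
    -- The number read is now `t * b + n`, with `t` the number read from the remaining words: the
    -- last digit is `n`, and dividing by `b` removes it.
    rw [readLetter, e, h n rfl] at *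
    cases k with
    | zero => simp [Nat.mod_eq_of_lt hxb]
    | succ k =>
      rw [pow_succ', ← Nat.div_div_eq_div_mul, Nat.mul_comm, Nat.mul_add_div hb,
        Nat.div_eq_of_lt hxb, add_zero, ih fun n hn => hL n (List.mem_cons_of_mem _ hn)]
      simp

/-- The registers holding the triple `u`. -/
def triple (u : Fin 3 → ℕ) (r : ℕ) : ℕ := if h : r < 3 then u ⟨r, h⟩ else 0

theorem triple_comp (u : Fin 3 → ℕ) : triple u ∘ (fun i : Fin 3 => (i : ℕ)) = u := by
  funext i
  simp [triple]

theorem triple_of_le (u : Fin 3 → ℕ) {r : ℕ} (h : 3 ≤ r) : triple u r = 0 := by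
  simp [triple, h]

theorem update_triple (u : Fin 3 → ℕ) (i : Fin 3) (x : ℕ) :
    Function.update (triple u) i x = triple (Function.update u i x) := by
  funext r
  by_cases h : r < 3
  · simp [triple, h, Function.update_apply, Fin.ext_iff]
  · have : r ≠ i := by omega
    simp [triple, h, this]

namespace StackProg

/-- Assign the value of `f` to one of three registers. -/
theorem exists_assign {f : (Fin 3 → ℕ) → ℕ} (hf : UnaryComp f) (i : Fin 3) :
    ∃ (P : StackProg) (cost : (Fin 3 → ℕ) → ℕ), PolyBdd cost ∧ ∀ inp out u,
      Runs P (regs inp out (triple u)) (cost u)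
        (regs inp out (triple (Function.update u i (f u)))) := by
  obtain ⟨hfb, cost, hc, h⟩ := hf
  obtain ⟨P, hP⟩ := h 3 (fun i => i) fun i => i.2
  refine ⟨seq (seq P (clear i)) (move 3 i), fun u => cost u + (2 * u i + 1) + 1 + (2 * f u + 1) + 1,
    (((hc.add (((PolyBdd.const 2).mul (.var i)).add (.const 1))).add (.const 1)).add
      (((PolyBdd.const 2).mul hfb).add (.const 1))).add (.const 1), fun inp out u => ?_⟩
  have hi := i.2
  have h1 := hP inp out (triple u) fun r hr => triple_of_le u hr
  rw [triple_comp] at h1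
  have h2 := (h1.seq (runs_clear i)).seq (runs_move (show 3 ≠ (i : ℕ) by omega))
  refine h2.cast rfl (le_of_eq ?_) ?_
  · have e1 : Function.update (triple u) 3 (f u) i = u i := by
      rw [Function.update_of_ne (by omega)]
      exact congrFun (triple_comp u) i
    have e2 : Function.update (Function.update (triple u) 3 (f u)) i 0 3 = f u := by
      rw [Function.update_of_ne (by omega), Function.update_self]
    rw [e1, e2]
  · rw [← update_triple]
    funext r
    have := triple_of_le u (le_refl 3)
    simp only [Function.update_apply]
    split_ifs <;> subst_vars <;> omega

theorem Runs.loop_nil {k : ℕ} {P : Option Bool → StackProg} {s : Stacks} (h : s k = []) :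
    Runs (loop k P) s 1 s := ⟨1, le_rfl, .loop_nil h⟩

theorem Runs.loop_cons {k : ℕ} {P : Option Bool → StackProg} {s s' s'' : Stacks} {c : Option Bool}
    {l : List (Option Bool)} {T T' : ℕ} (h : s k = c :: l)
    (h1 : Runs (P c) (Function.update s k l) T s') (h2 : Runs (loop k P) s' T' s'') :
    Runs (loop k P) s (T + T' + 1) s'' := by
  obtain ⟨t, ht, h1⟩ := h1
  obtain ⟨t', ht', h2⟩ := h2
  exact ⟨t + t' + 1, by omega, .loop_cons h h1 h2⟩

theorem update_regs_inp {inp out : List (Option Bool)} {v : ℕ → ℕ} (l : List (Option Bool)) :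
    Function.update (regs inp out v) 0 l = regs l out v := by
  funext x
  rcases x with _ | _ | x <;> simp [regs]

/-- A first pass reverses the input onto the output stack and computes the base. -/
theorem exists_reverse_pass : ∃ (P : StackProg) (c : ℕ), ∀ l o (u : Fin 3 → ℕ) (D : ℕ),
    tupleNorm (Function.update u 0 (u 0 * 2 ^ l.length)) ≤ D →
    Runs P (regs l o (triple u)) (l.length * (D ^ c + 3) + 1)
      (regs [] (l.reverse ++ o) (triple (Function.update u 0 (u 0 * 2 ^ l.length)))) := by
  obtain ⟨P, cost, ⟨c, hc⟩, hP⟩ := exists_assign ((UnaryComp.var 0).mul (.const 2)) (0 : Fin 3)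
  refine ⟨loop 0 fun c => seq (push 1 c) P, c, fun l => ?_⟩
  induction l with
  | nil =>
    intro o u D _
    refine (Runs.loop_nil rfl).mono (by simp) |>.cast rfl le_rfl (by simp)
  | cons x l ih =>
    intro o u D hD
    set u' := Function.update u 0 (u 0 * 2) with hu'
    have hD' : Function.update u 0 (u 0 * 2 ^ (x :: l).length) =
        Function.update u' 0 (u' 0 * 2 ^ l.length) := by
      simp [hu', pow_succ', mul_assoc]
    rw [hD'] at hD ⊢
    have h2 := ih (x :: o) u' D hD
    have h1 := (runs_emit (inp := l) (out := o) (v := triple u) x).seq (hP l (x :: o) u)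
    -- The base only grows, so the norm of the final triple bounds that of every earlier one.
    have hn : tupleNorm u ≤ D := by
      refine le_trans ?_ hD
      unfold tupleNorm
      gcongr with i
      by_cases hi : i = 0
      · subst hi
        simp only [hu', Function.update_self, mul_assoc]
        exact Nat.le_mul_of_pos_right _ (by positivity)
      · simp [hu', hi]
    have hcD : cost u ≤ D ^ c := (hc u).trans (Nat.pow_le_pow_left hn c)
    have h3 := Runs.loop_cons (k := 0) (P := fun c => seq (push 1 c) P)
      (s := regs (x :: l) o (triple u)) rfl (by rw [update_regs_inp]; exact h1) h2
    rw [List.reverse_cons, List.append_assoc]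
    refine h3.mono ?_
    rw [List.length_cons, Nat.succ_mul]
    omega

/-- A second pass folds the reversed input into the third register. -/
theorem exists_fold_pass : ∃ (P : StackProg) (c : ℕ), ∀ l (u : Fin 3 → ℕ) (D : ℕ), 2 ≤ u 0 →
    2 + u 0 + u 1 * u 0 ^ l.length + (u 2 + 1) * u 0 ^ l.length ≤ D →
    Runs P (regs [] l (triple u)) (l.length * (D ^ c + 1) + 1)
      (regs [] [] (triple ![u 0, u 1 * u 0 ^ l.length,
        l.foldl (fun t x => readLetter (u 0) x t) (u 2)])) := by
  obtain ⟨P, cost, ⟨c, hc⟩, hP⟩ := exists_assign ((UnaryComp.var 1).mul (.var 0)) (1 : Fin 3)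
  have hQ : ∀ x : Option Bool, ∃ (P : StackProg) (cost : (Fin 3 → ℕ) → ℕ), PolyBdd cost ∧
      ∀ inp out u, Runs P (regs inp out (triple u)) (cost u)
        (regs inp out (triple (Function.update u 2 (readLetter (u 0) x (u 2))))) := by
    intro x
    refine exists_assign ?_ 2
    cases x with
    | none => exact (UnaryComp.var 2).mul (.var 0)
    | some b => exact ((UnaryComp.var 2).add ((UnaryComp.var 2).mod (.var 0))).add (.const _)
  choose Q cost' hc' hQ using hQ
  choose c' hc' using hc'
  refine ⟨loop 1 fun x => seq P (Q x), c + (c' none + (c' (some true) + c' (some false))) + 2,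
    fun l => ?_⟩
  -- One exponent dominates the cost of the multiplication and of all three letters; the `2` added
  -- to it absorbs the constant overhead of a round, since `4 ≤ D ^ 2`.
  set C := c + (c' none + (c' (some true) + c' (some false))) with hC
  have hcC : ∀ x, c' x ≤ C := by rintro (_ | _ | _) <;> omega
  induction l with
  | nil =>
    intro u D _ _
    refine (Runs.loop_nil rfl).cast rfl (by simp) ?_
    congr 1
    funext i
    fin_cases i <;> simp
  | cons x l ih =>
    intro u D hu hD
    set u' : Fin 3 → ℕ := Function.update u 1 (u 1 * u 0) with hu'
    set u'' : Fin 3 → ℕ := Function.update u' 2 (readLetter (u' 0) x (u' 2)) with hu''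
    have e0 : u'' 0 = u 0 := by simp [hu', hu'']
    have e1 : u'' 1 = u 1 * u 0 := by simp [hu', hu'']
    have e2 : u'' 2 = readLetter (u 0) x (u 2) := by simp [hu', hu'']
    have h2le : readLetter (u 0) x (u 2) + 1 ≤ (u 2 + 1) * u 0 := by
      have h2 : u 2 % u 0 ≤ u 2 := Nat.mod_le _ _
      cases x with
      | none => simp only [readLetter]; nlinarith
      | some b =>
        have h3 : b.toNat ≤ 1 := by cases b <;> simp
        simp only [readLetter]
        nlinarith
    rw [List.length_cons, pow_succ'] at hD
    have hpos : 0 < u 0 ^ l.length := by positivity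
    have h3 := ih u'' D (e0 ▸ hu) (by
      rw [e0, e1, e2]
      refine le_trans ?_ hD
      rw [← mul_assoc, ← mul_assoc]
      gcongr)
    rw [e0, e1, e2] at h3
    have h1 := (hP [] l u).seq (hQ x [] l u')
    have k1 : u 1 * u 0 ≤ u 1 * (u 0 * u 0 ^ l.length) := by
      rw [← mul_assoc]; exact Nat.le_mul_of_pos_right _ hpos
    have k2 : u 1 ≤ u 1 * u 0 := Nat.le_mul_of_pos_right _ (by omega)
    have k3 : (u 2 + 1) ≤ (u 2 + 1) * (u 0 * u 0 ^ l.length) :=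
      Nat.le_mul_of_pos_right _ (by positivity)
    have hn : tupleNorm u ≤ D := by
      simp only [tupleNorm, Fin.sum_univ_three]; omega
    have hn' : tupleNorm u' ≤ D := by
      have f0 : u' 0 = u 0 := by simp [hu']
      have f1 : u' 1 = u 1 * u 0 := by simp [hu']
      have f2 : u' 2 = u 2 := by simp [hu']
      simp only [tupleNorm, Fin.sum_univ_three, f0, f1, f2]; omega
    have hD2 : 2 ≤ D := (two_le_tupleNorm u).trans hn
    have b1 : cost u ≤ D ^ C := ((hc u).trans (Nat.pow_le_pow_left hn c)).trans
      (Nat.pow_le_pow_right (by omega) (by omega))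
    have b2 : cost' x u' ≤ D ^ C := ((hc' x u').trans (Nat.pow_le_pow_left hn' _)).trans
      (Nat.pow_le_pow_right (by omega) (hcC x))
    have b3 : 1 ≤ D ^ C := Nat.one_le_pow _ _ (by omega)
    have b4 : 4 * D ^ C ≤ D ^ (C + 2) := by
      have : 4 ≤ D ^ 2 := by nlinarith
      calc 4 * D ^ C = D ^ C * 4 := mul_comm _ _
        _ ≤ D ^ C * D ^ 2 := Nat.mul_le_mul_left _ this
        _ = D ^ (C + 2) := (pow_add D C 2).symm
    have h4 := Runs.loop_cons (k := 1) (P := fun x => seq P (Q x))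
      (s := regs [] (x :: l) (triple u)) rfl (by rw [update_regs_out]; exact h1) h3
    refine h4.cast rfl ?_ ?_
    · rw [List.length_cons, Nat.succ_mul]
      omega
    · rw [List.length_cons, List.foldl_cons, pow_succ', mul_assoc]

end StackProg

open StackProg in
/-- A function is computable in exponential time if the encoding of its values is written by
programs on unary registers that hold the encoding of its argument. -/
theorem Emits.computableInExpTime {α β : Type} {ea : α → List (Option Bool)}
    {eb : β → List (Option Bool)} {f : α → β} {G : (Fin 3 → ℕ) → List (Option Bool)}
    (hG : Emits G) (h : ∀ a, eb (f a) = G (readInput (ea a))) : ComputableInExpTime ea eb f := by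
  obtain ⟨P₁, c₁, h₁⟩ := exists_reverse_pass
  obtain ⟨P₂, c₂, h₂⟩ := exists_fold_pass
  obtain ⟨cost, ⟨c₃, hc₃⟩, h₃⟩ := hG
  obtain ⟨P₃, h₃⟩ := h₃ 3 (fun i => i) fun i => i.2
  obtain ⟨P₄, h₄⟩ := UnaryComp.clear_all 3 0
  -- Stack `r + 2` is the register `r`, so the pushes set the triple to `(2, 1, 0)`. Doubling the
  -- base once per letter gives `2 ^ (n + 1)`, and the second pass multiplies the `1` by this base
  -- `n` times. The final clearing leaves only the output, as the halting configuration demands.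
  set P : StackProg := seq (seq (seq (seq (seq (push 2 none) (push 2 none)) (push 3 none))
    (seq P₁ P₂)) P₃) P₄ with hP
  obtain ⟨K, hK⟩ : PolyBdd fun v : Fin 1 → ℕ => ((1 + 1 + 1) + 1 + 1 +
      ((v 0 * (v 0 ^ c₁ + 3) + 1) + (v 0 * (v 0 ^ c₂ + 1) + 1) + 1) + 1 + v 0 ^ c₃ + 1 +
      (1 + 8 * v 0) + 1) + 1 := by
    have h0 := PolyBdd.var (0 : Fin 1)
    have hk := fun n => PolyBdd.const (m := 1) n
    exact ((((((((((hk 1).add (hk 1)).add (hk 1)).add (hk 1)).add (hk 1)).add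
      ((((h0.mul ((h0.pow _).add (hk 3))).add (hk 1)).add
      ((h0.mul ((h0.pow _).add (hk 1))).add (hk 1))).add (hk 1))).add (hk 1)).add
      (h0.pow _)).add (hk 1)).add ((hk 1).add ((hk 8).mul h0))).add (hk 1) |>.add (hk 1)
  -- With `b = 2 ^ (n + 1)`, the triples met in both passes have norm at most `4 * b ^ n * b = 2 ^
  -- (n * n + 2 * n + 3)`; any larger quadratic exponent serves.
  set D : ℕ → ℕ := fun n => 2 ^ (n * n + 3 * n + 5) with hDdef
  have key : ∀ l, ∃ t, Exec P (ioStacks l []) t (ioStacks [] (G (readInput l))) ∧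
      t + 1 ≤ (2 + D l.length) ^ K := by
    intro l
    set n := l.length with hn
    have hb2 : 2 ≤ 2 ^ (n + 1) := by rw [pow_succ]; have := Nat.one_le_two_pow (n := n); omega
    have hD1 : 4 * ((2 ^ (n + 1)) ^ n * 2 ^ (n + 1)) ≤ D n := by
      rw [hDdef, ← pow_mul, ← pow_add, show (4 : ℕ) = 2 ^ 2 by norm_num, ← pow_add]
      exact Nat.pow_le_pow_right (by norm_num) (by nlinarith)
    have hB1 : 1 ≤ (2 ^ (n + 1)) ^ n := Nat.one_le_pow _ _ (by positivity)
    have hBB : 2 ^ (n + 1) ≤ (2 ^ (n + 1)) ^ n * 2 ^ (n + 1) := Nat.le_mul_of_pos_left _ hB1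
    have hBH : (2 ^ (n + 1)) ^ n * 2 ≤ (2 ^ (n + 1)) ^ n * 2 ^ (n + 1) :=
      Nat.mul_le_mul_left _ hb2
    have hbD : 2 + 2 ^ (n + 1) + 1 * (2 ^ (n + 1)) ^ n + (0 + 1) * (2 ^ (n + 1)) ^ n ≤ D n := by
      omega
    have hnD : n ≤ D n := by
      have : n < 2 ^ (n + 1) := (Nat.lt_succ_self n).trans Nat.lt_two_pow_self
      omega
    have e0 := ((runs_inc (inp := l) (out := []) (v := fun _ => 0) 0).seq (runs_inc 0)).seq
      (runs_inc 1)
    have e0' := e0.cast (w := fun _ => 0) (w' := triple ![2, 1, 0]) rfl le_rfl (by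
      funext r
      rcases r with _ | _ | _ | r <;> simp [triple])
    have f1 : Function.update (![2, 1, 0] : Fin 3 → ℕ) 0
        ((![2, 1, 0] : Fin 3 → ℕ) 0 * 2 ^ l.length) = ![2 ^ (n + 1), 1, 0] := by
      funext i
      fin_cases i <;> simp [hn, pow_succ']
    have e1 := h₁ l [] ![2, 1, 0] (D n) (by
      rw [f1]
      simp only [tupleNorm, Fin.sum_univ_three]
      simp
      omega)
    rw [f1, List.append_nil] at e1
    have e2 := h₂ l.reverse ![2 ^ (n + 1), 1, 0] (D n) (by simpa using hb2)
      (by simpa [← hn] using hbD)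
    have f2 : (![(![2 ^ (n + 1), 1, 0] : Fin 3 → ℕ) 0, (![2 ^ (n + 1), 1, 0] : Fin 3 → ℕ) 1 *
        (![2 ^ (n + 1), 1, 0] : Fin 3 → ℕ) 0 ^ l.reverse.length, l.reverse.foldl
        (fun t x => readLetter ((![2 ^ (n + 1), 1, 0] : Fin 3 → ℕ) 0) x t)
        ((![2 ^ (n + 1), 1, 0] : Fin 3 → ℕ) 2)] : Fin 3 → ℕ) = readInput l := by
      simp [readInput, ← hn]
    rw [f2] at e2
    have e3 := h₃ [] [] (triple (readInput l)) fun r hr => triple_of_le _ hr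
    rw [triple_comp, List.append_nil] at e3
    have hu0 : readInput l 0 = 2 ^ (n + 1) := rfl
    have hu1 : readInput l 1 = (2 ^ (n + 1)) ^ n := rfl
    have hu2 : readInput l 2 < (2 ^ (n + 1)) ^ n := foldr_readLetter_lt hb2 l
    have hnorm : tupleNorm (readInput l) ≤ D n := by
      simp only [tupleNorm, Fin.sum_univ_three, hu0, hu1]
      omega
    have e4 := h₄ [] (G (readInput l)) (triple (readInput l))
    have e5 := (((e0'.seq (e1.seq e2)).seq e3).seq e4).cast (w := fun _ => 0) rfl le_rfl
      (w' := fun _ => 0) (by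
        funext r
        by_cases hr : r < 3
        · simp [hr]
        · rw [if_neg (by omega)]
          exact triple_of_le _ (by omega))
    obtain ⟨t, ht, e⟩ := e5
    have g1 : regs l [] (fun _ => 0) = ioStacks l [] := by
      funext r
      rcases r with _ | _ | r <;> simp [regs, ioStacks]
    have g2 : regs [] (G (readInput l)) (fun _ => 0) = ioStacks [] (G (readInput l)) := by
      funext r
      rcases r with _ | _ | r <;> simp [regs, ioStacks]
    rw [g1, g2] at e
    refine ⟨t, e, ?_⟩
    have q3 : cost (readInput l) ≤ D n ^ c₃ := (hc₃ _).trans (Nat.pow_le_pow_left hnorm _)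
    have q1 : l.length * (D n ^ c₁ + 3) ≤ D n * (D n ^ c₁ + 3) := Nat.mul_le_mul_right _ hnD
    have q2 : l.reverse.length * (D n ^ c₂ + 1) ≤ D n * (D n ^ c₂ + 1) := by
      rw [List.length_reverse]; exact Nat.mul_le_mul_right _ hnD
    have q4 : ∑ j : Fin 3, (2 * triple (readInput l) (0 + j) + 2) ≤ 8 * D n := by
      rw [Fin.sum_univ_three]
      simp only [triple]
      simp only [tupleNorm, Fin.sum_univ_three] at hnorm
      simp
      omega
    have q5 := hK ![D n]
    simp only [tupleNorm, Fin.sum_univ_one, Matrix.cons_val_zero] at q5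
    omega
  refine ⟨{ tm := machine P (P.bound + 1), inputAlphabet := Equiv.refl _,
            outputAlphabet := Equiv.refl _, time := fun n => (2 + D n) ^ K,
            outputsFun := fun a => ?_ }, ?_⟩
  · refine Classical.choice ?_
    obtain ⟨t, ht, hT⟩ := key (ea a)
    have := outputsInTime ht hT
    rw [← h a] at this
    have cast : ∀ {M : Turing.FinTM2} {l l' : List (M.Γ M.k₀)} {o o' : List (M.Γ M.k₁)} {T : ℕ},
        l' = l → o' = o → Nonempty (Turing.TM2OutputsInTime M l (some o) T) →
        Nonempty (Turing.TM2OutputsInTime M l' (some o') T) := by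
      rintro M l _ o _ T rfl rfl h
      exact h
    exact cast (List.map_id _) (List.map_id _) this
  · refine ⟨Polynomial.C K * (Polynomial.X * Polynomial.X + Polynomial.C 3 * Polynomial.X +
      Polynomial.C 6), fun n => ?_⟩
    simp only [Polynomial.eval_mul, Polynomial.eval_add, Polynomial.eval_C, Polynomial.eval_X]
    rw [mul_comm, pow_mul]
    refine Nat.pow_le_pow_left ?_ K
    have h1 : 2 ≤ D n := by
      rw [hDdef]
      exact (by norm_num : 2 ≤ 2 ^ 1).trans (Nat.pow_le_pow_right (by norm_num) (by omega))
    calc 2 + D n ≤ 2 * D n := by omega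
      _ = 2 ^ (n * n + 3 * n + 6) := by rw [hDdef]; ring

end

noncomputable section

/-! ### Cylinders -/

section Cylinders

variable {X : Type*}

/-- The sequences that start with the list `l`. -/
def listCylinder (l : List X) : Set (ℕ → X) := {x | ∀ i, ∀ h : i < l.length, x i = l[i]}

/-- Put an element in front of a sequence. -/
def consSeq (a : X) (x : ℕ → X) : ℕ → X
  | 0 => a
  | n + 1 => x n

@[simp] theorem listCylinder_nil : listCylinder ([] : List X) = Set.univ := by
  simp [listCylinder]

theorem mem_listCylinder_cons {a : X} {l : List X} {x : ℕ → X} :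
    x ∈ listCylinder (a :: l) ↔ x 0 = a ∧ (fun i => x (i + 1)) ∈ listCylinder l := by
  constructor
  · intro h
    exact ⟨h 0 (by simp), fun i hi => h (i + 1) (by simpa using hi)⟩
  · rintro ⟨h0, h⟩ (_ | i) hi
    · exact h0
    · exact h i (by simpa using hi)

theorem consSeq_mem_listCylinder_cons {a b : X} {l : List X} {x : ℕ → X} :
    consSeq b x ∈ listCylinder (a :: l) ↔ b = a ∧ x ∈ listCylinder l :=
  mem_listCylinder_cons

theorem mem_listCylinder_append {a : X} {l : List X} {x : ℕ → X} :
    x ∈ listCylinder (l ++ [a]) ↔ x ∈ listCylinder l ∧ x l.length = a := by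
  induction l generalizing x with
  | nil => simp [mem_listCylinder_cons]
  | cons b l ih =>
    rw [List.cons_append, mem_listCylinder_cons, mem_listCylinder_cons, ih, List.length_cons,
      and_assoc]

theorem mem_listCylinder_ofFn {n : ℕ} {x y : ℕ → X} :
    x ∈ listCylinder (List.ofFn fun i : Fin n => y i) ↔ ∀ i < n, x i = y i := by
  simp [listCylinder]

variable [MeasurableSpace X]

theorem measurable_consSeq (a : X) : Measurable (consSeq a) := by
  refine measurable_pi_lambda _ fun i => ?_
  cases i with
  | zero => exact measurable_const
  | succ i => exact measurable_pi_apply i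

variable [MeasurableSingletonClass X]

theorem measurableSet_listCylinder (l : List X) : MeasurableSet (listCylinder l) := by
  have : listCylinder l = ⋂ i, ⋂ h : i < l.length, {x : ℕ → X | x i = l[i]} := by
    ext x; simp [listCylinder]
  rw [this]
  exact MeasurableSet.iInter fun i => MeasurableSet.iInter fun h =>
    (measurable_pi_apply i) (measurableSet_singleton _)

/-- Finite measures on sequences are determined by the cylinders. -/
theorem measure_ext_listCylinder [Countable X] {μ ν : Measure (ℕ → X)} [IsFiniteMeasure μ]
    (h : ∀ l, μ (listCylinder l) = ν (listCylinder l)) : μ = ν := by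
  refine ext_of_generate_finite (insert ∅ (Set.range listCylinder)) ?_ ?_ ?_
    (by simpa using h [])
  · refine le_antisymm ?_ (MeasurableSpace.generateFrom_le ?_)
    -- Cylinders generate: a condition on the coordinate `i` is a union of cylinders of lists longer
    -- than `i`, and there are only countably many lists.
    · refine iSup_le fun i => ?_
      rw [MeasurableSpace.comap_le_iff_le_map]
      intro s _
      have hs : (fun x : ℕ → X => x i) ⁻¹' s =
          ⋃ l : {l : List X // ∃ h : i < l.length, l[i] ∈ s}, listCylinder l.1 := by
        ext x
        simp only [Set.mem_preimage, Set.mem_iUnion]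
        constructor
        · intro hx
          refine ⟨⟨List.ofFn fun j : Fin (i + 1) => x j, by simp, ?_⟩, ?_⟩
          · rw [List.getElem_ofFn]; exact hx
          · exact mem_listCylinder_ofFn.2 fun _ _ => rfl
        · rintro ⟨⟨l, hl, hs⟩, hx⟩
          rw [hx i hl]
          exact hs
      show MeasurableSet[MeasurableSpace.generateFrom (insert ∅ (Set.range listCylinder))]
        ((fun x : ℕ → X => x i) ⁻¹' s)
      rw [hs]
      exact MeasurableSet.iUnion fun l => MeasurableSpace.measurableSet_generateFrom
        (Or.inr ⟨l.1, rfl⟩)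
    · rintro _ (rfl | ⟨l, rfl⟩)
      · exact MeasurableSet.empty
      · exact measurableSet_listCylinder l
  -- Two cylinders are nested or disjoint, hence they form a π-system.
  · have key : ∀ l l' : List X, (listCylinder l ∩ listCylinder l').Nonempty →
        l.length ≤ l'.length → listCylinder l ∩ listCylinder l' = listCylinder l' := by
      rintro l l' ⟨x, hx, hx'⟩ hl
      refine Set.inter_eq_right.2 fun y hy i hi => ?_
      rw [hy i (hi.trans_le hl), ← hx' i (hi.trans_le hl), hx i hi]
    rintro _ (rfl | ⟨l, rfl⟩) _ (rfl | ⟨l', rfl⟩) hne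
    · simp at hne
    · simp at hne
    · simp at hne
    · rcases le_total l.length l'.length with hl | hl
      · rw [key l l' hne hl]; exact Or.inr ⟨l', rfl⟩
      · rw [Set.inter_comm] at hne ⊢
        rw [key l' l hne hl]; exact Or.inr ⟨l, rfl⟩
  · rintro _ (rfl | ⟨l, rfl⟩)
    · simp
    · exact h l

end Cylinders

/-! ### Laws of runs -/

namespace MDP

variable {Q A : Type*}

/-- The strategy that continues `σ` from `q` after the first step, which plays `a`. -/
def tailStrategy (σ : Strategy Q A) (q : Q) (a : A) : Strategy Q A :=
  fun ρ => σ (q, (a, ρ.1) :: ρ.2)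

theorem next_cons (G : MDP Q A) (σ : Strategy Q A) (q : Q) (x : A × Q) (l : List (A × Q)) :
    G.next σ (q, x :: l) = G.next (tailStrategy σ q x.1) (x.2, l) := by
  have : FinRun.head (q, x :: l) = FinRun.head (x.2, l) := by
    simp only [FinRun.head]
    rw [List.getLast?_cons]
    cases l.getLast? <;> rfl
  rw [next, next, this]
  rfl

/-- The probability that a run starts with the given steps. -/
def listWeight (G : MDP Q A) : Strategy Q A → Q → List (A × Q) → ℝ≥0∞
  | _, _, [] => 1
  | σ, q, x :: l => G.next σ (q, []) x * listWeight G (tailStrategy σ q x.1) x.2 l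

/-- The weight is defined by peeling off the first step, while the Ionescu-Tulcea measure is built
by appending a last one; this identity connects the two recursions. -/
theorem listWeight_append (G : MDP Q A) (σ : Strategy Q A) (q : Q) (l : List (A × Q))
    (x : A × Q) : G.listWeight σ q (l ++ [x]) = G.listWeight σ q l * G.next σ (q, l) x := by
  induction l generalizing σ q with
  | nil => simp [listWeight]
  | cons y l ih => rw [List.cons_append, listWeight, ih, listWeight, next_cons, mul_assoc]

theorem isProbabilityMeasure_runMeasure [Countable Q] [Countable A]
    (G : MDP Q A) (σ : Strategy Q A) (q : Q) :
    @IsProbabilityMeasure _ (@MeasurableSpace.pi ℕ (fun _ => A × Q) fun _ => ⊤)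
      (G.runMeasure σ q) := by
  let _ : MeasurableSpace (A × Q) := ⊤
  unfold runMeasure
  infer_instance

/-- The coordinate at time zero of `Kernel.trajMeasure` has the initial law. -/
theorem runMeasure_cylinder_singleton [Countable Q] [Countable A]
    (G : MDP Q A) (σ : Strategy Q A) (q : Q) (x : A × Q) :
    G.runMeasure σ q (listCylinder [x]) = G.next σ (q, []) x := by
  let _ : MeasurableSpace (A × Q) := ⊤
  have h : (G.runMeasure σ q).map (Preorder.frestrictLe 0) =
      (G.next σ (q, [])).toMeasure.map
        (MeasurableEquiv.piUnique (fun _ : Finset.Iic 0 => A × Q)).symm := by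
    unfold runMeasure
    rw [Kernel.trajMeasure, Measure.map_comp _ _ (by fun_prop), Kernel.traj_map_frestrictLe,
      Kernel.partialTraj_self, Measure.id_comp]
  have h1 : listCylinder [x] = Preorder.frestrictLe (π := fun _ : ℕ => A × Q) 0 ⁻¹'
      ((fun y : Finset.Iic 0 → A × Q => y default) ⁻¹' {x}) := by
    ext y
    simp only [mem_listCylinder_cons, listCylinder_nil, Set.mem_univ, and_true]
    rfl
  rw [h1, ← Measure.map_apply (by fun_prop)
    ((measurable_pi_apply _) (measurableSet_singleton x)), h, Measure.map_apply (by fun_prop)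
    ((measurable_pi_apply _) (measurableSet_singleton x)), ← Set.preimage_comp]
  have h2 : (fun y : Finset.Iic 0 → A × Q => y default) ∘
      (MeasurableEquiv.piUnique (fun _ : Finset.Iic 0 => A × Q)).symm = id := by
    funext y
    rfl
  rw [h2, Set.preimage_id]
  exact PMF.toMeasure_apply_singleton _ _ (measurableSet_singleton x)

/-- The joint law of the first `n + 1` pairs and the next one is the composition product with
`nextKernel`; on a product of singletons this is a product of two masses. The kernels need a
nonempty history, hence the length `n + 1`. -/
theorem runMeasure_cylinder_append [Countable Q] [Countable A]
    (G : MDP Q A) (σ : Strategy Q A) (q : Q) (n : ℕ)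
    (l : List (A × Q)) (hl : l.length = n + 1) (x : A × Q) :
    G.runMeasure σ q (listCylinder (l ++ [x])) =
      G.runMeasure σ q (listCylinder l) * G.next σ (q, l) x := by
  let _ : MeasurableSpace (A × Q) := ⊤
  have := G.isProbabilityMeasure_runMeasure σ q
  have h : (G.runMeasure σ q).map (Preorder.frestrictLe n) ⊗ₘ G.nextKernel σ q n =
      (G.runMeasure σ q).map (fun y => (Preorder.frestrictLe n y, y (n + 1))) := by
    unfold runMeasure
    exact Kernel.map_frestrictLe_trajMeasure_compProd_eq_map_trajMeasure
  set hl' : Finset.Iic n → A × Q := fun i =>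
    l[i.1]'(by rw [hl]; exact Nat.lt_succ_of_le (Finset.mem_Iic.1 i.2)) with hdef
  have h1 : listCylinder l = Preorder.frestrictLe (π := fun _ : ℕ => A × Q) n ⁻¹' {hl'} := by
    ext y
    simp only [listCylinder, Set.mem_ofPred_eq, Set.mem_preimage, Set.mem_singleton_iff,
      funext_iff, hdef]
    constructor
    · intro hy i
      exact hy _ _
    · intro hy i hi
      exact hy ⟨i, Finset.mem_Iic.2 (by omega)⟩
  have h2 : listCylinder (l ++ [x]) = (fun y : ℕ → A × Q =>
      (Preorder.frestrictLe (π := fun _ : ℕ => A × Q) n y, y (n + 1))) ⁻¹' ({hl'} ×ˢ {x}) := by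
    ext y
    rw [mem_listCylinder_append, h1, hl]
    rfl
  have hm : MeasurableSet ({hl'} : Set (Finset.Iic n → A × Q)) := measurableSet_singleton _
  have hx : MeasurableSet ({x} : Set (A × Q)) := measurableSet_singleton _
  rw [h2, ← Measure.map_apply (by fun_prop) (hm.prod hx), ← h, Measure.compProd_apply_prod hm hx,
    Measure.restrict_singleton, lintegral_smul_measure, lintegral_dirac, h1,
    Measure.map_apply (by fun_prop) hm, smul_eq_mul]
  congr 1
  show (G.next σ (q, List.ofFn fun i : Fin (n + 1) => hl' ⟨i, _⟩)).toMeasure {x} = _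
  rw [PMF.toMeasure_apply_singleton _ _ hx]
  congr 3
  refine List.ext_getElem (by simp [hl]) fun i _ _ => ?_
  rw [List.getElem_ofFn]

theorem runMeasure_cylinder [Countable Q] [Countable A]
    (G : MDP Q A) (σ : Strategy Q A) (q : Q) (l : List (A × Q)) :
    G.runMeasure σ q (listCylinder l) = G.listWeight σ q l := by
  induction l using List.reverseRecOn with
  | nil =>
    have := G.isProbabilityMeasure_runMeasure σ q
    rw [listCylinder_nil, listWeight]
    exact this.measure_univ
  | append_singleton l x ih =>
    rcases l.length.eq_zero_or_pos with h | h
    · rw [List.length_eq_zero_iff.1 h, List.nil_append, runMeasure_cylinder_singleton]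
      simp [listWeight]
    · rw [runMeasure_cylinder_append G σ q (l.length - 1) l (by omega), ih, listWeight_append]

/-- Decomposition of the law of the run after its first step. -/
theorem runMeasure_apply [Countable Q] [Countable A]
    (G : MDP Q A) (σ : Strategy Q A) (q : Q) {S : Set (ℕ → A × Q)}
    (hS : MeasurableSet[@MeasurableSpace.pi ℕ (fun _ => A × Q) fun _ => ⊤] S) :
    G.runMeasure σ q S = ∑' x : A × Q, G.next σ (q, []) x *
      G.runMeasure (tailStrategy σ q x.1) x.2 (consSeq x ⁻¹' S) := by
  let _ : MeasurableSpace (A × Q) := ⊤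
  have := G.isProbabilityMeasure_runMeasure
  -- The mixture of the laws of the continuations, each preceded by its first step, has the masses
  -- `listWeight` on cylinders and therefore equals the law of the run.
  set ν : Measure (ℕ → A × Q) := Measure.sum fun x : A × Q => G.next σ (q, []) x •
    (G.runMeasure (tailStrategy σ q x.1) x.2).map (consSeq x) with hν
  have happ : ∀ {S : Set (ℕ → A × Q)}, MeasurableSet S → ν S = ∑' x : A × Q,
      G.next σ (q, []) x * G.runMeasure (tailStrategy σ q x.1) x.2 (consSeq x ⁻¹' S) := by
    intro S hS
    rw [hν, Measure.sum_apply _ hS]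
    refine tsum_congr fun x => ?_
    rw [Measure.smul_apply, Measure.map_apply (measurable_consSeq x) hS, smul_eq_mul]
  rw [← happ hS]
  have : G.runMeasure σ q = ν := by
    refine measure_ext_listCylinder fun l => ?_
    rw [happ (measurableSet_listCylinder l), runMeasure_cylinder]
    cases l with
    | nil =>
      have : ∀ x : A × Q, G.runMeasure (tailStrategy σ q x.1) x.2 Set.univ = 1 := fun x =>
        measure_univ
      simp [listWeight, this, PMF.tsum_coe]
    | cons y l =>
      rw [tsum_eq_single y, listWeight]
      · have : consSeq y ⁻¹' listCylinder (y :: l) = listCylinder l := by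
          ext x; simp [consSeq_mem_listCylinder_cons]
        rw [this, runMeasure_cylinder]
      · intro x hx
        have : consSeq x ⁻¹' listCylinder (y :: l) = ∅ := by
          ext z; simp [consSeq_mem_listCylinder_cons, hx]
        rw [this, measure_empty, mul_zero]
  rw [this]

end MDP

/-! ### Parity objectives and sequences of labels -/

/-- The parity objective on sequences of labels. -/
abbrev labelParity : Set (ℕ → ℕ) := parityObjective id

/-- Dropping the first position does not change which labels occur infinitely often. For this reason
the initial state of a run is irrelevant below, and the MEMDP may use an extra first step. -/
theorem mem_parityObjective_iff {Q : Type*} (f : Q → ℕ) (r : ℕ → Q) :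
    r ∈ parityObjective f ↔ (fun i => f (r (i + 1))) ∈ labelParity := by
  have : {n | ∀ i, ∃ j ≥ i, f (r j) = n} = {n | ∀ i, ∃ j ≥ i, f (r (j + 1)) = n} := by
    ext n
    constructor
    · intro h i
      obtain ⟨j, hj, e⟩ := h (i + 1)
      exact ⟨j - 1, by omega, by rwa [Nat.sub_add_cancel (by omega)]⟩
    · intro h i
      obtain ⟨j, hj, e⟩ := h i
      exact ⟨j + 1, by omega, e⟩
  simp only [parityObjective, Set.mem_ofPred_eq, this, id]

/-- The condition uses only quantifiers over natural numbers, applied to conditions on single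
coordinates. -/
theorem measurableSet_labelParity : MeasurableSet labelParity := by
  have h : ∀ i n : ℕ, Measurable fun r : ℕ → ℕ => r i = n := fun i n =>
    by
    have : MeasurableSet ((fun r : ℕ → ℕ => r i) ⁻¹' {n}) :=
      (measurable_pi_apply i) (measurableSet_singleton n)
    exact measurableSet_setOfPred.1 this
  have h' : ∀ n, Measurable fun r : ℕ → ℕ => ∀ i, ∃ j ≥ i, r j = n := fun n =>
    Measurable.forall fun i => Measurable.exists fun j => Measurable.and measurable_const (h j n)
  have : labelParity = {r : ℕ → ℕ | ∃ n, ((∀ i, ∃ j ≥ i, r j = n) ∧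
      ∀ m, (∀ i, ∃ j ≥ i, r j = m) → m ≤ n) ∧ Even n} := by
    ext r
    simp [labelParity, parityObjective, IsGreatest, upperBounds]
  rw [this]
  exact measurableSet_setOfPred.2 (Measurable.exists fun n => Measurable.and (Measurable.and (h' n)
    (Measurable.forall fun m => Measurable.imp (h' m) measurable_const)) measurable_const)

namespace MDP

variable {Q Q' A A' : Type*}

/-- The labels along a run, without the initial one. -/
def runLabels (f : Q → ℕ) (x : ℕ → A × Q) : ℕ → ℕ := fun i => f (x i).2

theorem measurable_runLabels (f : Q → ℕ) :
    Measurable[@MeasurableSpace.pi ℕ (fun _ => A × Q) fun _ => ⊤] (runLabels (A := A) f) := by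
  let _ : MeasurableSpace (A × Q) := ⊤
  exact measurable_pi_lambda _ fun i =>
    (measurable_from_top (f := fun y : A × Q => f y.2)).comp (measurable_pi_apply i)

theorem prob_parityObjective [Countable Q] [Countable A]
    (G : MDP Q A) (σ : Strategy Q A) (q : Q) (f : Q → ℕ) :
    G.prob σ q (parityObjective f) = G.runMeasure σ q (runLabels f ⁻¹' labelParity) := by
  have : {x : ℕ → A × Q | path q x ∈ parityObjective f} = runLabels f ⁻¹' labelParity := by
    ext x
    exact mem_parityObjective_iff f _
  rw [prob, this]

/-- The probability of a parity objective depends only on the law of the labels. -/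
theorem prob_parityObjective_congr [Countable Q] [Countable A] [Countable Q'] [Countable A']
    (G : MDP Q A) (σ : Strategy Q A) (q : Q) (f : Q → ℕ)
    (G' : MDP Q' A') (σ' : Strategy Q' A') (q' : Q') (f' : Q' → ℕ)
    (h : ∀ l, G.runMeasure σ q (runLabels f ⁻¹' listCylinder l) =
      G'.runMeasure σ' q' (runLabels f' ⁻¹' listCylinder l)) :
    G.prob σ q (parityObjective f) = G'.prob σ' q' (parityObjective f') := by
  let _ : MeasurableSpace (A × Q) := ⊤
  let _ : MeasurableSpace (A' × Q') := ⊤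
  have := G.isProbabilityMeasure_runMeasure σ q
  have e : (G.runMeasure σ q).map (runLabels f) = (G'.runMeasure σ' q').map (runLabels f') := by
    have : IsProbabilityMeasure ((G.runMeasure σ q).map (runLabels f)) :=
      Measure.isProbabilityMeasure_map (measurable_runLabels f).aemeasurable
    refine measure_ext_listCylinder fun l => ?_
    rw [Measure.map_apply (measurable_runLabels f) (measurableSet_listCylinder l),
      Measure.map_apply (measurable_runLabels f') (measurableSet_listCylinder l), h]
  rw [prob_parityObjective, prob_parityObjective,
    ← Measure.map_apply (measurable_runLabels f) measurableSet_labelParity, e,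
    Measure.map_apply (measurable_runLabels f') measurableSet_labelParity]

/-- Decomposition of the law of the labels after the first step. -/
theorem runMeasure_labels_cons [Countable Q] [Countable A]
    (G : MDP Q A) (σ : Strategy Q A) (q : Q) (f : Q → ℕ) (n : ℕ)
    (l : List ℕ) : G.runMeasure σ q (runLabels f ⁻¹' listCylinder (n :: l)) =
      ∑' x : A × Q, G.next σ (q, []) x * if f x.2 = n then
        G.runMeasure (tailStrategy σ q x.1) x.2 (runLabels f ⁻¹' listCylinder l) else 0 := by
  let _ : MeasurableSpace (A × Q) := ⊤
  rw [runMeasure_apply G σ q (measurable_runLabels f (measurableSet_listCylinder _))]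
  refine tsum_congr fun x => ?_
  congr 1
  have : ∀ y : ℕ → A × Q, consSeq x y ∈ runLabels f ⁻¹' listCylinder (n :: l) ↔
      f x.2 = n ∧ y ∈ runLabels f ⁻¹' listCylinder l := fun y => mem_listCylinder_cons
  split_ifs with h
  · congr 1
    ext y
    exact (this y).trans (and_iff_right h)
  · have e : consSeq x ⁻¹' (runLabels f ⁻¹' listCylinder (n :: l)) = ∅ := by
      ext y
      exact (this y).trans (by simp [h])
    rw [e, measure_empty]

/-- Decomposition of the probability of a parity objective after the first step. -/
theorem prob_parityObjective_eq_tsum [Countable Q] [Countable A]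
    (G : MDP Q A) (σ : Strategy Q A) (q : Q) (f : Q → ℕ) :
    G.prob σ q (parityObjective f) = ∑' x : A × Q, G.next σ (q, []) x *
      G.prob (tailStrategy σ q x.1) x.2 (parityObjective f) := by
  let _ : MeasurableSpace (A × Q) := ⊤
  rw [prob_parityObjective,
    runMeasure_apply G σ q (measurable_runLabels f measurableSet_labelParity)]
  refine tsum_congr fun x => ?_
  rw [prob_parityObjective]
  congr 2
  ext y
  exact mem_parityObjective_iff id (runLabels f (consSeq x y))

end MDP

end

noncomputable section

/-! ### Sums against distributions -/

theorem PMF.tsum_pure_mul {α : Type*} (a : α) (g : α → ℝ≥0∞) :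
    ∑' x, PMF.pure a x * g x = g a := by
  rw [tsum_eq_single a fun x hx => by simp [hx]]
  simp

theorem PMF.tsum_bind_mul {α β : Type*} (p : PMF α) (k : α → PMF β) (g : β → ℝ≥0∞) :
    ∑' y, p.bind k y * g y = ∑' x, p x * ∑' y, k x y * g y := by
  simp only [PMF.bind_apply, ← ENNReal.tsum_mul_right, ← ENNReal.tsum_mul_left]
  rw [ENNReal.tsum_comm]
  simp only [mul_assoc]

theorem PMF.tsum_map_mul {α β : Type*} (p : PMF α) (u : α → β) (g : β → ℝ≥0∞) :
    ∑' y, p.map u y * g y = ∑' x, p x * g (u x) := by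
  rw [PMF.map, PMF.tsum_bind_mul]
  simp only [Function.comp, PMF.tsum_pure_mul]

theorem MDP.tsum_next_mul {Q A : Type*} (G : MDP Q A) (σ : Strategy Q A) (ρ : FinRun Q A)
    (g : A × Q → ℝ≥0∞) : ∑' x, G.next σ ρ x * g x =
      ∑' a, σ ρ a * ∑' q, G.δ ρ.head a q * g (a, q) := by
  rw [next, PMF.tsum_bind_mul]
  simp only [PMF.tsum_map_mul]

/-! ### Tracking a POMDP in the states of an MEMDP -/

namespace POMDP

variable {Q A Ω S E : Type*}

/-- `q` is a possible start of the run with the given steps. -/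
def Feasible (Λ : POMDP Q A Ω) : Q → List (A × Q) → Prop
  | _, [] => True
  | q, x :: l => Λ.δ q x.1 x.2 ≠ 0 ∧ Feasible Λ x.2 l

/-- The run of states `s` updated by `upd` upon the given actions and observations. -/
def track (upd : S → A → Ω → S) : S → List (A × Ω) → List (A × S)
  | _, [] => []
  | s, x :: l => (x.1, upd s x.1 x.2) :: track upd (upd s x.1 x.2) l

/-- The MEMDP `Γ` tracks the possible current states of `Λ` in its states `s`: for every initial
state `i`, `cur s i` is the current state of `Λ`, if `i` is still possible. The labels and
the observations can be read off from `s`. -/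
structure Tracking (Λ : POMDP Q A Ω) (Γ : MEMDP S A E) (ε : E ≃ Q) (f : Q → ℕ) (f' : S → ℕ) where
  cur : S → Q → Option Q
  upd : S → A → Ω → S
  start : Ω → S
  init : S
  obs : S → Ω
  δ_init : ∀ e a, Γ.δ e init a = PMF.pure (start (Λ.obs (ε e)))
  δ_some : ∀ e s a q, cur s (ε e) = some q →
    Γ.δ e s a = (Λ.δ q a).map fun q' => upd s a (Λ.obs q')
  cur_start : ∀ q, cur (start (Λ.obs q)) q = some q
  obs_start : ∀ q, obs (start (Λ.obs q)) = Λ.obs q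
  cur_upd : ∀ s a q q' i, cur s i = some q → Λ.δ q a q' ≠ 0 →
    cur (upd s a (Λ.obs q')) i = some q'
  obs_upd : ∀ s a q q' i, cur s i = some q → Λ.δ q a q' ≠ 0 →
    obs (upd s a (Λ.obs q')) = Λ.obs q'
  label_upd : ∀ s a q q' i, cur s i = some q → Λ.δ q a q' ≠ 0 →
    f' (upd s a (Λ.obs q')) = f q'

/-! ### Carrying strategies between the POMDP and a tracking MEMDP -/

namespace Tracking

variable {Λ : POMDP Q A Ω} {Γ : MEMDP S A E} {ε : E ≃ Q} {f : Q → ℕ} {f' : S → ℕ}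

/-- Tracking loses no observations along runs that are possible from `q`. This is what allows a
strategy for the POMDP to be played in the MEMDP. -/
theorem mapStates_track (T : Tracking Λ Γ ε f f') (i : Q) (r : List (A × Q)) :
    ∀ s q, T.cur s i = some q → Λ.Feasible q r →
    (track T.upd s (r.map fun x => (x.1, Λ.obs x.2))).map (fun x => (x.1, T.obs x.2)) =
      r.map fun x => (x.1, Λ.obs x.2) := by
  induction r with
  | nil => intros; rfl
  | cons x r ih =>
    intro s q hs hr
    simp only [List.map_cons, track]
    rw [T.obs_upd s _ _ _ _ hs hr.1, ih _ _ (T.cur_upd s _ _ _ _ hs hr.1) hr.2]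

/-- In a fixed environment the target of the first step is the same for all actions. The only
randomness is the action, which the strategy may remember. -/
theorem prob_init [Countable A] [Countable S] (T : Tracking Λ Γ ε f f') (e : E)
    (σ : Strategy S A) :
    (Γ.env e).prob σ T.init (parityObjective f') = ∑' a, σ (T.init, []) a *
      (Γ.env e).prob (MDP.tailStrategy σ T.init a) (T.start (Λ.obs (ε e)))
        (parityObjective f') := by
  rw [MDP.prob_parityObjective_eq_tsum, MDP.tsum_next_mul]
  refine tsum_congr fun a => ?_
  have h1 : (Γ.env e).δ (FinRun.head (T.init, ([] : List (A × S)))) a =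
      PMF.pure (T.start (Λ.obs (ε e))) :=
    T.δ_init e a
  rw [h1, PMF.tsum_pure_mul]

variable [Countable Q] [Countable A] [Countable S]

/-- One step of the MEMDP in environment `e` is the image of one step of the POMDP from the tracked
state, with the same label; induction on the labels gives equal laws. The strategies need to agree
only on feasible runs, because transitions of probability zero contribute nothing to either sum. -/
theorem runMeasure_labels (T : Tracking Λ Γ ε f f') (e : E) (l : List ℕ) :
    ∀ (s : S) (q : Q) (σ : Strategy S A) (τ : Strategy Q A), T.cur s (ε e) = some q →
    (∀ r, Λ.Feasible q r →
      σ (s, track T.upd s (r.map fun x => (x.1, Λ.obs x.2))) = τ (q, r)) →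
    (Γ.env e).runMeasure σ s (MDP.runLabels f' ⁻¹' listCylinder l) =
      Λ.toMDP.runMeasure τ q (MDP.runLabels f ⁻¹' listCylinder l) := by
  induction l with
  | nil =>
    intro s q σ τ _ _
    simp only [listCylinder_nil, Set.preimage_univ]
    rw [((Γ.env e).isProbabilityMeasure_runMeasure σ s).measure_univ,
      (Λ.toMDP.isProbabilityMeasure_runMeasure τ q).measure_univ]
  | cons n l ih =>
    intro s q σ τ hs hστ
    rw [MDP.runMeasure_labels_cons, MDP.runMeasure_labels_cons, MDP.tsum_next_mul,
      MDP.tsum_next_mul]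
    have h0 : σ (s, []) = τ (q, []) := hστ [] trivial
    rw [h0]
    refine tsum_congr fun a => ?_
    congr 1
    have h1 : (Γ.env e).δ (FinRun.head (s, ([] : List (A × S)))) a =
        (Λ.δ q a).map fun q' => T.upd s a (Λ.obs q') := T.δ_some e s a q hs
    rw [h1, PMF.tsum_map_mul]
    refine tsum_congr fun q' => ?_
    rcases eq_or_ne (Λ.δ q a q') 0 with h | h
    · show Λ.δ q a q' * _ = Λ.δ q a q' * _
      rw [h, zero_mul, zero_mul]
    · show Λ.δ q a q' * _ = Λ.δ q a q' * _
      congr 1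
      dsimp only
      rw [T.label_upd s a q q' _ hs h]
      split_ifs
      · exact ih _ _ _ _ (T.cur_upd s a q q' _ hs h) fun r hr => hστ ((a, q') :: r) ⟨h, hr⟩
      · rfl

theorem prob_start (T : Tracking Λ Γ ε f f') (e : E) (σ : Strategy S A) (τ : Strategy Q A)
    (h : ∀ r, Λ.Feasible (ε e) r → σ (T.start (Λ.obs (ε e)), track T.upd (T.start (Λ.obs (ε e)))
      (r.map fun x => (x.1, Λ.obs x.2))) = τ (ε e, r)) :
    (Γ.env e).prob σ (T.start (Λ.obs (ε e))) (parityObjective f') =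
      Λ.toMDP.prob τ (ε e) (parityObjective f) :=
  MDP.prob_parityObjective_congr _ _ _ _ _ _ _ _ fun l =>
    T.runMeasure_labels e l _ _ _ _ (T.cur_start _) h

/-- A POMDP strategy is imitated after an arbitrary first action. Conversely, for each first action
`a`, the rest of an MEMDP strategy is a POMDP strategy `κ a`, because its tuples are computable from
the observations. The value of the MEMDP strategy is then the average of the values of the `κ a`,
hence at most their supremum. -/
theorem value_eq (T : Tracking Λ Γ ε f f') (b : PMF Q) :
    Λ.value b (parityObjective f) =
      Γ.priorValue (b.map ε.symm) T.init (parityObjective f') := by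
  apply le_antisymm
  · refine iSup_le fun κ => ?_
    obtain ⟨q₀, -⟩ := b.support_nonempty
    -- The choice made on the empty history is immaterial; an observation `Λ.obs q₀` only serves to
    -- name some distribution on actions.
    let σ : Strategy S A := fun ρ => match ρ with
      | (_, []) => κ (Λ.obs q₀, [])
      | (_, x :: l) => κ (FinRun.mapStates T.obs (x.2, l))
    refine le_trans (le_of_eq ?_) (le_iSup _ σ)
    rw [PMF.tsum_map_mul]
    refine tsum_congr fun q => ?_
    congr 1
    rw [T.prob_init]
    have : ∀ a, (Γ.env (ε.symm q)).prob (MDP.tailStrategy σ T.init a)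
        (T.start (Λ.obs (ε (ε.symm q)))) (parityObjective f') =
        Λ.toMDP.prob (fun ρ => κ (ρ.mapStates Λ.obs)) q (parityObjective f) := by
      intro a
      rw [T.prob_start (ε.symm q) _ fun ρ => κ (ρ.mapStates Λ.obs)]
      · rw [ε.apply_symm_apply]
      · intro r hr
        show κ (FinRun.mapStates _ _) = κ (FinRun.mapStates _ _)
        congr 1
        simp only [FinRun.mapStates]
        rw [T.obs_start, T.mapStates_track _ _ _ _ (T.cur_start _) hr]
    simp only [this]
    rw [ENNReal.tsum_mul_right, PMF.tsum_coe, one_mul]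
  · refine iSup_le fun σ => ?_
    rw [PMF.tsum_map_mul]
    let κ : A → Strategy Ω A := fun a ρ =>
      σ (T.init, (a, T.start ρ.1) :: track T.upd (T.start ρ.1) ρ.2)
    have h1 : ∀ q, (Γ.env (ε.symm q)).prob σ T.init (parityObjective f') =
        ∑' a, σ (T.init, []) a *
          Λ.toMDP.prob (fun ρ => κ a (ρ.mapStates Λ.obs)) q (parityObjective f) := by
      intro q
      rw [T.prob_init]
      refine tsum_congr fun a => ?_
      rw [T.prob_start (ε.symm q) _ fun ρ => κ a (ρ.mapStates Λ.obs)]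
      · rw [ε.apply_symm_apply]
      · intro r _
        rfl
    simp only [h1, ← ENNReal.tsum_mul_left]
    rw [ENNReal.tsum_comm]
    calc ∑' a, ∑' q, b q * (σ (T.init, []) a *
          Λ.toMDP.prob (fun ρ => κ a (ρ.mapStates Λ.obs)) q (parityObjective f))
        = ∑' a, σ (T.init, []) a * ∑' q, b q *
          Λ.toMDP.prob (fun ρ => κ a (ρ.mapStates Λ.obs)) q (parityObjective f) := by
          refine tsum_congr fun a => ?_
          rw [← ENNReal.tsum_mul_left]
          exact tsum_congr fun q => mul_left_comm _ _ _
      _ ≤ ∑' a, σ (T.init, []) a * Λ.value b (parityObjective f) :=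
          ENNReal.tsum_le_tsum fun a => mul_le_mul_right (le_iSup
            (fun κ : Strategy Ω A => ∑' q, b q *
              Λ.toMDP.prob (fun ρ => κ (ρ.mapStates Λ.obs)) q (parityObjective f)) (κ a)) _
      _ = Λ.value b (parityObjective f) := by
          rw [ENNReal.tsum_mul_right, PMF.tsum_coe, one_mul]

end Tracking

/-! ### The subset construction of a Dirac-preserving POMDP -/

/-- Both states lie in the support of the updated belief for their common observation, which is a
singleton. This is the form in which Dirac preservation is used. -/
theorem DiracPreserving.eq_of_obs_eq {Λ : POMDP Q A Ω} (h : Λ.DiracPreserving) {q q₁ q₂ : Q}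
    {a : A} (h₁ : Λ.δ q a q₁ ≠ 0) (h₂ : Λ.δ q a q₂ ≠ 0) (ho : Λ.obs q₁ = Λ.obs q₂) :
    q₁ = q₂ := by
  classical
  have hs : ∀ x, ∑' q', PMF.pure q q' * Λ.δ q' a x = Λ.δ q a x := fun x =>
    PMF.tsum_pure_mul q fun q' => Λ.δ q' a x
  have hl : Λ.likelihood (PMF.pure q) a (Λ.obs q₂) =
      ∑' x : {x // Λ.obs x = Λ.obs q₂}, Λ.δ q a x := by
    simp only [likelihood, hs]
  have hpos : Λ.obs q₂ ∈ Λ.Comp (PMF.pure q) a := by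
    show 0 < Λ.likelihood _ _ _
    rw [hl]
    exact lt_of_lt_of_le (pos_iff_ne_zero.2 h₂)
      (ENNReal.le_tsum (f := fun x : {x // Λ.obs x = Λ.obs q₂} => Λ.δ q a x) ⟨q₂, rfl⟩)
  -- Dividing by an infinite likelihood would give zero and empty the support.
  have htop : Λ.likelihood (PMF.pure q) a (Λ.obs q₂) ≠ ⊤ := by
    rw [hl]
    refine ne_top_of_le_ne_top ENNReal.one_ne_top ?_
    rw [← (Λ.δ q a).tsum_coe]
    exact ENNReal.tsum_comp_le_tsum_of_injective Subtype.val_injective _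
  obtain ⟨x, hx⟩ := Set.encard_eq_one.1 (h q a _ hpos)
  have hmem : ∀ y, Λ.δ q a y ≠ 0 → Λ.obs y = Λ.obs q₂ → y = x := by
    intro y hy hyo
    have : y ∈ Function.support (Λ.updatedBelief (PMF.pure q) a (Λ.obs q₂)) := by
      rw [Function.mem_support, updatedBelief, if_pos hyo, hs]
      exact (ENNReal.div_pos hy htop).ne'
    rw [hx] at this
    exact this
  rw [hmem _ h₁ ho, hmem _ h₂ rfl]

open Classical in
/-- The successor of `q` under `a` with the observation `o`, if there is one. -/
def succ (Λ : POMDP Q A Ω) (q : Q) (a : A) (o : Ω) : Option Q :=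
  if h : ∃ q', Λ.obs q' = o ∧ Λ.δ q a q' ≠ 0 then some h.choose else none

theorem DiracPreserving.succ_eq_some {Λ : POMDP Q A Ω} (h : Λ.DiracPreserving) {q q' : Q} {a : A}
    {o : Ω} : Λ.succ q a o = some q' ↔ Λ.obs q' = o ∧ Λ.δ q a q' ≠ 0 := by
  unfold succ
  split_ifs with hq
  · rw [Option.some.injEq]
    constructor
    · rintro rfl
      exact hq.choose_spec
    · rintro ⟨h1, h2⟩
      exact h.eq_of_obs_eq hq.choose_spec.2 h2 (hq.choose_spec.1.trans h1.symm)
  · exact ⟨nofun, fun h' => (hq ⟨q', h'⟩).elim⟩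

open Classical in
/-- The tuple of the possible current states after the initial observation `o`. -/
def startTuple (Λ : POMDP Q A Ω) (o : Ω) : Q → Option Q :=
  fun i => if Λ.obs i = o then some i else none

/-- The tuple of the possible current states after the action `a` and the observation `o`. -/
def updTuple (Λ : POMDP Q A Ω) (g : Q → Option Q) (a : A) (o : Ω) : Q → Option Q :=
  fun i => (g i).bind fun q => Λ.succ q a o

/-- The MEMDP whose states stand for tuples of possible current states, one for each initial
state. -/
def subsetMEMDP (Λ : POMDP Q A Ω) (ε : E ≃ Q) (dec : S ≃ (Q → Option Q)) : MEMDP S A E where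
  -- The `none` case serves two purposes: it is the revealing first step from the all-`none` tuple,
  -- and a default at tuples that exclude `e`.
  δ e s a := (dec s (ε e)).elim (PMF.pure (dec.symm (Λ.startTuple (Λ.obs (ε e)))))
    fun q => (Λ.δ q a).map fun q' => dec.symm (Λ.updTuple (dec s) a (Λ.obs q'))

theorem obs_eq_of_startTuple {Λ : POMDP Q A Ω} {o : Ω} {i q : Q}
    (h : Λ.startTuple o i = some q) : Λ.obs q = o := by
  unfold startTuple at h
  split_ifs at h with h'
  rw [← Option.some.inj h, h']

theorem startTuple_self (Λ : POMDP Q A Ω) (q : Q) : Λ.startTuple (Λ.obs q) q = some q :=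
  if_pos rfl

theorem DiracPreserving.obs_eq_of_updTuple {Λ : POMDP Q A Ω} (hΛ : Λ.DiracPreserving)
    {g : Q → Option Q} {a : A} {o : Ω} {i q : Q} (h : Λ.updTuple g a o i = some q) :
    Λ.obs q = o := by
  obtain ⟨x, -, hx⟩ := Option.bind_eq_some_iff.1 h
  exact (hΛ.succ_eq_some.1 hx).1

theorem DiracPreserving.updTuple_eq_some {Λ : POMDP Q A Ω} (hΛ : Λ.DiracPreserving)
    {g : Q → Option Q} {a : A} {q q' i : Q} (h : g i = some q) (h' : Λ.δ q a q' ≠ 0) :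
    Λ.updTuple g a (Λ.obs q') i = some q' := by
  rw [updTuple, h]
  exact hΛ.succ_eq_some.2 ⟨rfl, h'⟩

/-- What depends only on the observation can be read off from a tuple whose states have the same
observation. -/
theorem apply_symm_tuple {β : Type*} {Λ : POMDP Q A Ω} {dec : S ≃ (Q → Option Q)} {F : S → β}
    {G : Q → β} (hF : ∀ s i q, dec s i = some q → ∃ i' q', dec s i' = some q' ∧ F s = G q')
    (hG : ∀ q q', Λ.obs q = Λ.obs q' → G q = G q') {g : Q → Option Q} {o : Ω} {q i : Q}
    (hg : ∀ i q, g i = some q → Λ.obs q = o) (hi : g i = some q) : F (dec.symm g) = G q := by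
  obtain ⟨i', q', h', e⟩ := hF (dec.symm g) i q (by rw [dec.apply_symm_apply, hi])
  rw [dec.apply_symm_apply] at h'
  rw [e]
  exact hG _ _ ((hg _ _ h').trans (hg _ _ hi).symm)

open Classical in
/-- The value of `G` at a state of the tuple `s`, if there is one. -/
def readTuple {β : Type*} (dec : S ≃ (Q → Option Q)) (G : Q → β) (d : β) (s : S) : β :=
  if h : ∃ q i, dec s i = some q then G h.choose else d

theorem readTuple_spec {β : Type*} (dec : S ≃ (Q → Option Q)) (G : Q → β) (d : β) (s : S) (i q : Q)
    (h : dec s i = some q) : ∃ i' q', dec s i' = some q' ∧ readTuple dec G d s = G q' := by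
  have h' : ∃ q i, dec s i = some q := ⟨q, i, h⟩
  exact ⟨h'.choose_spec.choose, h'.choose, h'.choose_spec.choose_spec, dif_pos h'⟩

/-- The subset construction tracks the POMDP. -/
def subsetTracking (Λ : POMDP Q A Ω) (ε : E ≃ Q) (dec : S ≃ (Q → Option Q)) (o : Ω)
    (hΛ : Λ.DiracPreserving) {f : Q → ℕ} (hf : Λ.ObsCompatible f) {f' : S → ℕ}
    (hf' : ∀ s i q, dec s i = some q → ∃ i' q', dec s i' = some q' ∧ f' s = f q') :
    Tracking Λ (Λ.subsetMEMDP ε dec) ε f f' where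
  cur s := dec s
  upd s a o := dec.symm (Λ.updTuple (dec s) a o)
  start o := dec.symm (Λ.startTuple o)
  init := dec.symm fun _ => none
  obs := readTuple dec Λ.obs o
  δ_init e a := by simp [subsetMEMDP]
  δ_some e s a q h := by simp [subsetMEMDP, h]
  cur_start q := by rw [dec.apply_symm_apply]; exact Λ.startTuple_self q
  obs_start q := apply_symm_tuple (readTuple_spec dec Λ.obs o) (fun _ _ h => h)
    (fun _ _ => obs_eq_of_startTuple) (Λ.startTuple_self q)
  cur_upd s a q q' i h h' := by rw [dec.apply_symm_apply]; exact hΛ.updTuple_eq_some h h'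
  obs_upd s a q q' i h h' := apply_symm_tuple (readTuple_spec dec Λ.obs o) (fun _ _ h => h)
    (fun _ _ => hΛ.obs_eq_of_updTuple) (hΛ.updTuple_eq_some h h')
  label_upd s a q q' i h h' := apply_symm_tuple hf' (fun q q' h => hf q q' h)
    (fun _ _ => hΛ.obs_eq_of_updTuple) (hΛ.updTuple_eq_some h h')

theorem value_eq_priorValue_subsetMEMDP [Countable Q] [Countable A] [Countable S]
    (Λ : POMDP Q A Ω) (ε : E ≃ Q) (dec : S ≃ (Q → Option Q))
    (hΛ : Λ.DiracPreserving) {f : Q → ℕ} (hf : Λ.ObsCompatible f) {f' : S → ℕ}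
    (hf' : ∀ s i q, dec s i = some q → ∃ i' q', dec s i' = some q' ∧ f' s = f q') (b : PMF Q) :
    Λ.value b (parityObjective f) = (Λ.subsetMEMDP ε dec).priorValue (b.map ε.symm)
      (dec.symm fun _ => none) (parityObjective f') := by
  -- A state is needed only to supply a default observation for the all-`none` tuple.
  obtain ⟨q, -⟩ := b.support_nonempty
  exact (subsetTracking Λ ε dec (Λ.obs q) hΛ hf hf').value_eq b

theorem exists_subsetMEMDP_value_eq [Finite Q] [Finite A]
    (Λ : POMDP Q A Ω) (f : Q → ℕ) (b : PMF Q) (hΛ : Λ.DiracPreserving)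
    (hf : Λ.ObsCompatible f) :
    ∃ (N K : ℕ) (Γ : MEMDP (Fin N) A (Fin K)) (f' : Fin N → ℕ) (b' : PMF (Fin K)) (q' : Fin N),
      N ≤ 2 ^ (Nat.card Q) ^ 2 ∧ K ≤ 2 ^ (Nat.card Q) ^ 2 ∧
      Λ.value b (parityObjective f) = Γ.priorValue b' q' (parityObjective f') := by
  classical
  have := Fintype.ofFinite Q
  set n := Nat.card Q with hn
  let ε : Fin n ≃ Q := (Finite.equivFin Q).symm
  have hcard : Nat.card (Q → Option Q) = (n + 1) ^ n := by
    rw [Nat.card_fun, Finite.card_option]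
  let dec : Fin ((n + 1) ^ n) ≃ (Q → Option Q) := (Finite.equivFinOfCardEq hcard).symm
  refine ⟨(n + 1) ^ n, n, Λ.subsetMEMDP ε dec, readTuple dec f 0, b.map ε.symm,
    dec.symm fun _ => none, ?_, ?_,
    value_eq_priorValue_subsetMEMDP Λ ε dec hΛ hf (readTuple_spec dec f 0) b⟩
  -- `n + 1 ≤ 2 ^ n`, so `(n + 1) ^ n ≤ 2 ^ (n ^ 2)`.
  · rw [sq, pow_mul]
    exact Nat.pow_le_pow_left (Nat.succ_le_of_lt Nat.lt_two_pow_self) n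
  · exact Nat.lt_two_pow_self.le.trans (Nat.pow_le_pow_right (by norm_num)
      (Nat.le_self_pow two_ne_zero n))

end POMDP

end

noncomputable section

/-! ### Tuples of possible current states as numbers -/

/-- The `i`-th digit of `s` in base `n + 1`. -/
def tupleDigit (n s i : ℕ) : ℕ := s / (n + 1) ^ i % (n + 1)

theorem tupleDigit_pred_lt {n s i : ℕ} (h : tupleDigit n s i ≠ 0) : tupleDigit n s i - 1 < n := by
  have : tupleDigit n s i < n + 1 := Nat.mod_lt _ n.succ_pos
  omega

/-- The digits of a number in base `n + 1`, where `0` stands for `none`. -/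
def tupleEquiv (n : ℕ) : Fin ((n + 1) ^ n) ≃ (Fin n → Option (Fin n)) :=
  finFunctionFinEquiv.symm.trans (Equiv.arrowCongr (Equiv.refl _) (finSuccEquiv n))

theorem tupleEquiv_apply {n : ℕ} (s : Fin ((n + 1) ^ n)) (i : Fin n) :
    tupleEquiv n s i = finSuccEquiv n ⟨tupleDigit n s i, Nat.mod_lt _ n.succ_pos⟩ := rfl

theorem tupleEquiv_eq_none {n : ℕ} {s : Fin ((n + 1) ^ n)} {i : Fin n} :
    tupleEquiv n s i = none ↔ tupleDigit n s i = 0 := by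
  rw [tupleEquiv_apply, ← finSuccEquiv_zero, (finSuccEquiv n).apply_eq_iff_eq, Fin.ext_iff]
  rfl

theorem tupleEquiv_eq_some {n : ℕ} {s : Fin ((n + 1) ^ n)} {i q : Fin n} :
    tupleEquiv n s i = some q ↔ tupleDigit n s i = q + 1 := by
  rw [tupleEquiv_apply, ← finSuccEquiv_succ, (finSuccEquiv n).apply_eq_iff_eq, Fin.ext_iff]
  rfl

/-- `s` is the tuple of the possible current states after the initial observation `o`. -/
def IsStart (n : ℕ) (O : ℕ → ℕ) (o s : ℕ) : Prop :=
  ∀ i < n, (O i = o → tupleDigit n s i = i + 1) ∧ (O i ≠ o → tupleDigit n s i = 0)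

/-- `s'` is the tuple of the possible current states after the tuple `s`, the action `a` and the
observation `o`, where `d` vanishes on the impossible transitions. -/
def IsUpd (n : ℕ) (O : ℕ → ℕ) (d : ℕ → ℕ → ℕ → ℕ) (a s o s' : ℕ) : Prop :=
  ∀ i < n, (tupleDigit n s i = 0 → tupleDigit n s' i = 0) ∧ (tupleDigit n s i ≠ 0 →
    (tupleDigit n s' i = 0 → ∀ q < n, O q = o → d (tupleDigit n s i - 1) a q = 0) ∧
    (tupleDigit n s' i ≠ 0 → O (tupleDigit n s' i - 1) = o ∧
      d (tupleDigit n s i - 1) a (tupleDigit n s' i - 1) ≠ 0))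

open Classical in
/-- The weight of the transition from the tuple `s` to the tuple `s'` under the action `a` for the
initial state `e`, given the weights `D` of the POMDP. -/
def tupleWeight {β : Type*} (n : ℕ) (O : ℕ → ℕ) (d : ℕ → ℕ → ℕ → ℕ) (D : ℕ → ℕ → ℕ → β)
    (zero one : β) (e s a s' : ℕ) : β :=
  if tupleDigit n s e = 0 then if IsStart n O (O e) s' then one else zero
  else if tupleDigit n s' e = 0 then zero
  else if IsUpd n O d a s (O (tupleDigit n s' e - 1)) s' then
    D (tupleDigit n s e - 1) a (tupleDigit n s' e - 1)
  else zero

/-- The case distinction does not depend on the weights. The rational weights, their numerators,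
their denominators and their values in `ℝ≥0∞` are therefore all given by the same formula. -/
theorem apply_tupleWeight {β γ : Type*} (F : β → γ) (n : ℕ) (O : ℕ → ℕ) (d : ℕ → ℕ → ℕ → ℕ)
    (D : ℕ → ℕ → ℕ → β) (zero one : β) (e s a s' : ℕ) :
    F (tupleWeight n O d D zero one e s a s') =
      tupleWeight n O d (fun q a q' => F (D q a q')) (F zero) (F one) e s a s' := by
  unfold tupleWeight
  split_ifs <;> rfl

theorem IsStart.congr {n : ℕ} {O O' : ℕ → ℕ} {o s : ℕ} (hO : ∀ q < n, O q = O' q)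
    (h : IsStart n O o s) : IsStart n O' o s :=
  fun i hi => hO i hi ▸ h i hi

theorem IsUpd.congr {n : ℕ} {O O' : ℕ → ℕ} {d d' : ℕ → ℕ → ℕ → ℕ} {a s o s' : ℕ}
    (hO : ∀ q < n, O q = O' q) (hd : ∀ q < n, ∀ q' < n, d q a q' = d' q a q')
    (h : IsUpd n O d a s o s') : IsUpd n O' d' a s o s' := by
  refine fun i hi => ⟨(h i hi).1, fun hs => ⟨fun hs' q hq ho => ?_, fun hs' => ?_⟩⟩
  · rw [← hd _ (tupleDigit_pred_lt hs) q hq]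
    exact ((h i hi).2 hs).1 hs' q hq ((hO q hq).trans ho)
  · rw [← hO _ (tupleDigit_pred_lt hs'), ← hd _ (tupleDigit_pred_lt hs) _ (tupleDigit_pred_lt hs')]
    exact ((h i hi).2 hs).2 hs'

open Classical in
theorem tupleWeight_congr {β : Type*} {n : ℕ} {O O' : ℕ → ℕ} {d d' : ℕ → ℕ → ℕ → ℕ}
    {D D' : ℕ → ℕ → ℕ → β} {zero one : β} {e s a s' : ℕ} (he : e < n)
    (hO : ∀ q < n, O q = O' q) (hd : ∀ q < n, ∀ q' < n, d q a q' = d' q a q')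
    (hD : ∀ q < n, ∀ q' < n, D q a q' = D' q a q') :
    tupleWeight n O d D zero one e s a s' = tupleWeight n O' d' D' zero one e s a s' := by
  have h1 : IsStart n O (O e) s' ↔ IsStart n O' (O' e) s' := by
    rw [hO e he]
    exact ⟨.congr hO, .congr fun q hq => (hO q hq).symm⟩
  unfold tupleWeight
  by_cases h2 : tupleDigit n s e = 0
  · rw [if_pos h2, if_pos h2]
    exact if_congr h1 rfl rfl
  · rw [if_neg h2, if_neg h2]
    by_cases h3 : tupleDigit n s' e = 0
    · rw [if_pos h3, if_pos h3]
    · rw [if_neg h3, if_neg h3, hO _ (tupleDigit_pred_lt h3),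
        hD _ (tupleDigit_pred_lt h2) _ (tupleDigit_pred_lt h3)]
      exact if_congr ⟨.congr hO hd, .congr (fun q hq => (hO q hq).symm)
        fun q hq q' hq' => (hd q hq q' hq').symm⟩ rfl rfl

/-- The label of the last state of the tuple `s`. -/
def tupleLabel (n : ℕ) (l : ℕ → ℕ) (s j : ℕ) : ℕ :=
  Nat.rec 0 (fun i acc => if tupleDigit n s i = 0 then acc else l (tupleDigit n s i - 1)) j

theorem tupleLabel_congr {n : ℕ} {l l' : ℕ → ℕ} (h : ∀ q < n, l q = l' q) (s j : ℕ) :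
    tupleLabel n l s j = tupleLabel n l' s j := by
  induction j with
  | zero => rfl
  | succ j ih =>
    show (if tupleDigit n s j = 0 then tupleLabel n l s j else _) =
      if tupleDigit n s j = 0 then tupleLabel n l' s j else _
    rw [ih]
    split_ifs with hs
    · rfl
    · exact h _ (tupleDigit_pred_lt hs)

/-- The scan overwrites its value at each nonzero digit. Which entry of the tuple it ends on does
not matter, since the entries of the tuples in use share their observation and hence their label. -/
theorem exists_tupleLabel_eq {n : ℕ} (l : ℕ → ℕ) {s i j : ℕ} (hij : i < j)
    (hi : tupleDigit n s i ≠ 0) :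
    ∃ i' < j, tupleDigit n s i' ≠ 0 ∧ tupleLabel n l s j = l (tupleDigit n s i' - 1) := by
  induction j with
  | zero => omega
  | succ j ih =>
    show ∃ i' < j + 1, _ ∧ (if tupleDigit n s j = 0 then tupleLabel n l s j
      else l (tupleDigit n s j - 1)) = _
    by_cases hj : tupleDigit n s j = 0
    · rw [if_pos hj]
      have hne : i ≠ j := fun h => hi (h ▸ hj)
      obtain ⟨i', h1, h2⟩ := ih (by omega)
      exact ⟨i', by omega, h2⟩
    · rw [if_neg hj]
      exact ⟨j, j.lt_succ_self, hj, rfl⟩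

/-! ### The subset construction on numbers -/

namespace POMDP

variable {n m : ℕ} {Λ : POMDP (Fin n) (Fin m) ℕ} {O : ℕ → ℕ} {d : ℕ → ℕ → ℕ → ℕ}

theorem isStart_iff (hO : ∀ q : Fin n, O q = Λ.obs q) (o : ℕ) (s : Fin ((n + 1) ^ n)) :
    IsStart n O o s ↔ s = (tupleEquiv n).symm (Λ.startTuple o) := by
  rw [Equiv.eq_symm_apply, funext_iff]
  unfold IsStart
  rw [← Fin.forall_iff (p := fun i : Fin n => (O i = o → tupleDigit n s i = i + 1) ∧
    (O i ≠ o → tupleDigit n s i = 0))]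
  refine forall_congr' fun i => ?_
  rw [hO, startTuple]
  split_ifs with h
  · simp [h, tupleEquiv_eq_some]
  · simp [h, tupleEquiv_eq_none]

theorem DiracPreserving.isUpd_iff (hΛ : Λ.DiracPreserving) (hO : ∀ q : Fin n, O q = Λ.obs q)
    (hd : ∀ (q : Fin n) (a : Fin m) (q' : Fin n), d q a q' = 0 ↔ Λ.δ q a q' = 0)
    (a : Fin m) (o : ℕ) (s s' : Fin ((n + 1) ^ n)) :
    IsUpd n O d a s o s' ↔ s' = (tupleEquiv n).symm (Λ.updTuple (tupleEquiv n s) a o) := by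
  rw [Equiv.eq_symm_apply, funext_iff]
  unfold IsUpd
  rw [← Fin.forall_iff (p := fun i : Fin n =>
    (tupleDigit n s i = 0 → tupleDigit n s' i = 0) ∧ (tupleDigit n s i ≠ 0 →
    (tupleDigit n s' i = 0 → ∀ q < n, O q = o → d (tupleDigit n s i - 1) a q = 0) ∧
    (tupleDigit n s' i ≠ 0 → O (tupleDigit n s' i - 1) = o ∧
      d (tupleDigit n s i - 1) a (tupleDigit n s' i - 1) ≠ 0)))]
  refine forall_congr' fun i => ?_
  rw [updTuple]
  rcases h : tupleEquiv n s i with _ | q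
  · rw [Option.bind_none, tupleEquiv_eq_none]
    simp [tupleEquiv_eq_none.1 h]
  · rw [Option.bind_some]
    rw [tupleEquiv_eq_some] at h
    rcases h' : tupleEquiv n s' i with _ | q'
    · have h0 := tupleEquiv_eq_none.1 h'
      simp only [h, h0, Nat.add_sub_cancel]
      rw [eq_comm (a := none), Option.eq_none_iff_forall_ne_some]
      simp only [ne_eq, hΛ.succ_eq_some, not_and, not_not, Nat.succ_ne_zero, not_true_eq_false,
        not_false_eq_true, forall_const, IsEmpty.forall_iff, true_and, and_true]
      constructor
      · intro h q' ho
        rw [← hd]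
        exact h q' q'.2 ((hO _).trans ho)
      · intro h x hx ho
        exact (hd q a ⟨x, hx⟩).2 (h ⟨x, hx⟩ ((hO ⟨x, hx⟩).symm.trans ho))
    · have h0 := tupleEquiv_eq_some.1 h'
      rw [eq_comm (a := some q'), hΛ.succ_eq_some, ← hO,
        show Λ.δ q a q' ≠ 0 ↔ d q a q' ≠ 0 from (hd q a q').not.symm]
      simp [h, h0]

/-- The transition is a pushforward along the update by the observation of `q'`, which is a sum over
a fiber. Among the `q'` of positive probability the new tuple determines `q'`, as its entry for `e`;
the sum thus has at most one nonzero term and the weight is a single entry of `δ`. -/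
theorem DiracPreserving.tupleWeight_eq (hΛ : Λ.DiracPreserving)
    (hO : ∀ q : Fin n, O q = Λ.obs q)
    (hd : ∀ (q : Fin n) (a : Fin m) (q' : Fin n), d q a q' = 0 ↔ Λ.δ q a q' = 0)
    {D : ℕ → ℕ → ℕ → ℝ≥0∞}
    (hD : ∀ (q : Fin n) (a : Fin m) (q' : Fin n), D q a q' = Λ.δ q a q')
    (e : Fin n) (s : Fin ((n + 1) ^ n)) (a : Fin m) (s' : Fin ((n + 1) ^ n)) :
    tupleWeight n O d D 0 1 e s a s' =
      (Λ.subsetMEMDP (Equiv.refl (Fin n)) (tupleEquiv n)).δ e s a s' := by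
  unfold tupleWeight
  simp only [subsetMEMDP, Equiv.refl_apply]
  rcases h : tupleEquiv n s e with _ | q
  · rw [if_pos (tupleEquiv_eq_none.1 h), Option.elim_none, PMF.pure_apply, hO]
    simp only [isStart_iff hO]
    congr
  · have hq := tupleEquiv_eq_some.1 h
    rw [if_neg (by omega), Option.elim_some, PMF.map_apply, hq, Nat.add_sub_cancel]
    have key : ∀ q', s' = (tupleEquiv n).symm (Λ.updTuple (tupleEquiv n s) a (Λ.obs q')) →
        Λ.δ q a q' ≠ 0 → tupleEquiv n s' e = some q' := by
      intro q' h1 h2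
      rw [h1, Equiv.apply_symm_apply]
      exact hΛ.updTuple_eq_some h h2
    rcases h' : tupleEquiv n s' e with _ | q₀
    · rw [if_pos (tupleEquiv_eq_none.1 h'), eq_comm, ENNReal.tsum_eq_zero]
      intro q'
      split_ifs with h1
      · by_contra h2
        simpa [h'] using key q' h1 h2
      · rfl
    · have hq' := tupleEquiv_eq_some.1 h'
      rw [if_neg (by omega), hq', Nat.add_sub_cancel, hD, hO, tsum_eq_single q₀]
      · simp only [hΛ.isUpd_iff hO hd]
        congr
      · intro q' hne
        split_ifs with h1
        · by_contra h2
          have := key q' h1 h2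
          rw [h'] at this
          exact hne (Option.some.inj this).symm
        · rfl

end POMDP

/-! ### The subset construction on finite descriptions -/

/-- Extend a function on `Fin n` by zero. -/
def extendFin {β : Type*} [Zero β] {n : ℕ} (g : Fin n → β) (i : ℕ) : β :=
  if h : i < n then g ⟨i, h⟩ else 0

theorem extendFin_val {β : Type*} [Zero β] {n : ℕ} (g : Fin n → β) (i : Fin n) :
    extendFin g i = g i := dif_pos i.2

namespace POMDPInstance

/-- The transition probabilities. -/
def prob (I : POMDPInstance) (q a q' : ℕ) : ℚ≥0 :=
  extendFin (fun q => extendFin (fun a => extendFin (I.δ q a).1) a q') q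

theorem prob_val (I : POMDPInstance) (q : Fin I.numStates) (a : Fin I.numActions)
    (q' : Fin I.numStates) : I.prob q a q' = (I.δ q a).1 q' := by
  rw [prob, extendFin_val, extendFin_val, extendFin_val]

end POMDPInstance

theorem RatDist.toPMF_apply {k : ℕ} (w : RatDist k) (i : Fin k) :
    w.toPMF i = ((w.1 i : ℝ≥0) : ℝ≥0∞) := rfl

namespace DiracInstance

/-- The weights of the transitions between tuples. -/
def weight (I : DiracInstance) (e s a s' : ℕ) : ℚ≥0 :=
  tupleWeight I.1.numStates (extendFin I.1.obs) (fun q a q' => (I.1.prob q a q').num) I.1.prob 0 1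
    e s a s'

/-- The subset construction of the POMDP of `I`. -/
def subset (I : DiracInstance) : MEMDP (Fin ((I.1.numStates + 1) ^ I.1.numStates))
    (Fin I.1.numActions) (Fin I.1.numStates) :=
  I.1.toPOMDP.subsetMEMDP (Equiv.refl (Fin I.1.numStates)) (tupleEquiv I.1.numStates)

theorem weight_eq (I : DiracInstance) (e : Fin I.1.numStates)
    (s : Fin ((I.1.numStates + 1) ^ I.1.numStates)) (a : Fin I.1.numActions)
    (s' : Fin ((I.1.numStates + 1) ^ I.1.numStates)) :
    ((I.weight e s a s' : ℝ≥0) : ℝ≥0∞) = I.subset.δ e s a s' := by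
  rw [weight, apply_tupleWeight fun x : ℚ≥0 => ((x : ℝ≥0) : ℝ≥0∞)]
  simp only [NNRat.cast_zero, NNRat.cast_one, ENNReal.coe_zero, ENNReal.coe_one]
  refine I.2.1.tupleWeight_eq (fun q => extendFin_val _ _) (fun q a q' => ?_)
    (fun q a q' => ?_) e s a s'
  · show _ ↔ (I.1.δ q a).toPMF q' = 0
    rw [RatDist.toPMF_apply, I.1.prob_val]
    simp [← not_iff_not, NNRat.num_ne_zero]
  · rw [I.1.prob_val]
    rfl

/-- The subset construction, as a finite description. -/
def toMEMDPInstance (I : DiracInstance) : MEMDPInstance where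
  numStates := (I.1.numStates + 1) ^ I.1.numStates
  numActions := I.1.numActions
  numEnvs := I.1.numStates
  init := ⟨0, by positivity⟩
  label s := tupleLabel I.1.numStates (extendFin I.1.label) s I.1.numStates
  belief := I.1.belief
  δ e s a := ⟨fun s' => I.weight e s a s', by
    -- The rational weights sum to one because their images in `ℝ≥0∞` form a distribution and the
    -- coercions are injective.
    have h : ∑ s' : Fin ((I.1.numStates + 1) ^ I.1.numStates),
        ((I.weight e s a s' : ℝ≥0) : ℝ≥0∞) = 1 := by
      simp only [weight_eq]
      rw [← tsum_fintype (L := .unconditional _), PMF.tsum_coe]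
    have h' : (((∑ s' : Fin ((I.1.numStates + 1) ^ I.1.numStates),
        I.weight e s a s' : ℚ≥0) : ℝ≥0) : ℝ≥0∞) = 1 := by
      rw [← h]
      push_cast
      rfl
    exact_mod_cast h'⟩

theorem value_eq (I : DiracInstance) :
    I.1.toPOMDP.value I.1.belief.toPMF (parityObjective I.1.label) =
      I.toMEMDPInstance.toMEMDP.priorValue I.toMEMDPInstance.belief.toPMF I.toMEMDPInstance.init
        (parityObjective I.toMEMDPInstance.label) := by
  have h1 : I.toMEMDPInstance.toMEMDP = I.subset := by
    unfold MEMDPInstance.toMEMDP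
    show MEMDP.mk _ = MEMDP.mk I.subset.δ
    congr 1
    funext e s a
    ext s'
    exact I.weight_eq e s a s'
  -- The digit `0` codes `none`, so the initial tuple is the number zero.
  have h2 : (tupleEquiv I.1.numStates).symm (fun _ => none) = ⟨0, by positivity⟩ := by
    rw [Equiv.symm_apply_eq]
    funext i
    rw [eq_comm, tupleEquiv_eq_none]
    simp [tupleDigit]
  rw [POMDP.value_eq_priorValue_subsetMEMDP I.1.toPOMDP (Equiv.refl _) (tupleEquiv _) I.2.1 I.2.2
    (f' := I.toMEMDPInstance.label) (fun s i q h => ?_), h1, h2]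
  · rw [Equiv.refl_symm, Equiv.coe_refl, PMF.map_id]
    rfl
  · rw [tupleEquiv_eq_some] at h
    obtain ⟨i', hi', h1, h2⟩ := exists_tupleLabel_eq (extendFin I.1.label) (s := s) i.2
      (show tupleDigit I.1.numStates s i ≠ 0 by omega)
    refine ⟨⟨i', hi'⟩, ⟨_, tupleDigit_pred_lt h1⟩, tupleEquiv_eq_some.2 ?_, h2.trans ?_⟩
    · dsimp only
      omega
    · exact dif_pos (tupleDigit_pred_lt h1)

end DiracInstance

end

noncomputable section

/-! ### The numbers of the input -/

/-- Unary words are also binary words, namely those of `2 ^ n - 1`. The input can thus be read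
uniformly as a list of binary numbers, the sizes being recovered as bit lengths. -/
theorem bits_two_pow_sub_one (n : ℕ) : (2 ^ n - 1).bits = unaryWord n := by
  induction n with
  | zero => simp [unaryWord]
  | succ n ih =>
    have h : 2 ^ (n + 1) - 1 = Nat.bit true (2 ^ n - 1) := by
      have := Nat.one_le_two_pow (n := n)
      rw [Nat.bit_true_apply, pow_succ]
      omega
    rw [h, Nat.bits_append_bit _ _ (fun _ => rfl), ih]
    rfl

theorem getElem?_flatten_ofFn {α : Type*} {k c : ℕ} {f : Fin k → List α}
    (hf : ∀ i, (f i).length = c) (i : Fin k) {j : ℕ} (hj : j < c) :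
    (List.ofFn f).flatten[i * c + j]? = (f i)[j]? := by
  induction k with
  | zero => exact i.elim0
  | succ k ih =>
    rw [List.ofFn_succ, List.flatten_cons]
    refine Fin.cases ?_ (fun i => ?_) i
    · rw [Fin.val_zero, zero_mul, zero_add, List.getElem?_append_left (by rw [hf]; exact hj)]
    · rw [Fin.val_succ, Nat.succ_mul, List.getElem?_append_right (by rw [hf]; omega), hf,
        show (i : ℕ) * c + c + j - c = i * c + j by omega]
      exact ih (fun i => hf i.succ) i

/-- The numerators and denominators. -/
def RatDist.numbers {k : ℕ} (w : RatDist k) : List ℕ :=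
  (List.ofFn fun i => [(w.1 i).num, (w.1 i).den]).flatten

theorem RatDist.numbers_length {k : ℕ} (w : RatDist k) : w.numbers.length = k * 2 :=
  ofFn_flatten_length fun _ => rfl

theorem RatDist.map_bits_numbers {k : ℕ} (w : RatDist k) : w.numbers.map Nat.bits = w.words := by
  simp [RatDist.numbers, RatDist.words, List.map_flatten, List.map_ofFn, Function.comp_def]

namespace POMDPInstance

/-- The numbers described by the words of an instance. -/
def numbers (I : POMDPInstance) : List ℕ :=
  [2 ^ I.numStates - 1, 2 ^ I.numActions - 1] ++ (List.ofFn I.obs ++ (List.ofFn I.label ++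
    (I.belief.numbers ++
      (List.ofFn fun q => (List.ofFn fun a => (I.δ q a).numbers).flatten).flatten)))

theorem map_bits_numbers (I : POMDPInstance) : I.numbers.map Nat.bits = I.words := by
  simp [numbers, words, bits_two_pow_sub_one, List.map_flatten, List.map_ofFn, Function.comp_def,
    RatDist.map_bits_numbers]

theorem getElem?_numbers_obs (I : POMDPInstance) (q : Fin I.numStates) :
    I.numbers[2 + (q : ℕ)]? = some (I.obs q) := by
  rw [numbers, List.getElem?_append_right (by simp), List.getElem?_append_left (by simp)]
  simp

theorem getElem?_numbers_label (I : POMDPInstance) (q : Fin I.numStates) :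
    I.numbers[2 + I.numStates + (q : ℕ)]? = some (I.label q) := by
  rw [numbers, List.getElem?_append_right (by simp; omega), List.getElem?_append_right
    (by simp; omega), List.getElem?_append_left (by simp; omega)]
  simp [show 2 + I.numStates + (q : ℕ) - 2 - I.numStates = q by omega]

theorem getElem?_numbers_belief (I : POMDPInstance) (q : Fin I.numStates) {c : ℕ} (hc : c < 2) :
    I.numbers[2 + 2 * I.numStates + (q * 2 + c)]? =
      some (if c = 0 then (I.belief.1 q).num else (I.belief.1 q).den) := by
  have hq := q.2
  rw [numbers, List.getElem?_append_right (by simp; omega), List.getElem?_append_right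
    (by simp; omega), List.getElem?_append_right (by simp; omega), List.getElem?_append_left
    (by simp [RatDist.numbers_length]; omega)]
  simp only [List.length_ofFn, List.length_cons, List.length_nil]
  rw [show 2 + 2 * I.numStates + ((q : ℕ) * 2 + c) - (0 + 1 + 1) - I.numStates - I.numStates =
    q * 2 + c by omega, RatDist.numbers, getElem?_flatten_ofFn (c := 2) (fun _ => rfl) q hc]
  interval_cases c <;> rfl

theorem getElem?_numbers_prob (I : POMDPInstance) (q : Fin I.numStates) (a : Fin I.numActions)
    (q' : Fin I.numStates) {c : ℕ} (hc : c < 2) :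
    I.numbers[2 + 4 * I.numStates + (q * (I.numActions * (I.numStates * 2)) +
      (a * (I.numStates * 2) + (q' * 2 + c)))]? =
      some (if c = 0 then ((I.δ q a).1 q').num else ((I.δ q a).1 q').den) := by
  rw [numbers, List.getElem?_append_right (by simp; omega), List.getElem?_append_right
    (by simp; omega), List.getElem?_append_right (by simp; omega), List.getElem?_append_right
    (by simp [RatDist.numbers_length]; omega)]
  simp only [List.length_ofFn, List.length_cons, List.length_nil, RatDist.numbers_length]
  have h1 : (q' : ℕ) * 2 + c < I.numStates * 2 := by omega
  have h2 : (a : ℕ) * (I.numStates * 2) + (q' * 2 + c) < I.numActions * (I.numStates * 2) := by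
    have := Nat.mul_le_mul_right (I.numStates * 2) (Nat.succ_le_of_lt a.2)
    rw [Nat.succ_mul] at this
    omega
  rw [show ∀ x, 2 + 4 * I.numStates + x - (0 + 1 + 1) - I.numStates - I.numStates -
    I.numStates * 2 = x by omega, getElem?_flatten_ofFn (fun _ => ofFn_flatten_length fun _ =>
      RatDist.numbers_length _) q h2,
    getElem?_flatten_ofFn (fun _ => RatDist.numbers_length _) a h1,
    RatDist.numbers, getElem?_flatten_ofFn (c := 2) (fun _ => rfl) q' hc]
  interval_cases c <;> rfl

end POMDPInstance

/-- Guarantees that every number of the input fits into one digit of the base `2 ^ (n + 1)`, where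
`n` is the length of the input. -/
theorem length_le_length_encodeWords {L : List (List Bool)} {w : List Bool} (h : w ∈ L) :
    w.length ≤ (encodeWords L).length := by
  unfold encodeWords
  rw [List.length_flatten, List.map_map]
  refine le_trans ?_ (List.single_le_sum (fun _ _ => Nat.zero_le _) _ (List.mem_map_of_mem h))
  simp

/-! ### Reading the instance from the registers -/

/-- The number described by the `k`-th word. -/
def inputWord (u : Fin 3 → ℕ) (k : ℕ) : ℕ := u 2 / u 0 ^ k % u 0

def inputStates (u : Fin 3 → ℕ) : ℕ := (inputWord u 0).size

def inputActions (u : Fin 3 → ℕ) : ℕ := (inputWord u 1).size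

def inputObs (u : Fin 3 → ℕ) (q : ℕ) : ℕ := inputWord u (2 + q)

def inputLabel (u : Fin 3 → ℕ) (q : ℕ) : ℕ := inputWord u (2 + inputStates u + q)

/-- The numerator or the denominator of the initial belief. -/
def inputBelief (c : ℕ) (u : Fin 3 → ℕ) (q : ℕ) : ℕ :=
  inputWord u (2 + 2 * inputStates u + (q * 2 + c))

/-- The numerator or the denominator of a transition probability. -/
def inputProb (c : ℕ) (u : Fin 3 → ℕ) (q a q' : ℕ) : ℕ :=
  inputWord u (2 + 4 * inputStates u + (q * (inputActions u * (inputStates u * 2)) +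
    (a * (inputStates u * 2) + (q' * 2 + c))))

/-- The number of tuples. -/
def inputTuples (u : Fin 3 → ℕ) : ℕ :=
  Nat.rec (motive := fun _ => ℕ) 1 (fun _ acc => min (acc * (inputStates u + 1)) (u 1))
    (inputStates u)

/-! ### Correctness of the values read from the registers -/

section Correct

variable (I : POMDPInstance)

theorem inputWord_encodePOMDP (k : ℕ) :
    inputWord (readInput (encodePOMDP I)) k = I.numbers[k]?.getD 0 := by
  have h := readInput_digit (b := 2 ^ ((encodePOMDP I).length + 1)) (by positivity) I.numbers
    (fun n hn => Nat.pow_le_pow_right two_pos ((length_le_length_encodeWords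
      (List.mem_map_of_mem hn)).trans (by rw [I.map_bits_numbers]; exact Nat.le_succ _))) k
  rw [I.map_bits_numbers] at h
  exact h

theorem inputStates_encodePOMDP :
    inputStates (readInput (encodePOMDP I)) = I.numStates := by
  rw [inputStates, inputWord_encodePOMDP, ← Nat.size_eq_bits_len]
  show (2 ^ I.numStates - 1).bits.length = _
  simp [bits_two_pow_sub_one, unaryWord]

theorem inputActions_encodePOMDP :
    inputActions (readInput (encodePOMDP I)) = I.numActions := by
  rw [inputActions, inputWord_encodePOMDP, ← Nat.size_eq_bits_len]
  show (2 ^ I.numActions - 1).bits.length = _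
  simp [bits_two_pow_sub_one, unaryWord]

theorem inputObs_encodePOMDP (q : Fin I.numStates) :
    inputObs (readInput (encodePOMDP I)) q = I.obs q := by
  rw [inputObs, inputWord_encodePOMDP, I.getElem?_numbers_obs, Option.getD_some]

theorem inputLabel_encodePOMDP (q : Fin I.numStates) :
    inputLabel (readInput (encodePOMDP I)) q = I.label q := by
  rw [inputLabel, inputWord_encodePOMDP, inputStates_encodePOMDP, I.getElem?_numbers_label,
    Option.getD_some]

theorem inputBelief_encodePOMDP (q : Fin I.numStates) {c : ℕ} (hc : c < 2) :
    inputBelief c (readInput (encodePOMDP I)) q =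
      if c = 0 then (I.belief.1 q).num else (I.belief.1 q).den := by
  rw [inputBelief, inputWord_encodePOMDP, inputStates_encodePOMDP, I.getElem?_numbers_belief _ hc,
    Option.getD_some]

theorem inputProb_encodePOMDP (q : Fin I.numStates) (a : Fin I.numActions) (q' : Fin I.numStates)
    {c : ℕ} (hc : c < 2) :
    inputProb c (readInput (encodePOMDP I)) q a q' =
      if c = 0 then ((I.δ q a).1 q').num else ((I.δ q a).1 q').den := by
  rw [inputProb, inputWord_encodePOMDP, inputStates_encodePOMDP, inputActions_encodePOMDP,
    I.getElem?_numbers_prob _ _ _ hc, Option.getD_some]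

/-- The number of states is written in unary and so is at most the length of the input; hence `(n +
1) ^ n` stays below the second register and the capped power is exact. Providing this cap is the
purpose of that register. -/
theorem inputTuples_encodePOMDP :
    inputTuples (readInput (encodePOMDP I)) = (I.numStates + 1) ^ I.numStates := by
  have hn : I.numStates ≤ (encodePOMDP I).length := by
    have := length_le_length_encodeWords (L := I.words) (w := unaryWord I.numStates)
      (by simp [POMDPInstance.words])
    rwa [unaryWord, List.length_replicate] at this
  rw [inputTuples, inputStates_encodePOMDP]
  refine UnaryComp.rec_min_mul (Nat.succ_pos _) ?_
  show _ ≤ (2 ^ ((encodePOMDP I).length + 1)) ^ (encodePOMDP I).length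
  refine (Nat.pow_le_pow_left ?_ _).trans (Nat.pow_le_pow_right (by positivity) hn)
  exact (Nat.succ_le_of_lt Nat.lt_two_pow_self).trans (Nat.pow_le_pow_right two_pos (by omega))

end Correct

/-! ### Computability of the subset construction on registers -/

section Computable

variable {m : ℕ}

theorem UnaryComp.lift {f : (Fin m → ℕ) → ℕ} (hf : UnaryComp f) :
    UnaryComp fun w : Fin (m + 1) → ℕ => f fun i => w i.succ :=
  hf.comp fun i => .var i.succ

variable {X : (Fin m → ℕ) → Fin 3 → ℕ} {f g h k : (Fin m → ℕ) → ℕ}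

namespace UnaryComp

theorem inputWord (hX : ∀ i, UnaryComp fun v => X v i) (hf : UnaryComp f) :
    UnaryComp fun v => inputWord (X v) (f v) :=
  ((hX 2).divPow (hX 0) hf).mod (hX 0)

theorem inputStates (hX : ∀ i, UnaryComp fun v => X v i) : UnaryComp fun v => inputStates (X v) :=
  (inputWord hX (const 0)).size

theorem inputActions (hX : ∀ i, UnaryComp fun v => X v i) :
    UnaryComp fun v => inputActions (X v) :=
  (inputWord hX (const 1)).size

theorem inputObs (hX : ∀ i, UnaryComp fun v => X v i) (hf : UnaryComp f) :
    UnaryComp fun v => inputObs (X v) (f v) :=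
  inputWord hX ((const 2).add hf)

theorem inputLabel (hX : ∀ i, UnaryComp fun v => X v i) (hf : UnaryComp f) :
    UnaryComp fun v => inputLabel (X v) (f v) :=
  inputWord hX (((const 2).add (inputStates hX)).add hf)

theorem inputBelief (c : ℕ) (hX : ∀ i, UnaryComp fun v => X v i) (hf : UnaryComp f) :
    UnaryComp fun v => inputBelief c (X v) (f v) :=
  inputWord hX (((const 2).add ((const 2).mul (inputStates hX))).add
    ((hf.mul (const 2)).add (const c)))

theorem inputProb (c : ℕ) (hX : ∀ i, UnaryComp fun v => X v i) (hf : UnaryComp f)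
    (hg : UnaryComp g) (hh : UnaryComp h) :
    UnaryComp fun v => inputProb c (X v) (f v) (g v) (h v) :=
  inputWord hX (((const 2).add ((const 4).mul (inputStates hX))).add
    ((hf.mul ((inputActions hX).mul ((inputStates hX).mul (const 2)))).add
      ((hg.mul ((inputStates hX).mul (const 2))).add ((hh.mul (const 2)).add (const c)))))

theorem inputTuples (hX : ∀ i, UnaryComp fun v => X v i) : UnaryComp fun v => inputTuples (X v) :=
  cappedPow (hX 1) (inputStates hX).succ (inputStates hX)

theorem tupleDigit (hf : UnaryComp f) (hg : UnaryComp g) (hh : UnaryComp h) :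
    UnaryComp fun v => tupleDigit (f v) (g v) (h v) :=
  (hg.divPow hf.succ hh).mod hf.succ

theorem tupleLabel (hX : ∀ i, UnaryComp fun v => X v i) (hf : UnaryComp f) :
    UnaryComp fun v => tupleLabel (_root_.inputStates (X v)) (_root_.inputLabel (X v)) (f v)
      (_root_.inputStates (X v)) := by
  -- Every label is a digit of the third register, which therefore bounds all values of the
  -- recursion.
  refine natRec (cnt := fun v => _root_.inputStates (X v)) (init := fun _ => 0)
    (step := fun v i acc => if _root_.tupleDigit (_root_.inputStates (X v)) (f v) i = 0 then acc
      else _root_.inputLabel (X v) (_root_.tupleDigit (_root_.inputStates (X v)) (f v) i - 1))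
    (inputStates hX) (const 0) ?_ (bd := fun v => X v 2) (hX 2).1 ?_
  · have hX' := fun i => (hX i).lift.lift
    have hd := tupleDigit (inputStates hX') hf.lift.lift (var 0)
    exact UnaryPred.ite (.eq hd (const 0)) (var 1) (inputLabel hX' hd.pred)
  · intro v j _
    induction j with
    | zero => exact Nat.zero_le _
    | succ j ih =>
      dsimp only
      split_ifs
      · exact ih (by omega)
      · exact (Nat.mod_le _ _).trans (Nat.div_le_self _ _)

end UnaryComp

namespace UnaryPred

theorem isStart (hX : ∀ i, UnaryComp fun v => X v i) (hf : UnaryComp f) (hg : UnaryComp g) :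
    UnaryPred fun v => IsStart (inputStates (X v)) (inputObs (X v)) (f v) (g v) := by
  have hX' := fun i => (hX i).lift
  have hd := (UnaryComp.inputStates hX').tupleDigit hg.lift (.var 0)
  have ho := eq (UnaryComp.inputObs hX' (.var 0)) hf.lift
  exact ball (p := fun v i => (inputObs (X v) i = f v →
      tupleDigit (inputStates (X v)) (g v) i = i + 1) ∧ (inputObs (X v) i ≠ f v →
      tupleDigit (inputStates (X v)) (g v) i = 0)) (UnaryComp.inputStates hX)
    ((ho.imp (eq hd (UnaryComp.var 0).succ)).and (ho.not.imp (eq hd (.const 0))))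

theorem isUpd (hX : ∀ i, UnaryComp fun v => X v i) (hf : UnaryComp f) (hg : UnaryComp g)
    (hh : UnaryComp h) (hk : UnaryComp k) :
    UnaryPred fun v => IsUpd (inputStates (X v)) (inputObs (X v)) (inputProb 0 (X v)) (f v) (g v)
      (h v) (k v) := by
  have hX' := fun i => (hX i).lift
  have hd := (UnaryComp.inputStates hX').tupleDigit hg.lift (.var 0)
  have hd' := (UnaryComp.inputStates hX').tupleDigit hk.lift (.var 0)
  have h0 := eq hd (.const 0)
  have h0' := eq hd' (.const 0)
  refine ball (p := fun v i =>
    (tupleDigit (inputStates (X v)) (g v) i = 0 → tupleDigit (inputStates (X v)) (k v) i = 0) ∧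
    (tupleDigit (inputStates (X v)) (g v) i ≠ 0 →
      (tupleDigit (inputStates (X v)) (k v) i = 0 → ∀ q < inputStates (X v),
        inputObs (X v) q = h v →
        inputProb 0 (X v) (tupleDigit (inputStates (X v)) (g v) i - 1) (f v) q = 0) ∧
      (tupleDigit (inputStates (X v)) (k v) i ≠ 0 →
        inputObs (X v) (tupleDigit (inputStates (X v)) (k v) i - 1) = h v ∧
        inputProb 0 (X v) (tupleDigit (inputStates (X v)) (g v) i - 1) (f v)
          (tupleDigit (inputStates (X v)) (k v) i - 1) ≠ 0))) (UnaryComp.inputStates hX)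
    ((h0.imp h0').and (h0.not.imp ((h0'.imp ?_).and (h0'.not.imp
      ((eq (UnaryComp.inputObs hX' hd'.pred) hh.lift).and
        (eq (UnaryComp.inputProb 0 hX' hd.pred hf.lift hd'.pred) (.const 0)).not)))))
  have hX'' := fun i => (hX' i).lift
  exact ball (p := fun (w : Fin (m + 1) → ℕ) q =>
    inputObs (X fun i => w i.succ) q = h (fun i => w i.succ) →
      inputProb 0 (X fun i => w i.succ)
        (tupleDigit (inputStates (X fun i => w i.succ)) (g fun i => w i.succ) (w 0) - 1)
        (f fun i => w i.succ) q = 0) (UnaryComp.inputStates hX')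
    ((eq (UnaryComp.inputObs hX'' (.var 0)) hh.lift.lift).imp
      (eq (UnaryComp.inputProb 0 hX'' hd.pred.lift hf.lift.lift (.var 0)) (.const 0)))

end UnaryPred

open Classical in
theorem UnaryComp.tupleWeight (c : ℕ) (hX : ∀ i, UnaryComp fun v => X v i) (hf : UnaryComp f)
    (hg : UnaryComp g) (hh : UnaryComp h) (hk : UnaryComp k) :
    UnaryComp fun v => tupleWeight (_root_.inputStates (X v)) (_root_.inputObs (X v))
      (_root_.inputProb 0 (X v)) (_root_.inputProb c (X v)) c 1 (f v) (g v) (h v) (k v) := by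
  have hd := (inputStates hX).tupleDigit hg hf
  have hd' := (inputStates hX).tupleDigit hk hf
  exact UnaryPred.ite (.eq hd (const 0))
    (UnaryPred.ite (.isStart hX (inputObs hX hf) hk) (const 1) (const c))
    (UnaryPred.ite (.eq hd' (const 0)) (const c)
      (UnaryPred.ite (.isUpd hX hh hg (inputObs hX hd'.pred) hk)
        (inputProb c hX hd.pred hh hd'.pred) (const c)))

end Computable

/-! ### Writing the subset construction -/

theorem encodeWords_append (L L' : List (List Bool)) :
    encodeWords (L ++ L') = encodeWords L ++ encodeWords L' := by
  simp [encodeWords]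

theorem encodeWords_flatten_ofFn {k : ℕ} {f : Fin k → List (List Bool)}
    {g : ℕ → List (Option Bool)} (h : ∀ i, encodeWords (f i) = g i) :
    encodeWords (List.ofFn f).flatten = (List.range k).flatMap g := by
  induction k generalizing g with
  | zero => rfl
  | succ k ih =>
    rw [List.ofFn_succ, List.flatten_cons, encodeWords_append, List.range_succ_eq_map,
      List.flatMap_cons, List.flatMap_map, h, ih (g := fun i => g (i + 1)) fun i => h i.succ]
    rfl

theorem encodeWords_ofFn {k : ℕ} {f : Fin k → List Bool}
    {g : ℕ → List (Option Bool)} (h : ∀ i, (f i).map some ++ [none] = g i) :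
    encodeWords (List.ofFn f) = (List.range k).flatMap g := by
  rw [← encodeWords_flatten_ofFn (f := fun i => [f i]) fun i => by simpa [encodeWords] using h i]
  congr 1
  induction k generalizing g with
  | zero => rfl
  | succ k ih =>
    rw [List.ofFn_succ, List.ofFn_succ, List.flatten_cons,
      ← ih (g := fun i => g (i + 1)) fun i => h i.succ]
    rfl

/-- The output of the reduction. -/
def subsetOutput (u : Fin 3 → ℕ) : List (Option Bool) :=
  (((unaryWord (inputTuples u)).map some ++ [none]) ++
  (((unaryWord (inputActions u)).map some ++ [none]) ++
  (((unaryWord (inputStates u)).map some ++ [none]) ++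
  ((unaryWord 0).map some ++ [none])))) ++
  ((List.range (inputTuples u)).flatMap (fun s =>
    (tupleLabel (inputStates u) (inputLabel u) s (inputStates u)).bits.map some ++ [none]) ++
  ((List.range (inputStates u)).flatMap (fun q =>
    ((inputBelief 0 u q).bits.map some ++ [none]) ++
      ((inputBelief 1 u q).bits.map some ++ [none])) ++
  (List.range (inputStates u)).flatMap fun e => (List.range (inputTuples u)).flatMap fun s =>
    (List.range (inputActions u)).flatMap fun a => (List.range (inputTuples u)).flatMap fun s' =>
      ((tupleWeight (inputStates u) (inputObs u) (inputProb 0 u) (inputProb 0 u) 0 1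
        e s a s').bits.map some ++ [none]) ++
      ((tupleWeight (inputStates u) (inputObs u) (inputProb 0 u) (inputProb 1 u) 1 1
        e s a s').bits.map some ++ [none])))

theorem emits_subsetOutput : Emits subsetOutput := by
  have h0 : ∀ i, UnaryComp fun v : Fin 3 → ℕ => v i := fun i => .var i
  have h1 := fun i => (h0 i).lift
  have h2 := fun i => (h1 i).lift
  have h3 := fun i => (h2 i).lift
  have h4 := fun i => (h3 i).lift
  refine ((Emits.unary (.inputTuples h0)).append ((Emits.unary (.inputActions h0)).append
    ((Emits.unary (.inputStates h0)).append (Emits.unary (.const 0))))).append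
    ((Emits.flatMap_range (F := fun u s => (tupleLabel (inputStates u) (inputLabel u) s
      (inputStates u)).bits.map some ++ [none]) (.inputTuples h0)
      (.bits (.tupleLabel h1 (.var 0)))).append
    ((Emits.flatMap_range (F := fun u q => ((inputBelief 0 u q).bits.map some ++ [none]) ++
      ((inputBelief 1 u q).bits.map some ++ [none])) (.inputStates h0)
      ((Emits.bits (.inputBelief 0 h1 (.var 0))).append
        (.bits (.inputBelief 1 h1 (.var 0))))).append ?_))
  refine Emits.flatMap_range (F := fun u e => (List.range (inputTuples u)).flatMap fun s =>
    (List.range (inputActions u)).flatMap fun a => (List.range (inputTuples u)).flatMap fun s' =>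
      ((tupleWeight (inputStates u) (inputObs u) (inputProb 0 u) (inputProb 0 u) 0 1
        e s a s').bits.map some ++ [none]) ++
      ((tupleWeight (inputStates u) (inputObs u) (inputProb 0 u) (inputProb 1 u) 1 1
        e s a s').bits.map some ++ [none])) (.inputStates h0) ?_
  refine Emits.flatMap_range (m := 4) (F := fun w s =>
    (List.range (inputActions fun i => w i.succ)).flatMap fun a =>
      (List.range (inputTuples fun i => w i.succ)).flatMap fun s' =>
      ((tupleWeight (inputStates fun i => w i.succ) (inputObs fun i => w i.succ)
        (inputProb 0 fun i => w i.succ) (inputProb 0 fun i => w i.succ) 0 1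
        (w 0) s a s').bits.map some ++ [none]) ++
      ((tupleWeight (inputStates fun i => w i.succ) (inputObs fun i => w i.succ)
        (inputProb 0 fun i => w i.succ) (inputProb 1 fun i => w i.succ) 1 1
        (w 0) s a s').bits.map some ++ [none])) (.inputTuples h1) ?_
  refine Emits.flatMap_range (m := 5) (F := fun w a =>
      (List.range (inputTuples fun i => w i.succ.succ)).flatMap fun s' =>
      ((tupleWeight (inputStates fun i => w i.succ.succ) (inputObs fun i => w i.succ.succ)
        (inputProb 0 fun i => w i.succ.succ) (inputProb 0 fun i => w i.succ.succ) 0 1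
        (w 1) (w 0) a s').bits.map some ++ [none]) ++
      ((tupleWeight (inputStates fun i => w i.succ.succ) (inputObs fun i => w i.succ.succ)
        (inputProb 0 fun i => w i.succ.succ) (inputProb 1 fun i => w i.succ.succ) 1 1
        (w 1) (w 0) a s').bits.map some ++ [none])) (.inputActions h2) ?_
  refine Emits.flatMap_range (m := 6) (F := fun w s' =>
      ((tupleWeight (inputStates fun i => w i.succ.succ.succ)
        (inputObs fun i => w i.succ.succ.succ) (inputProb 0 fun i => w i.succ.succ.succ)
        (inputProb 0 fun i => w i.succ.succ.succ) 0 1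
        (w 2) (w 1) (w 0) s').bits.map some ++ [none]) ++
      ((tupleWeight (inputStates fun i => w i.succ.succ.succ)
        (inputObs fun i => w i.succ.succ.succ) (inputProb 0 fun i => w i.succ.succ.succ)
        (inputProb 1 fun i => w i.succ.succ.succ) 1 1
        (w 2) (w 1) (w 0) s').bits.map some ++ [none])) (.inputTuples h3) ?_
  -- Each nested loop puts its index in front of the arguments: positions `3, 2, 1, 0` hold the
  -- environment, the old tuple, the action and the new tuple.
  exact (Emits.bits (.tupleWeight 0 h4 (.var 3) (.var 2) (.var 1) (.var 0))).append
    (.bits (.tupleWeight 1 h4 (.var 3) (.var 2) (.var 1) (.var 0)))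

theorem RatDist.encodeWords_words {k : ℕ} (w : RatDist k) {g g' : ℕ → ℕ}
    (h : ∀ i : Fin k, (w.1 i).num = g i) (h' : ∀ i : Fin k, (w.1 i).den = g' i) :
    encodeWords w.words = (List.range k).flatMap fun i =>
      ((g i).bits.map some ++ [none]) ++ ((g' i).bits.map some ++ [none]) :=
  encodeWords_flatten_ofFn fun i => by simp [encodeWords, h, h']

namespace DiracInstance

theorem weight_num (I : DiracInstance) (e : Fin I.1.numStates) (a : Fin I.1.numActions)
    (s s' : ℕ) : (I.weight e s a s').num =
      tupleWeight I.1.numStates (inputObs (readInput (encodePOMDP I.1)))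
        (inputProb 0 (readInput (encodePOMDP I.1))) (inputProb 0 (readInput (encodePOMDP I.1)))
        0 1 e s a s' := by
  have hp : ∀ q < I.1.numStates, ∀ q' < I.1.numStates, (I.1.prob q a q').num =
      inputProb 0 (readInput (encodePOMDP I.1)) q a q' := fun q hq q' hq' => by
    rw [I.1.prob_val ⟨q, hq⟩ a ⟨q', hq'⟩, inputProb_encodePOMDP I.1 ⟨q, hq⟩ a ⟨q', hq'⟩ two_pos,
      if_pos rfl]
  rw [weight, apply_tupleWeight NNRat.num]
  refine tupleWeight_congr e.2 (fun q hq => ?_) hp hp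
  rw [extendFin_val I.1.obs ⟨q, hq⟩, inputObs_encodePOMDP I.1 ⟨q, hq⟩]

/-- The defaults are `1` and `1` because both rationals `0` and `1` have denominator `1`. The
impossible transitions are still detected by the numerators. -/
theorem weight_den (I : DiracInstance) (e : Fin I.1.numStates) (a : Fin I.1.numActions)
    (s s' : ℕ) : (I.weight e s a s').den =
      tupleWeight I.1.numStates (inputObs (readInput (encodePOMDP I.1)))
        (inputProb 0 (readInput (encodePOMDP I.1))) (inputProb 1 (readInput (encodePOMDP I.1)))
        1 1 e s a s' := by
  rw [weight, apply_tupleWeight NNRat.den]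
  refine tupleWeight_congr e.2 (fun q hq => ?_) (fun q hq q' hq' => ?_) (fun q hq q' hq' => ?_)
  · rw [extendFin_val I.1.obs ⟨q, hq⟩, inputObs_encodePOMDP I.1 ⟨q, hq⟩]
  · rw [I.1.prob_val ⟨q, hq⟩ a ⟨q', hq'⟩, inputProb_encodePOMDP I.1 ⟨q, hq⟩ a ⟨q', hq'⟩ two_pos,
      if_pos rfl]
  · rw [I.1.prob_val ⟨q, hq⟩ a ⟨q', hq'⟩, inputProb_encodePOMDP I.1 ⟨q, hq⟩ a ⟨q', hq'⟩ one_lt_two,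
      if_neg one_ne_zero]

theorem encodeMEMDP_toMEMDPInstance (I : DiracInstance) :
    encodeMEMDP I.toMEMDPInstance = subsetOutput (readInput (encodePOMDP I.1)) := by
  rw [encodeMEMDP, MEMDPInstance.words, subsetOutput, inputStates_encodePOMDP,
    inputActions_encodePOMDP, inputTuples_encodePOMDP, encodeWords_append, encodeWords_append,
    encodeWords_append]
  refine congrArg₂ _ ?_ (congrArg₂ _ ?_ (congrArg₂ _ ?_ ?_))
  · simp [encodeWords, toMEMDPInstance]
  · refine encodeWords_ofFn fun s => ?_
    show (tupleLabel I.1.numStates (extendFin I.1.label) s I.1.numStates).bits.map some ++ _ = _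
    rw [tupleLabel_congr fun q hq => ?_]
    rw [extendFin_val I.1.label ⟨q, hq⟩, inputLabel_encodePOMDP I.1 ⟨q, hq⟩]
  · refine RatDist.encodeWords_words I.1.belief (fun q => ?_) fun q => ?_
    · rw [inputBelief_encodePOMDP I.1 q two_pos, if_pos rfl]
    · rw [inputBelief_encodePOMDP I.1 q one_lt_two, if_neg one_ne_zero]
  · refine encodeWords_flatten_ofFn fun e => encodeWords_flatten_ofFn fun s =>
      encodeWords_flatten_ofFn fun a => ?_
    exact (I.toMEMDPInstance.δ e s a).encodeWords_words (fun s' => I.weight_num e a s s')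
      fun s' => I.weight_den e a s s'

theorem computableInExpTime_toMEMDPInstance : ComputableInExpTime
    (fun I : DiracInstance => encodePOMDP I.1) encodeMEMDP toMEMDPInstance :=
  emits_subsetOutput.computableInExpTime encodeMEMDP_toMEMDPInstance

end DiracInstance

end

theorem mainTheorem5 :
    (∃ F : DiracInstance → MEMDPInstance,
      ComputableInExpTime (fun I : DiracInstance => encodePOMDP I.1) encodeMEMDP F ∧
      ∀ I : DiracInstance, (F I).numActions = I.1.numActions ∧
        I.1.toPOMDP.value I.1.belief.toPMF (parityObjective I.1.label) =
          (F I).toMEMDP.priorValue (F I).belief.toPMF (F I).init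
            (parityObjective (F I).label)) ∧
    (∃ p : Polynomial ℕ, ∀ (Q A Ω : Type*) [Finite Q] [Nonempty Q] [Finite A] [Nonempty A]
      (Λ : POMDP Q A Ω) (f : Q → ℕ) (b : PMF Q),
      Λ.DiracPreserving → Λ.ObsCompatible f →
      ∃ (N K : ℕ) (Γ : MEMDP (Fin N) A (Fin K)) (f' : Fin N → ℕ) (b' : PMF (Fin K))
        (q' : Fin N),
        N ≤ 2 ^ p.eval (Nat.card Q) ∧ K ≤ 2 ^ p.eval (Nat.card Q) ∧
        Λ.value b (parityObjective f) = Γ.priorValue b' q' (parityObjective f')) := by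
  refine ⟨⟨DiracInstance.toMEMDPInstance, DiracInstance.computableInExpTime_toMEMDPInstance,
    fun I => ⟨rfl, I.value_eq⟩⟩, Polynomial.X ^ 2, fun Q A Ω _ _ _ _ Λ f b hΛ hf => ?_⟩
  simp only [Polynomial.eval_pow, Polynomial.eval_X]
  exact Λ.exists_subsetMEMDP_value_eq f b hΛ hf
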